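/- Let $\Pi^3=[0,1]^3$ with periodic boundary conditions, let $c\in\mathbb R$, and let $p\in C^\infty((0,\infty))$ be real-valued with $p'(r)>0$ for all $r>0$. For angles $(\theta,\varphi)$ put $\Omega=(\sin\theta\cos\varphi,\ \sin\theta\sin\varphi,\ \cos\theta)^T$, and let $P_{\Omega^\perp}=\mathrm{Id}-\Omega\otimes\Omega$. Consider on $\Pi^3$ the inviscid system $$\partial_t\rho+\nabla_x\cdot(\rho\,\Omega)=0,\qquad \rho\,\big(\partial_t\Omega+c\,(\Omega\cdot\nabla_x)\Omega\big)+P_{\Omega^\perp}\nabla_x\big(p(\rho)\big)=0 .$$ Let $m>5/2$ be real and let the initial data $\rho_0,\theta_0,\varphi_0:\Pi^3\to\mathbb R$ belong to the periodic Sobolev space $H^m(\Pi^3)$ (and be identified with their continuous representatives), with $\rho_0>0$ and $\sin\theta_0>0$ everywhere. Then there exist a time $T>0$ and a solution $(\rho,\theta,\varphi)$ of the system on $[0,T]$ (the equations holding for almost every $t$ and every $x$), with all three components real-valued and in $$L^\infty\big(0,T;H^m(\Pi^3)\big)\cap H^1\big(0,T;H^{m-1}(\Pi^3)\big),$$ with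 $(\rho,\theta,\varphi)|_{t=0}=(\rho_0,\theta_0,\varphi_0)$ and $\rho>0$ on $[0,T]\times\Pi^3$; moreover $\sin\theta>0$ on $[0,T]\times\Pi^3$. This solution is unique: every solution on $[0,T]$ in the same class, with the same initial data and with positive density, coincides with it on $[0,T]$. (Elements of the class are identified with their representatives that are continuous on $[0,T]\times\Pi^3$.) -/

import Mathlib

open MeasureTheory Set
open scoped ContDiff

noncomputable section

namespace SelfAlign

/-- The periodic cube, i.e. `[0,1]³` with opposite faces identified. -/
abbrev Torus : Type := UnitAddTorus (Fin 3)

/-- The squared `H^s` norm (`s` real) of a continuous function on the periodic cube, through its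
Fourier coefficients: `∑ₖ (1 + |k|²)^s |f̂(k)|²`, with value `∞` if `f` is not in `H^s`. For
`s > 3/2` every class in `H^s` has exactly one continuous representative, so in this range
continuous functions with finite norm are all of `H^s`. -/
def sobolevNormSq (s : ℝ) (f : C(Torus, ℝ)) : ENNReal :=
  ∑' k : Fin 3 → ℤ, ENNReal.ofReal
    ((1 + ∑ i, (k i : ℝ) ^ 2) ^ s * ‖UnitAddTorus.mFourierCoeff (fun x => (f x : ℂ)) k‖ ^ 2)

/-- `f ∈ H^s` -/
def MemH (s : ℝ) (f : C(Torus, ℝ)) : Prop := sobolevNormSq s f < ⊤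

/-- `u ∈ L^∞(0,T; H^s)` -/
def MemLinftyH (T s : ℝ) (u : ℝ → C(Torus, ℝ)) : Prop :=
  AEStronglyMeasurable u (volume.restrict (Ioo 0 T)) ∧
    ∃ M : NNReal, ∀ᵐ t ∂volume.restrict (Ioo 0 T), sobolevNormSq s (u t) ≤ M

/-- `u ∈ L²(0,T; H^s)` -/
def MemL2H (T s : ℝ) (u : ℝ → C(Torus, ℝ)) : Prop :=
  AEStronglyMeasurable u (volume.restrict (Ioo 0 T)) ∧
    ∫⁻ t in Ioo 0 T, sobolevNormSq s (u t) < ⊤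

/-- `v` is the weak time derivative of `u` on `(0,T)`: `∫ ψ' u dt = - ∫ ψ v dt` for every
test function `ψ ∈ C_c^∞((0,T))`. -/
def IsWeakTimeDeriv (T : ℝ) (u v : ℝ → C(Torus, ℝ)) : Prop :=
  ∀ ψ : ℝ → ℝ, ContDiff ℝ ∞ ψ → HasCompactSupport ψ → tsupport ψ ⊆ Ioo 0 T →
    ∫ t in Ioo 0 T, deriv ψ t • u t = -∫ t in Ioo 0 T, ψ t • v t

/-- `u ∈ H¹(0,T; H^s)` -/
def MemH1H (T s : ℝ) (u : ℝ → C(Torus, ℝ)) : Prop :=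
  MemL2H T s u ∧ ∃ v : ℝ → C(Torus, ℝ), MemL2H T s v ∧ IsWeakTimeDeriv T u v

/-- The class `L^∞(0,T; H^m) ∩ H¹(0,T; H^{m-1})`, each element given by its representative that is
continuous in time on `[0,T]` (which exists and is unique if `m - 1 > 3/2`). -/
def InSolutionClass (T m : ℝ) (u : ℝ → C(Torus, ℝ)) : Prop :=
  ContinuousOn u (Icc 0 T) ∧ MemLinftyH T m u ∧ MemH1H T (m - 1) u

/-- The partial derivative `∂F/∂xᵢ` at `x` of a function on the periodic cube. -/
def pderiv {E : Type*} [NormedAddCommGroup E] [NormedSpace ℝ E]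
    (i : Fin 3) (F : Torus → E) (x : Torus) : E :=
  deriv (fun r : ℝ => F (x + Pi.single i (r : UnitAddCircle))) 0

/-- The gradient of a scalar function. -/
def grad (f : Torus → ℝ) (x : Torus) : Fin 3 → ℝ := fun i => pderiv i f x

/-- The divergence of a vector field. -/
def divergence (F : Torus → Fin 3 → ℝ) (x : Torus) : ℝ := ∑ i, pderiv i (fun y => F y i) x

/-- The directional derivative `(a · ∇) F`. -/
def advect (a : Fin 3 → ℝ) (F : Torus → Fin 3 → ℝ) (x : Torus) : Fin 3 → ℝ :=
  ∑ i, a i • pderiv i F x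

/-- The orthogonal projection `a - (n · a) n` onto the plane normal to a unit vector `n`. -/
def projPerp (n a : Fin 3 → ℝ) : Fin 3 → ℝ := a - (n ⬝ᵥ a) • n

/-- The unit vector with spherical angles `(θ, φ)`. -/
def direction (θ φ : ℝ) : Fin 3 → ℝ :=
  ![Real.sin θ * Real.cos φ, Real.sin θ * Real.sin φ, Real.cos θ]

/-- The direction field `Ω` with spherical angles `θ(x)`, `φ(x)`. -/
def directionField (θ φ : C(Torus, ℝ)) (x : Torus) : Fin 3 → ℝ := direction (θ x) (φ x)

/-- `(ρ, θ, φ)` is a solution on `[0,T]`, with `ρ > 0`, in `L^∞(0,T; H^m) ∩ H¹(0,T; H^{m-1})`, of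

`∂ₜρ + ∇·(ρΩ) = 0`,  `ρ (∂ₜΩ + c (Ω·∇)Ω) + P_{Ω^⊥} ∇(p(ρ)) = 0`,  `Ω = Ω(θ, φ)`,

with initial data `(ρ₀, θ₀, φ₀)`. The equations hold for almost every `t` and every `x`: if
`m > 5/2`, functions of the class are `C¹` in `x` for almost every `t`, and for almost every `t`
they have a time derivative. -/
structure IsSolution (c : ℝ) (p : ℝ → ℝ) (m T : ℝ) (ρ₀ θ₀ φ₀ : C(Torus, ℝ))
    (ρ θ φ : ℝ → C(Torus, ℝ)) : Prop where
  class_density : InSolutionClass T m ρ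
  class_theta : InSolutionClass T m θ
  class_phi : InSolutionClass T m φ
  init_density : ρ 0 = ρ₀
  init_theta : θ 0 = θ₀
  init_phi : φ 0 = φ₀
  pos : ∀ t ∈ Icc 0 T, ∀ x, 0 < ρ t x
  mass : ∀ᵐ t ∂volume.restrict (Ioo 0 T), ∀ x, ∃ ρt : ℝ,
    HasDerivAt (fun s => ρ s x) ρt t ∧
      ρt + divergence (fun y => ρ t y • directionField (θ t) (φ t) y) x = 0
  momentum : ∀ᵐ t ∂volume.restrict (Ioo 0 T), ∀ x, ∃ Ωt : Fin 3 → ℝ,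
    HasDerivAt (fun s => directionField (θ s) (φ s) x) Ωt t ∧
      ρ t x • (Ωt + c • advect (directionField (θ t) (φ t) x) (directionField (θ t) (φ t)) x)
        + projPerp (directionField (θ t) (φ t) x) (grad (fun y => p (ρ t y)) x) = 0

end SelfAlign

end

open scoped ContDiff
noncomputable section
namespace SelfAlign
open scoped ENNReal NNReal ComplexConjugate

/-! The system is symmetric hyperbolic in the right unknowns. Put `σ = ∫ √(p' z) / z dz`
(`potential`) in place of the density and the vector `Ω` in place of the angles. Then `∇p(ρ)/ρ = √p'
∇σ`, and the equations read `∂ₜσ + Ω·∇σ + √p' div Ω = 0` and `∂ₜΩ + c (Ω·∇)Ω + √p' P_{Ω^⊥}∇σ = 0`.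
Since `|Ω| = 1` gives `Ω·∂ⱼΩ = 0`, `div Ω` equals `∑ (δᵢⱼ - Ωᵢ Ωⱼ) ∂ⱼΩᵢ`; written so, the coupling
of `σ` to `Ω` is the transpose of the coupling of `Ω` to `σ`. The resulting coefficients are `symA`,
with the sound speed `√p'` replaced by a globally smooth function `q` of `σ` that agrees with it on
the relevant range of densities.

Existence for the symmetric system (`exists_solution_symmetric`) is by Fourier-Galerkin
approximation. Symmetry and a commutator estimate for `⟨k⟩^m` bound the growth of the `H^m` energy
independently of the truncation (`exists_energy_le`), hence on a common time interval.
Coefficientwise compactness, upgraded by the `H^m` bound to uniform convergence of functions and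
first derivatives (here `m - 1 > 3/2` matters), gives a limit that is `C¹` in time with values in
the continuous functions.

To return to the original unknowns, `|Ω|² - 1` solves a linear homogeneous transport equation and
stays zero (`sum_sq_eq_one_of_symmetric`). For a short time `ρ`, `θ`, `φ` are smooth functions of
`(σ, Ω, θ₀, φ₀)`, and a Moser estimate (`exists_sobolev_nem_le`) puts them into the solution class
(`isSolution_of_symmetric`).

For uniqueness, a solution of the class is only known to be `H¹` in time. It is absolutely
continuous at each point of the torus, and the equations then make the symmetric unknowns Lipschitz
in time (`IsSolution.symmetric`). The difference of two solutions satisfies a linear symmetric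
system, and an `L²` Gronwall estimate shows that it vanishes (`eq_zero_of_symmetric_hyperbolic`).
Equal directions give angles equal up to multiples of `2π`, and continuity in time removes this
ambiguity as long as `sin θ` does not vanish. -/

/-! ### Weights and sequence inequalities -/

/-- The Fourier weight `1 + |k|²`. -/
def wt (k : Fin 3 → ℤ) : ℝ := 1 + ∑ i, (k i : ℝ) ^ 2

lemma one_le_wt (k : Fin 3 → ℤ) : 1 ≤ wt k := by
  have : 0 ≤ ∑ i, (k i : ℝ) ^ 2 := Finset.sum_nonneg fun i _ => sq_nonneg _
  unfold wt; linarith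

lemma wt_pos (k : Fin 3 → ℤ) : 0 < wt k := lt_of_lt_of_le one_pos (one_le_wt k)

/-- The weight `(1 + |k|²)^s` as an extended nonnegative real. -/
def W (s : ℝ) (k : Fin 3 → ℤ) : ℝ≥0∞ := ENNReal.ofReal (wt k ^ s)

lemma W_ne_top (s : ℝ) (k : Fin 3 → ℤ) : W s k ≠ ⊤ := ENNReal.ofReal_ne_top

lemma W_add (s r : ℝ) (k : Fin 3 → ℤ) : W (s + r) k = W s k * W r k := by
  rw [W, W, W, ← ENNReal.ofReal_mul (Real.rpow_nonneg (wt_pos k).le _), Real.rpow_add (wt_pos k)]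

lemma W_zero (k : Fin 3 → ℤ) : W 0 k = 1 := by simp [W]

lemma W_neg_mul (s : ℝ) (k : Fin 3 → ℤ) : W (-s) k * W s k = 1 := by
  rw [← W_add, neg_add_cancel, W_zero]

lemma W_mono {s r : ℝ} (h : s ≤ r) (k : Fin 3 → ℤ) : W s k ≤ W r k :=
  ENNReal.ofReal_le_ofReal (Real.rpow_le_rpow_of_exponent_le (one_le_wt k) h)

lemma W_half_sq (s : ℝ) (k : Fin 3 → ℤ) : W (s / 2) k ^ 2 = W s k := by
  rw [sq, ← W_add, add_halves]

lemma tsum_fin_prod (f : ℤ → ℝ≥0∞) (n : ℕ) :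
    ∑' k : Fin n → ℤ, ∏ i, f (k i) = (∑' j, f j) ^ n := by
  induction n with
  | zero => simp
  | succ n ih =>
    rw [← (Fin.consEquiv (fun _ : Fin (n + 1) => ℤ)).tsum_eq, ENNReal.tsum_prod', pow_succ', ← ih,
      ← ENNReal.tsum_mul_right]
    refine tsum_congr fun a => ?_
    rw [← ENNReal.tsum_mul_left]
    refine tsum_congr fun b => ?_
    simp [Fin.prod_univ_succ, Fin.consEquiv]

/-- Since `∏ (1 + kᵢ²) ≤ (1 + |k|²)³`, the weight is at most a product of one-dimensional weights
with exponent `-s/3`. The lattice sum is thus bounded by the cube of a sum over `ℤ`, which converges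
because `2s/3 > 1`. -/
lemma tsum_W_neg_lt_top {s : ℝ} (hs : 3 / 2 < s) : ∑' k, W (-s) k < ⊤ := by
  have h1 : ∀ k, W (-s) k ≤ ∏ i, ENNReal.ofReal ((1 + (k i : ℝ) ^ 2) ^ (-s / 3)) := by
    intro k
    rw [← ENNReal.ofReal_prod_of_nonneg (fun i _ => by positivity), W,
      Real.finsetProd_rpow _ _ (fun i _ => by positivity)]
    refine ENNReal.ofReal_le_ofReal ?_
    have h2 : ∏ i, (1 + (k i : ℝ) ^ 2) ≤ wt k ^ (3 : ℝ) := by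
      have : ∏ i, (1 + (k i : ℝ) ^ 2) ≤ ∏ _i : Fin 3, wt k := by
        refine Finset.prod_le_prod (fun i _ => by positivity) fun i _ => ?_
        have := Finset.single_le_sum (f := fun i => (k i : ℝ) ^ 2) (fun i _ => sq_nonneg _)
          (Finset.mem_univ i)
        simpa [wt] using this
      simpa [Finset.prod_const] using this
    have h3 : wt k ^ (-s) = (wt k ^ (3 : ℝ)) ^ (-s / 3) := by
      rw [← Real.rpow_mul (wt_pos k).le]; congr 1; ring
    rw [h3]
    exact Real.rpow_le_rpow_of_nonpos (Finset.prod_pos fun i _ => by positivity) h2 (by linarith)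
  refine lt_of_le_of_lt (ENNReal.tsum_le_tsum h1) ?_
  rw [tsum_fin_prod (fun j => ENNReal.ofReal ((1 + (j : ℝ) ^ 2) ^ (-s / 3)))]
  refine ENNReal.pow_lt_top ?_
  have hsum : Summable fun j : ℤ => (1 + (j : ℝ) ^ 2) ^ (-s / 3) := by
    have h := Real.summable_abs_int_rpow (b := 2 * s / 3) (by linarith)
    refine Summable.of_norm_bounded_eventually h ?_
    rw [Filter.eventually_cofinite]
    refine (Set.finite_singleton (0 : ℤ)).subset fun j hj => ?_
    by_contra hne
    apply hj
    have hj0 : (0 : ℝ) < |(j : ℝ)| := abs_pos.mpr (by exact_mod_cast hne)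
    rw [Real.norm_of_nonneg (by positivity)]
    have : |(j : ℝ)| ^ (-(2 * s / 3)) = (|(j : ℝ)| ^ (2 : ℝ)) ^ (-s / 3) := by
      rw [← Real.rpow_mul hj0.le]; congr 1; ring
    rw [this]
    refine Real.rpow_le_rpow_of_nonpos (by positivity) ?_ (by linarith)
    rw [Real.rpow_two, sq_abs]; linarith
  rw [← ENNReal.ofReal_tsum_of_nonneg (fun j => by positivity) hsum]
  exact ENNReal.ofReal_lt_top

section Seq
variable {α : Type*}

/-- Cauchy–Schwarz for sums. -/
lemma tsum_mul_sq_le (a b : α → ℝ≥0∞) :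
    (∑' k, a k * b k) ^ 2 ≤ (∑' k, a k ^ 2) * ∑' k, b k ^ 2 := by
  let _ : MeasurableSpace α := ⊤
  have h := ENNReal.lintegral_mul_le_Lp_mul_Lq (Measure.count (α := α)) Real.HolderConjugate.two_two
    (f := a) (g := b) (measurable_from_top).aemeasurable (measurable_from_top).aemeasurable
  simp only [Pi.mul_apply, lintegral_count, ENNReal.rpow_two] at h
  calc _ ≤ _ := pow_le_pow_left' h 2
    _ = _ := by
      rw [mul_pow, ← ENNReal.rpow_two, ← ENNReal.rpow_two, ← ENNReal.rpow_mul, ← ENNReal.rpow_mul]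
      norm_num

/-- Cauchy–Schwarz for the measure with weights `a`, by splitting `a b` as `√a · (√a b)`. -/
lemma tsum_mul_le_sq (a b : α → ℝ≥0∞) :
    (∑' k, a k * b k) ^ 2 ≤ (∑' k, a k) * ∑' k, a k * b k ^ 2 := by
  let c : α → ℝ≥0∞ := fun k => a k ^ (1 / 2 : ℝ)
  have hc : ∀ k, c k ^ 2 = a k := fun k => by
    simp only [c]; rw [← ENNReal.rpow_two, ← ENNReal.rpow_mul]; norm_num
  have h := tsum_mul_sq_le c (fun k => c k * b k)
  simpa only [mul_pow, hc, ← mul_assoc, ← sq] using h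

/-- Young's inequality `ℓ¹ * ℓ² ⊂ ℓ²`. -/
lemma tsum_conv_sq_le {G : Type*} [AddCommGroup G] (a b : G → ℝ≥0∞) :
    ∑' k, (∑' l, a l * b (k - l)) ^ 2 ≤ (∑' l, a l) ^ 2 * ∑' k, b k ^ 2 := by
  calc _ ≤ ∑' k, (∑' l, a l) * ∑' l, a l * b (k - l) ^ 2 :=
        ENNReal.tsum_le_tsum fun k => tsum_mul_le_sq _ _
    _ = (∑' l, a l) * ∑' l, a l * ∑' k, b (k - l) ^ 2 := by
        rw [ENNReal.tsum_mul_left, ENNReal.tsum_comm]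
        simp_rw [ENNReal.tsum_mul_left]
    _ = _ := by
        have : ∀ l, ∑' k, b (k - l) ^ 2 = ∑' k, b k ^ 2 := fun l =>
          (Equiv.subRight l).tsum_eq (fun k => b k ^ 2)
        simp_rw [this, ENNReal.tsum_mul_right]
        ring

lemma tsum_conv_comm {G : Type*} [AddCommGroup G] (a b : G → ℝ≥0∞) (k : G) :
    ∑' l, a l * b (k - l) = ∑' l, b l * a (k - l) := by
  rw [← (Equiv.subLeft k).tsum_eq]
  refine tsum_congr fun l => ?_
  simp [mul_comm]

lemma sq_add_le (x y : ℝ≥0∞) : (x + y) ^ 2 ≤ 2 * (x ^ 2 + y ^ 2) := by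
  have := ENNReal.rpow_add_le_mul_rpow_add_rpow x y (p := 2) (by norm_num)
  norm_num at this
  simpa only [ENNReal.rpow_two] using this

end Seq

/-- Cauchy–Schwarz with `1 = W (-s/2) · W (s/2)`. This is the sequence form of the Sobolev embedding
`H^s ⊂ ℓ¹` on the Fourier side; the first factor on the right is finite for `s > 3/2`. -/
lemma tsum_sq_le_W {s : ℝ} (c : (Fin 3 → ℤ) → ℝ≥0∞) :
    (∑' k, c k) ^ 2 ≤ (∑' k, W (-s) k) * ∑' k, W s k * c k ^ 2 := by
  have h := tsum_mul_sq_le (fun k => W (-s / 2) k) (fun k => W (s / 2) k * c k)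
  have e : ∀ k, W (-s / 2) k * (W (s / 2) k * c k) = c k := fun k => by
    rw [← mul_assoc, neg_div, W_neg_mul, one_mul]
  simpa only [e, mul_pow, W_half_sq] using h

/-! ### Fourier coefficients of continuous functions -/

/-- The normalized Haar measure of the periodic cube. -/
abbrev haarT : Measure Torus := Measure.pi fun _ => AddCircle.haarAddCircle

/-- Fourier coefficients of a real continuous function. -/
def fc (f : C(Torus, ℝ)) (k : Fin 3 → ℤ) : ℂ :=
  UnitAddTorus.mFourierCoeff (fun x => (f x : ℂ)) k

lemma fc_eq (f : C(Torus, ℝ)) (k : Fin 3 → ℤ) :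
    fc f k = ∫ x, UnitAddTorus.mFourier (-k) x * (f x : ℂ) ∂haarT := rfl

lemma integrable_haarT {E : Type*} [NormedAddCommGroup E] {f : Torus → E} (hf : Continuous f) :
    Integrable f haarT :=
  hf.integrable_of_hasCompactSupport (HasCompactSupport.of_compactSpace f)

lemma sobolevNormSq_eq (s : ℝ) (f : C(Torus, ℝ)) :
    sobolevNormSq s f = ∑' k, W s k * ‖fc f k‖ₑ ^ 2 := by
  refine tsum_congr fun k => ?_
  rw [← ofReal_norm, ← ENNReal.ofReal_pow (norm_nonneg _), W,
    ← ENNReal.ofReal_mul (Real.rpow_nonneg (wt_pos k).le _)]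
  rfl

lemma norm_mFourier_apply (k : Fin 3 → ℤ) (x : Torus) : ‖UnitAddTorus.mFourier k x‖ = 1 := by
  simp [UnitAddTorus.mFourier, fourier_apply, Circle.norm_coe]

/-- The `k`-th Fourier coefficient as a continuous linear functional. -/
def fcL (k : Fin 3 → ℤ) : C(Torus, ℝ) →L[ℝ] ℂ :=
  LinearMap.mkContinuous
    { toFun := fun f => fc f k
      map_add' := fun f g => by
        simp only [fc_eq]
        rw [← integral_add (integrable_haarT (by fun_prop)) (integrable_haarT (by fun_prop))]
        congr 1; ext x; simp [mul_add]
      map_smul' := fun c f => by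
        simp only [fc_eq, RingHom.id_apply]
        rw [← integral_smul]
        congr 1; ext x; simp; ring } 1 (fun f => by
    change ‖fc f k‖ ≤ 1 * ‖f‖
    rw [fc_eq]
    refine (norm_integral_le_of_norm_le_const (C := ‖f‖) (ae_of_all _ fun x => ?_)).trans ?_
    · rw [norm_mul, norm_mFourier_apply, one_mul, Complex.norm_real]
      exact f.norm_coe_le_norm x
    · simp)

@[simp] lemma fcL_apply (f : C(Torus, ℝ)) (k : Fin 3 → ℤ) : fcL k f = fc f k := rfl

lemma fc_add (f g : C(Torus, ℝ)) (k) : fc (f + g) k = fc f k + fc g k := (fcL k).map_add f g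
lemma fc_sub (f g : C(Torus, ℝ)) (k) : fc (f - g) k = fc f k - fc g k := (fcL k).map_sub f g
lemma fc_neg (f : C(Torus, ℝ)) (k) : fc (-f) k = -fc f k := (fcL k).map_neg f
lemma fc_zero (k) : fc 0 k = 0 := (fcL k).map_zero
lemma fc_smul (c : ℝ) (f : C(Torus, ℝ)) (k) : fc (c • f) k = c • fc f k := (fcL k).map_smul c f
lemma fc_sum {ι : Type*} (s : Finset ι) (f : ι → C(Torus, ℝ)) (k) :
    fc (∑ i ∈ s, f i) k = ∑ i ∈ s, fc (f i) k := map_sum (fcL k) f s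

lemma norm_fc_le (f : C(Torus, ℝ)) (k) : ‖fc f k‖ ≤ ‖f‖ := by
  have := (fcL k).le_of_opNorm_le (c := 1) (LinearMap.mkContinuous_norm_le _ zero_le_one _) f
  simpa using this

lemma fc_conj (f : C(Torus, ℝ)) (k) : fc f (-k) = conj (fc f k) := by
  rw [fc_eq, fc_eq, ← integral_conj]
  congr 1; ext x
  rw [map_mul, Complex.conj_ofReal, ← UnitAddTorus.mFourier_neg]

/-- A real continuous function, viewed as a complex one. -/
def toC (f : C(Torus, ℝ)) : C(Torus, ℂ) := ⟨fun x => (f x : ℂ), by fun_prop⟩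

@[simp] lemma toC_apply (f : C(Torus, ℝ)) (x) : toC f x = (f x : ℂ) := rfl

lemma tsum_fc_sq_le (f : C(Torus, ℝ)) : ∑' k, ‖fc f k‖ₑ ^ 2 ≤ ENNReal.ofReal (‖f‖ ^ 2) := by
  -- The circle is given its Haar measure of total mass one, so that Parseval's identity holds
  -- without a constant.
  let _ : MeasureSpace UnitAddCircle := ⟨AddCircle.haarAddCircle⟩
  have : IsProbabilityMeasure (volume : Measure UnitAddCircle) :=
    inferInstanceAs (IsProbabilityMeasure AddCircle.haarAddCircle)
  have h := UnitAddTorus.hasSum_sq_mFourierCoeff ((toC f).toLp 2 haarT ℂ)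
  have e : ∀ k, ‖fc f k‖ₑ ^ 2 = ENNReal.ofReal (‖UnitAddTorus.mFourierCoeff
      ((toC f).toLp 2 haarT ℂ) k‖ ^ 2) := fun k => by
    rw [ENNReal.ofReal_pow (norm_nonneg _), ofReal_norm]
    congr 2
    exact (UnitAddTorus.mFourierCoeff_toLp (toC f) k).symm
  simp_rw [e]
  rw [← ENNReal.ofReal_tsum_of_nonneg (fun k => by positivity) h.summable, h.tsum_eq]
  refine ENNReal.ofReal_le_ofReal ?_
  have h2 : ∫ t, ‖((toC f).toLp 2 haarT ℂ) t‖ ^ 2 ∂haarT = ∫ t, ‖f t‖ ^ 2 ∂haarT := by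
    refine integral_congr_ae ?_
    filter_upwards [(toC f).coeFn_toLp (p := 2) (𝕜 := ℂ) haarT] with t ht
    rw [ht]; simp
  refine (le_of_eq h2).trans ?_
  refine (integral_mono (g := fun _ => ‖f‖ ^ 2) (integrable_haarT (by fun_prop))
    (integrable_const _) fun x => ?_).trans (by simp)
  exact pow_le_pow_left₀ (norm_nonneg _) (f.norm_coe_le_norm x) 2

lemma hasSum_fourier {f : C(Torus, ℝ)} (h : ∑' k, ‖fc f k‖ₑ ≠ ⊤) :
    HasSum (fun k => fc f k • UnitAddTorus.mFourier k) (toC f) := by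
  refine UnitAddTorus.hasSum_mFourier_series_of_summable (f := toC f) ?_
  have : Summable fun k => ‖fc f k‖ := by
    have := ENNReal.summable_toReal h
    simpa using this
  exact this.of_norm

lemma norm_toC (f : C(Torus, ℝ)) : ‖toC f‖ = ‖f‖ := by
  refine le_antisymm ((ContinuousMap.norm_le _ (norm_nonneg _)).2 fun x => ?_)
    ((ContinuousMap.norm_le _ (norm_nonneg _)).2 fun x => ?_)
  · simpa using f.norm_coe_le_norm x
  · simpa using (toC f).norm_coe_le_norm x

/-- If the right side is finite, the Fourier series converges in the sup norm to `f` and each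
exponential has norm one. -/
lemma enorm_le_tsum_fc (f : C(Torus, ℝ)) : ‖f‖ₑ ≤ ∑' k, ‖fc f k‖ₑ := by
  by_cases h : ∑' k, ‖fc f k‖ₑ = ⊤
  · rw [h]; exact le_top
  have hs := hasSum_fourier h
  have : ‖f‖ₑ = ‖toC f‖ₑ := by rw [← ofReal_norm, ← ofReal_norm, norm_toC]
  rw [this, ← hs.tsum_eq]
  refine (enorm_tsum_le_tsum_enorm (f := fun k => fc f k • UnitAddTorus.mFourier k)).trans
    (ENNReal.tsum_le_tsum fun k => ?_)
  rw [enorm_smul, ← ofReal_norm (UnitAddTorus.mFourier k), UnitAddTorus.mFourier_norm]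
  simp

lemma fc_injective {f g : C(Torus, ℝ)} (h : ∀ k, fc f k = fc g k) : f = g := by
  have := enorm_le_tsum_fc (f - g)
  simp only [fc_sub, h, sub_self, enorm_zero, tsum_zero, nonpos_iff_eq_zero] at this
  rw [← ofReal_norm, ENNReal.ofReal_eq_zero] at this
  exact sub_eq_zero.1 (norm_le_zero_iff.1 this)

lemma sobolevNormSq_mono {s r : ℝ} (h : s ≤ r) (f : C(Torus, ℝ)) :
    sobolevNormSq s f ≤ sobolevNormSq r f := by
  rw [sobolevNormSq_eq, sobolevNormSq_eq]
  exact ENNReal.tsum_le_tsum fun k => by gcongr; exact W_mono h k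

/-- Sobolev embedding on the Fourier side. -/
lemma tsum_fc_le {s : ℝ} (f : C(Torus, ℝ)) :
    (∑' k, ‖fc f k‖ₑ) ^ 2 ≤ (∑' k, W (-s) k) * sobolevNormSq s f := by
  rw [sobolevNormSq_eq]; exact tsum_sq_le_W _

lemma enorm_sq_le_sobolev {s : ℝ} (f : C(Torus, ℝ)) :
    ‖f‖ₑ ^ 2 ≤ (∑' k, W (-s) k) * sobolevNormSq s f :=
  (pow_le_pow_left' (enorm_le_tsum_fc f) 2).trans (tsum_fc_le f)

lemma tsum_fc_ne_top {s : ℝ} (hs : 3 / 2 < s) {f : C(Torus, ℝ)} (hf : MemH s f) :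
    ∑' k, ‖fc f k‖ₑ ≠ ⊤ := by
  intro h
  have := tsum_fc_le (s := s) f
  rw [h] at this
  have h2 := ENNReal.mul_lt_top (tsum_W_neg_lt_top hs) hf
  simp at this
  exact absurd this h2.ne

/-- The Fourier coefficients of a product. -/
lemma hasSum_fc_mul {f g : C(Torus, ℝ)} (h : ∑' k, ‖fc f k‖ₑ ≠ ⊤) (k) :
    HasSum (fun l => fc f l * fc g (k - l)) (fc (f * g) k) := by
  have hs := hasSum_fourier h
  -- Integration against `e₋ₖ g` is continuous in the sup norm, hence may be applied termwise to the
  -- Fourier series of `f`. The coefficients of `g` need not be summable.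
  let L : C(Torus, ℂ) →L[ℂ] ℂ := LinearMap.mkContinuous
    { toFun := fun F => ∫ x, F x * (UnitAddTorus.mFourier (-k) x * (g x : ℂ)) ∂haarT
      map_add' := fun F G => by
        rw [← integral_add (integrable_haarT (by fun_prop)) (integrable_haarT (by fun_prop))]
        congr 1; ext x; simp [add_mul]
      map_smul' := fun c F => by
        rw [RingHom.id_apply, smul_eq_mul, ← integral_const_mul]
        congr 1; ext x; simp; ring } ‖g‖ (fun F => by
    change ‖∫ x, F x * (UnitAddTorus.mFourier (-k) x * (g x : ℂ)) ∂haarT‖ ≤ _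
    refine (norm_integral_le_of_norm_le_const (C := ‖g‖ * ‖F‖) (ae_of_all _ fun x => ?_)).trans ?_
    · rw [norm_mul, norm_mul, norm_mFourier_apply, one_mul, Complex.norm_real, mul_comm]
      gcongr
      · exact g.norm_coe_le_norm x
      · exact F.norm_coe_le_norm x
    · simp)
  have h1 : L (toC f) = fc (f * g) k := by
    rw [fc_eq]
    change ∫ x, _ ∂haarT = _
    congr 1; ext x; simp; ring
  have h2 : ∀ l, L (fc f l • UnitAddTorus.mFourier l) = fc f l * fc g (k - l) := by
    intro l
    rw [map_smul, smul_eq_mul]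
    congr 1
    rw [fc_eq]
    change ∫ x, _ ∂haarT = _
    congr 1; ext x
    rw [← mul_assoc, ← UnitAddTorus.mFourier_add]
    congr 3; abel
  have h3 := L.hasSum hs
  simp only [h1, h2] at h3
  exact h3

lemma enorm_fc_mul_le {f g : C(Torus, ℝ)} (h : ∑' k, ‖fc f k‖ₑ ≠ ⊤) (k) :
    ‖fc (f * g) k‖ₑ ≤ ∑' l, ‖fc f l‖ₑ * ‖fc g (k - l)‖ₑ := by
  rw [← (hasSum_fc_mul h k).tsum_eq]
  refine enorm_tsum_le_tsum_enorm.trans (le_of_eq (tsum_congr fun l => ?_))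
  rw [enorm_mul]

/-! ### Japanese bracket -/

/-- `⟨k⟩ = (1 + |k|²)^{1/2}` -/
def jb (k : Fin 3 → ℤ) : ℝ := Real.sqrt (wt k)

lemma one_le_jb (k) : 1 ≤ jb k := Real.one_le_sqrt.2 (one_le_wt k)
lemma jb_pos (k) : 0 < jb k := lt_of_lt_of_le one_pos (one_le_jb k)

lemma wt_rpow (k) (s : ℝ) : wt k ^ s = jb k ^ (2 * s) := by
  rw [jb, Real.sqrt_eq_rpow, ← Real.rpow_mul (wt_pos k).le]; congr 1; ring

lemma jb_sq (k) : jb k ^ 2 = wt k := Real.sq_sqrt (wt_pos k).le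

/-- The frequency as a Euclidean vector `(1, k)`. -/
def jvec (c : ℝ) (k : Fin 3 → ℤ) : EuclideanSpace ℝ (Fin 4) :=
  WithLp.toLp 2 ![c, k 0, k 1, k 2]

lemma norm_jvec (c : ℝ) (k) : ‖jvec c k‖ = Real.sqrt (c ^ 2 + ∑ i, (k i : ℝ) ^ 2) := by
  rw [EuclideanSpace.norm_eq]
  congr 1
  simp [jvec, Fin.sum_univ_succ]

lemma jb_eq_norm (k) : jb k = ‖jvec 1 k‖ := by rw [norm_jvec, jb, wt]; norm_num

/-- Reverse triangle inequality for the vectors `(1, k)` and `(1, l)` in `ℝ⁴`, whose difference is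
`(0, k - l)`. -/
lemma abs_jb_sub_le (k l) : |jb k - jb l| ≤ jb (k - l) := by
  rw [jb_eq_norm k, jb_eq_norm l]
  refine (abs_norm_sub_norm_le _ _).trans ?_
  have : jvec 1 k - jvec 1 l = jvec 0 (k - l) := by
    ext i; fin_cases i <;> simp [jvec]
  rw [this, norm_jvec, jb, wt]
  apply Real.sqrt_le_sqrt; linarith

lemma jb_le_add (k l) : jb k ≤ jb (k - l) + jb l := by
  have := (abs_le.1 (abs_jb_sub_le k l)).2; linarith

lemma abs_le_jb (k) (j : Fin 3) : |(k j : ℝ)| ≤ jb k := by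
  rw [jb, ← Real.sqrt_sq_eq_abs]
  apply Real.sqrt_le_sqrt
  have := Finset.single_le_sum (f := fun i => (k i : ℝ) ^ 2) (fun i _ => sq_nonneg _)
          (Finset.mem_univ j)
  simp only [wt]; linarith

lemma add_rpow_le' {a b s : ℝ} (ha : 0 ≤ a) (hb : 0 ≤ b) (hs : 0 ≤ s) :
    (a + b) ^ s ≤ 2 ^ s * (a ^ s + b ^ s) := by
  have h : (a + b) ^ s ≤ (2 * max a b) ^ s :=
    Real.rpow_le_rpow (by positivity) (by
      have := le_max_left a b; have := le_max_right a b; linarith) hs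
  refine h.trans ?_
  rw [Real.mul_rpow (by norm_num) (by positivity)]
  gcongr
  rcases le_total a b with h | h
  · rw [max_eq_right h]; have := Real.rpow_nonneg ha s; linarith
  · rw [max_eq_left h]; have := Real.rpow_nonneg hb s; linarith

/-- One of `⟨k - l⟩`, `⟨l⟩` is at least half of `⟨k⟩`. When it is `⟨l⟩`, write `⟨l⟩^s = ⟨l⟩^r
⟨l⟩^(s-r)` and, since `s - r ≤ 0`, replace the last base by the smaller bracket `⟨k - l⟩`. The
unbalanced form lets one factor of a product be measured in `H^r` and the other only in `H^s`. -/
lemma jb_rpow_le {s r : ℝ} (hs : 0 ≤ s) (hsr : s ≤ r) (k l) :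
    jb k ^ s ≤ 2 ^ s * (jb (k - l) ^ s + jb l ^ r * jb (k - l) ^ (s - r)) := by
  have ha := jb_pos (k - l)
  have hb := jb_pos l
  rcases le_total (jb l) (jb (k - l)) with h | h
  · have h1 : jb k ^ s ≤ (2 * jb (k - l)) ^ s :=
      Real.rpow_le_rpow (jb_pos k).le (by have := jb_le_add k l; linarith) hs
    rw [Real.mul_rpow (by norm_num) ha.le] at h1
    refine h1.trans ?_
    gcongr
    have : 0 ≤ jb l ^ r * jb (k - l) ^ (s - r) := by positivity
    linarith
  · have h1 : jb k ^ s ≤ (2 * jb l) ^ s :=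
      Real.rpow_le_rpow (jb_pos k).le (by have := jb_le_add k l; linarith) hs
    rw [Real.mul_rpow (by norm_num) hb.le] at h1
    refine h1.trans ?_
    gcongr
    have h2 : jb l ^ s = jb l ^ r * jb l ^ (s - r) := by rw [← Real.rpow_add hb]; congr 1; ring
    have h3 : jb l ^ (s - r) ≤ jb (k - l) ^ (s - r) :=
      Real.rpow_le_rpow_of_nonpos ha h (by linarith)
    have h4 : jb l ^ s ≤ jb l ^ r * jb (k - l) ^ (s - r) := by rw [h2]; gcongr
    have : 0 ≤ jb (k - l) ^ s := by positivity
    linarith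

lemma W_eq_jb (s : ℝ) (k) : W (s / 2) k = ENNReal.ofReal (jb k ^ s) := by
  rw [W, wt_rpow]; congr 2; ring

lemma W_half_le {s r : ℝ} (hs : 0 ≤ s) (hsr : s ≤ r) (k l) :
    W (s / 2) k ≤ ENNReal.ofReal (2 ^ s) *
      (W (s / 2) (k - l) + W (r / 2) l * W ((s - r) / 2) (k - l)) := by
  simp_rw [W_eq_jb]
  rw [← ENNReal.ofReal_mul (by have := jb_pos l; positivity), ← ENNReal.ofReal_add
    (by have := jb_pos (k - l); positivity)
    (by have := jb_pos (k - l); have := jb_pos l; positivity),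
    ← ENNReal.ofReal_mul (by positivity)]
  exact ENNReal.ofReal_le_ofReal (jb_rpow_le hs hsr k l)

/-! ### The product estimate in Sobolev spaces. -/

/-- The product `H^r · H^s ⊂ H^s` for `0 ≤ s ≤ r`, `r > 3/2`. -/
lemma sobolev_mul {s r : ℝ} (hs : 0 ≤ s) (hsr : s ≤ r) (hr : 3 / 2 < r) :
    ∃ C : ℝ≥0, ∀ f g : C(Torus, ℝ), MemH r f →
      sobolevNormSq s (f * g) ≤ C * sobolevNormSq r f * sobolevNormSq s g := by
  set K := ∑' k, W (-r) k with hK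
  have hKt : K < ⊤ := tsum_W_neg_lt_top hr
  set D := ENNReal.ofReal (2 ^ s) with hD
  have hCt : D ^ 2 * (2 * (K + K)) ≠ ⊤ := by finiteness
  refine ⟨(D ^ 2 * (2 * (K + K))).toNNReal, fun f g hf => ?_⟩
  rw [ENNReal.coe_toNNReal hCt]
  have hf1 := tsum_fc_ne_top hr hf
  set a : (Fin 3 → ℤ) → ℝ≥0∞ := fun k => ‖fc f k‖ₑ with ha
  set b : (Fin 3 → ℤ) → ℝ≥0∞ := fun k => ‖fc g k‖ₑ with hb
  -- In the first convolution `f` is the `ℓ¹` factor and carries no weight; in the second the `ℓ¹`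
  -- factor is `g` with the nonpositive weight `(s - r)/2`, while `f` carries the full weight `r/2`.
  have key : ∀ k, W s k * ‖fc (f * g) k‖ₑ ^ 2 ≤ D ^ 2 * (2 *
      ((∑' l, a l * (W (s / 2) (k - l) * b (k - l))) ^ 2 +
        (∑' l, (W ((s - r) / 2) l * b l) * (W (r / 2) (k - l) * a (k - l))) ^ 2)) := by
    intro k
    have h1 : ‖fc (f * g) k‖ₑ ≤ ∑' l, a l * b (k - l) := enorm_fc_mul_le hf1 k
    rw [← W_half_sq, ← mul_pow]
    have h2 : W (s / 2) k * ‖fc (f * g) k‖ₑ ≤ D * (∑' l, a l * (W (s / 2) (k - l) * b (k - l)) +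
        ∑' l, (W ((s - r) / 2) l * b l) * (W (r / 2) (k - l) * a (k - l))) := by
      rw [tsum_conv_comm (fun l => W ((s - r) / 2) l * b l) (fun l => W (r / 2) l * a l),
        ← ENNReal.tsum_add, ← ENNReal.tsum_mul_left]
      refine (mul_le_mul_right h1 _).trans ?_
      rw [← ENNReal.tsum_mul_left]
      refine ENNReal.tsum_le_tsum fun l => ?_
      refine (mul_le_mul_left (W_half_le hs hsr k l) _).trans (le_of_eq ?_)
      ring
    refine (pow_le_pow_left' h2 2).trans ?_
    rw [mul_pow]
    gcongr
    exact sq_add_le _ _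
  rw [sobolevNormSq_eq s (f * g)]
  refine (ENNReal.tsum_le_tsum key).trans ?_
  rw [ENNReal.tsum_mul_left, ENNReal.tsum_mul_left, ENNReal.tsum_add, mul_assoc, mul_assoc,
    mul_assoc]
  gcongr
  rw [add_mul]
  refine add_le_add ?_ ?_
  · refine (tsum_conv_sq_le a (fun k => W (s / 2) k * b k)).trans ?_
    simp_rw [mul_pow, W_half_sq]
    rw [← sobolevNormSq_eq, ← mul_assoc]
    gcongr
    exact tsum_fc_le f
  · refine (tsum_conv_sq_le (fun l => W ((s - r) / 2) l * b l) (fun k => W (r / 2) k * a k)).trans ?_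
    simp_rw [mul_pow, W_half_sq]
    rw [← sobolevNormSq_eq, mul_comm (sobolevNormSq r f), ← mul_assoc]
    gcongr
    -- The weight `r` spent on passing from `ℓ¹` to `ℓ²` combines with `s - r` to the weight `s` of
    -- `g`.
    refine (tsum_sq_le_W (s := r) _).trans (le_of_eq ?_)
    rw [sobolevNormSq_eq]
    congr 1
    refine tsum_congr fun k => ?_
    rw [mul_pow, W_half_sq, ← mul_assoc, ← W_add]
    congr 2; ring

/-! ### Linear operations and Sobolev norms -/

lemma sobolevNormSq_neg (s : ℝ) (f : C(Torus, ℝ)) :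
    sobolevNormSq s (-f) = sobolevNormSq s f := by
  rw [sobolevNormSq_eq, sobolevNormSq_eq]
  refine tsum_congr fun k => ?_
  rw [fc_neg, enorm_neg]

lemma sobolevNormSq_zero (s : ℝ) : sobolevNormSq s 0 = 0 := by
  rw [sobolevNormSq_eq]; simp [fc_zero]

lemma sobolevNormSq_add_le (s : ℝ) (f g : C(Torus, ℝ)) :
    sobolevNormSq s (f + g) ≤ 2 * (sobolevNormSq s f + sobolevNormSq s g) := by
  rw [sobolevNormSq_eq, sobolevNormSq_eq, sobolevNormSq_eq, ← ENNReal.tsum_add,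
    ← ENNReal.tsum_mul_left]
  refine ENNReal.tsum_le_tsum fun k => ?_
  rw [fc_add]
  calc W s k * ‖fc f k + fc g k‖ₑ ^ 2 ≤ W s k * (2 * (‖fc f k‖ₑ ^ 2 + ‖fc g k‖ₑ ^ 2)) := by
        gcongr
        exact (pow_le_pow_left' (enorm_add_le _ _) 2).trans (sq_add_le _ _)
    _ = _ := by ring

lemma sobolevNormSq_sub_le (s : ℝ) (f g : C(Torus, ℝ)) :
    sobolevNormSq s (f - g) ≤ 2 * (sobolevNormSq s f + sobolevNormSq s g) := by
  rw [sub_eq_add_neg, ← sobolevNormSq_neg s g]; exact sobolevNormSq_add_le s f (-g)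

lemma sobolevNormSq_sum_le {ι : Type*} (s : ℝ) (S : Finset ι) (f : ι → C(Torus, ℝ)) :
    sobolevNormSq s (∑ i ∈ S, f i) ≤ 2 ^ S.card * ∑ i ∈ S, sobolevNormSq s (f i) := by
  classical
  induction S using Finset.induction_on with
  | empty => simp [sobolevNormSq_zero]
  | insert a S ha ih =>
    rw [Finset.sum_insert ha, Finset.sum_insert ha, Finset.card_insert_of_notMem ha]
    refine (sobolevNormSq_add_le _ _ _).trans ?_
    rw [pow_succ', mul_assoc]
    gcongr
    rw [mul_add]
    gcongr
    exact le_mul_of_one_le_left' (one_le_pow₀ (by norm_num))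

/-! ### Compactness of bounded sets of `H^s`. -/

/-- On bounded sets of `H^s`, `s > 3/2`, the sup norm is controlled by finitely many Fourier
coefficients up to a small error. -/
lemma norm_le_finset_sum {s : ℝ} (hs : 3 / 2 < s) (M : ℝ≥0) {ε : ℝ} (hε : 0 < ε) :
    ∃ F : Finset (Fin 3 → ℤ), ∀ f : C(Torus, ℝ), sobolevNormSq s f ≤ M →
      ‖f‖ ≤ ∑ k ∈ F, ‖fc f k‖ + ε := by
  have ht := ENNReal.tendsto_tsum_compl_atTop_zero (tsum_W_neg_lt_top hs).ne
  have ht2 : Filter.Tendsto (fun F : Finset (Fin 3 → ℤ) =>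
      (∑' k : { k // k ∉ F }, W (-s) k) * M) Filter.atTop (nhds 0) := by
    simpa using ENNReal.Tendsto.mul_const ht (Or.inr (ENNReal.coe_ne_top (r := M)))
  have hpos : (0 : ℝ≥0∞) < ENNReal.ofReal ε ^ 2 := by
    have := ENNReal.ofReal_pos.2 hε; positivity
  -- The tail of `∑ W (-s)` beyond `F`, times `M`, is below `ε²`; by Cauchy–Schwarz it bounds the
  -- square of the `ℓ¹` tail of the coefficients.
  obtain ⟨F, hF⟩ := (ht2.eventually (gt_mem_nhds hpos)).exists
  refine ⟨F, fun f hf => ?_⟩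
  have h1 : ∑' k : { k // k ∉ F }, ‖fc f k‖ₑ ≤ ENNReal.ofReal ε := by
    have h2 : (∑' k : { k // k ∉ F }, ‖fc f k‖ₑ) ^ 2 ≤ ENNReal.ofReal ε ^ 2 := by
      have h := tsum_mul_sq_le (fun k : { k // k ∉ F } => W (-s / 2) k)
        (fun k => W (s / 2) k * ‖fc f k‖ₑ)
      have e : ∀ k : { k // k ∉ F }, W (-s / 2) k * (W (s / 2) k * ‖fc f k‖ₑ) = ‖fc f k‖ₑ :=
        fun k => by rw [← mul_assoc, neg_div, W_neg_mul, one_mul]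
      simp only [e, mul_pow, W_half_sq] at h
      refine h.trans (le_trans ?_ hF.le)
      gcongr
      refine le_trans ?_ hf
      rw [sobolevNormSq_eq]
      exact ENNReal.tsum_comp_le_tsum_of_injective Subtype.val_injective _
    exact (ENNReal.pow_le_pow_left_iff two_ne_zero).1 h2
  have h3 : ‖f‖ₑ ≤ ENNReal.ofReal (∑ k ∈ F, ‖fc f k‖ + ε) := by
    refine (enorm_le_tsum_fc f).trans ?_
    rw [← ENNReal.sum_add_tsum_compl F, ENNReal.ofReal_add (by positivity) hε.le,
      ENNReal.ofReal_sum_of_nonneg (fun _ _ => norm_nonneg _)]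
    simp_rw [ofReal_norm]
    gcongr
    exact h1
  rw [← ofReal_norm] at h3
  exact (ENNReal.ofReal_le_ofReal_iff (by positivity)).1 h3

lemma continuous_fc (k : Fin 3 → ℤ) : Continuous fun f : C(Torus, ℝ) => fc f k :=
  (fcL k).continuous

/-- The `H^s` bound makes the high frequencies uniformly small, so uniform convergence is decided by
finitely many coefficients. -/
lemma tendsto_of_fc {α : Type*} {l : Filter α} {s : ℝ} (hs : 3 / 2 < s) {M : ℝ≥0}
    {f : α → C(Torus, ℝ)} {g : C(Torus, ℝ)} (hf : ∀ᶠ a in l, sobolevNormSq s (f a) ≤ M)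
    (hg : sobolevNormSq s g ≤ M)
    (h : ∀ k, Filter.Tendsto (fun a => fc (f a) k) l (nhds (fc g k))) :
    Filter.Tendsto f l (nhds g) := by
  rw [Metric.tendsto_nhds]
  intro ε hε
  -- The constant `4 M = 2 (M + M)` bounds the squared norm of the difference.
  obtain ⟨F, hF⟩ := norm_le_finset_sum hs (4 * M) (half_pos hε)
  have h1 : Filter.Tendsto (fun a => ∑ k ∈ F, ‖fc (f a) k - fc g k‖) l (nhds 0) := by
    have : Filter.Tendsto (fun a => ∑ k ∈ F, ‖fc (f a) k - fc g k‖) l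
        (nhds (∑ k ∈ F, ‖fc g k - fc g k‖)) :=
      tendsto_finsetSum _ fun k _ => ((h k).sub_const _).norm
    simpa using this
  filter_upwards [hf, h1.eventually (gt_mem_nhds (half_pos hε))] with a ha hb
  rw [dist_eq_norm]
  have h2 := hF (f a - g) ((sobolevNormSq_sub_le s _ _).trans (by
    calc 2 * (sobolevNormSq s (f a) + sobolevNormSq s g) ≤ 2 * ((M : ℝ≥0∞) + M) := by gcongr
      _ = _ := by push_cast; ring))
  simp only [fc_sub] at h2
  linarith

/-- Lower semicontinuity of the norm: every finite partial sum of the series passes to the limit. -/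
lemma sobolevNormSq_le_of_fc {α : Type*} {l : Filter α} [l.NeBot] {s : ℝ} {M : ℝ≥0∞}
    {f : α → C(Torus, ℝ)} {g : C(Torus, ℝ)} (hf : ∀ᶠ a in l, sobolevNormSq s (f a) ≤ M)
    (h : ∀ k, Filter.Tendsto (fun a => fc (f a) k) l (nhds (fc g k))) :
    sobolevNormSq s g ≤ M := by
  rw [sobolevNormSq_eq, ENNReal.tsum_eq_iSup_sum]
  refine iSup_le fun F => ?_
  have h1 : Filter.Tendsto (fun a => ∑ k ∈ F, W s k * ‖fc (f a) k‖ₑ ^ 2) l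
      (nhds (∑ k ∈ F, W s k * ‖fc g k‖ₑ ^ 2)) := by
    refine tendsto_finsetSum _ fun k _ => ?_
    refine ENNReal.Tendsto.const_mul ?_ (Or.inr (W_ne_top s k))
    exact ((ENNReal.continuous_pow 2).comp continuous_enorm).tendsto _ |>.comp (h k)
  refine le_of_tendsto h1 ?_
  filter_upwards [hf] with a ha
  refine le_trans ?_ ha
  rw [sobolevNormSq_eq]
  exact ENNReal.sum_le_tsum F

lemma sobolevNormSq_le_of_tendsto {α : Type*} {l : Filter α} [l.NeBot] {s : ℝ} {M : ℝ≥0∞}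
    {f : α → C(Torus, ℝ)} {g : C(Torus, ℝ)} (hf : ∀ᶠ a in l, sobolevNormSq s (f a) ≤ M)
    (h : Filter.Tendsto f l (nhds g)) : sobolevNormSq s g ≤ M :=
  sobolevNormSq_le_of_fc hf fun k => ((continuous_fc k).tendsto g).comp h

/-- Rellich-type compactness: a bounded sequence in `H^s`, `s > 3/2`, whose Fourier coefficients
converge, converges uniformly. -/
lemma exists_tendsto_of_fc_cauchy {s : ℝ} (hs : 3 / 2 < s) {M : ℝ≥0}
    {f : ℕ → C(Torus, ℝ)} (hf : ∀ n, sobolevNormSq s (f n) ≤ M)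
    (h : ∀ k, CauchySeq fun n => fc (f n) k) :
    ∃ g, Filter.Tendsto f Filter.atTop (nhds g) := by
  refine cauchySeq_tendsto_of_complete (Metric.cauchySeq_iff.2 fun ε hε => ?_)
  obtain ⟨F, hF⟩ := norm_le_finset_sum hs (4 * M) (half_pos hε)
  set δ := ε / 2 / (F.card + 1) with hδ
  have hδ0 : 0 < δ := by positivity
  choose N hN using fun k => Metric.cauchySeq_iff.1 (h k) δ hδ0
  refine ⟨F.sup N, fun m hm n hn => ?_⟩
  rw [dist_eq_norm]
  have h2 := hF (f m - f n) ((sobolevNormSq_sub_le s _ _).trans (by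
    calc 2 * (sobolevNormSq s (f m) + sobolevNormSq s (f n)) ≤ 2 * ((M : ℝ≥0∞) + M) := by
          gcongr <;> exact hf _
      _ = _ := by push_cast; ring))
  have h3 : ∑ k ∈ F, ‖fc (f m - f n) k‖ ≤ ∑ k ∈ F, δ := by
    refine Finset.sum_le_sum fun k hk => ?_
    rw [fc_sub, ← dist_eq_norm]
    exact (hN k m (le_trans (Finset.le_sup hk) hm) n (le_trans (Finset.le_sup hk) hn)).le
  have h4 : ∑ k ∈ F, δ < ε / 2 := by
    rw [Finset.sum_const, nsmul_eq_mul, hδ, mul_div_assoc', div_lt_iff₀ (by positivity)]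
    nlinarith
  linarith

/-! ### Partial derivatives -/

/-- `g` is the partial derivative of `f` in direction `j`. -/
def HasPDeriv (j : Fin 3) (f g : C(Torus, ℝ)) : Prop :=
  ∀ x, HasDerivAt (fun r : ℝ => f (x + Pi.single j (r : UnitAddCircle))) (g x) 0

open Classical in
/-- The partial derivative of `f` if it exists and is continuous, and zero otherwise. -/
def D (j : Fin 3) (f : C(Torus, ℝ)) : C(Torus, ℝ) :=
  if h : ∃ g, HasPDeriv j f g then h.choose else 0

lemma HasPDeriv.unique {j : Fin 3} {f g h : C(Torus, ℝ)} (hg : HasPDeriv j f g)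
    (hh : HasPDeriv j f h) : g = h :=
  ContinuousMap.ext fun x => (hg x).unique (hh x)

lemma HasPDeriv.D_eq {j : Fin 3} {f g : C(Torus, ℝ)} (h : HasPDeriv j f g) : D j f = g := by
  have h' : ∃ g, HasPDeriv j f g := ⟨g, h⟩
  rw [D, dif_pos h']
  exact h'.choose_spec.unique h

lemma HasPDeriv.hasPDeriv_D {j : Fin 3} {f g : C(Torus, ℝ)} (h : HasPDeriv j f g) :
    HasPDeriv j f (D j f) := by rw [h.D_eq]; exact h

lemma HasPDeriv.hasDerivAt {j : Fin 3} {f g : C(Torus, ℝ)} (h : HasPDeriv j f g) (x : Torus)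
    (r₀ : ℝ) : HasDerivAt (fun r : ℝ => f (x + Pi.single j (r : UnitAddCircle)))
      (g (x + Pi.single j (r₀ : UnitAddCircle))) r₀ := by
  have h1 := h (x + Pi.single j (r₀ : UnitAddCircle))
  have h2 : HasDerivAt (fun r : ℝ => r - r₀) 1 r₀ := (hasDerivAt_id r₀).sub_const r₀
  have h3 := HasDerivAt.comp (h := fun r : ℝ => r - r₀) r₀ (by simpa using h1) h2
  rw [mul_one] at h3
  refine h3.congr_of_eventuallyEq (Filter.Eventually.of_forall fun r => ?_)
  simp [Function.comp, add_assoc, ← Pi.single_add]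

lemma HasPDeriv.sub {j : Fin 3} {f g f' g' : C(Torus, ℝ)} (hf : HasPDeriv j f f')
    (hg : HasPDeriv j g g') : HasPDeriv j (f - g) (f' - g') := fun x => (hf x).sub (hg x)

lemma HasPDeriv.mul {j : Fin 3} {f g f' g' : C(Torus, ℝ)} (hf : HasPDeriv j f f')
    (hg : HasPDeriv j g g') : HasPDeriv j (f * g) (f' * g + f * g') := fun x => by
  have := (hf x).fun_mul (hg x)
  simp only [QuotientAddGroup.mk_zero, Pi.single_zero, add_zero] at this
  exact this

lemma HasPDeriv.sum {ι : Type*} {j : Fin 3} {S : Finset ι} {f f' : ι → C(Torus, ℝ)}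
    (hf : ∀ i ∈ S, HasPDeriv j (f i) (f' i)) : HasPDeriv j (∑ i ∈ S, f i) (∑ i ∈ S, f' i) :=
  fun x => by simpa using HasDerivAt.fun_sum fun i hi => hf i hi x

lemma HasPDeriv.pderiv_eq {j : Fin 3} {f g : C(Torus, ℝ)} (h : HasPDeriv j f g) (x : Torus) :
    pderiv j f x = g x := (h x).deriv

lemma mFourier_single_coe (k : Fin 3 → ℤ) (j : Fin 3) (r : ℝ) :
    UnitAddTorus.mFourier k (Pi.single j (r : UnitAddCircle)) =
      fourier (k j) (r : UnitAddCircle) := by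
  simp only [UnitAddTorus.mFourier, ContinuousMap.coe_mk]
  rw [Finset.prod_eq_single j]
  · simp
  · intro i _ hi; rw [Pi.single_eq_of_ne hi, fourier_eval_zero]
  · simp

lemma mFourier_apply_add (k : Fin 3 → ℤ) (x y : Torus) :
    UnitAddTorus.mFourier k (x + y) = UnitAddTorus.mFourier k x * UnitAddTorus.mFourier k y := by
  simp only [UnitAddTorus.mFourier, ContinuousMap.coe_mk, Pi.add_apply,
    ← Finset.prod_mul_distrib]
  refine Finset.prod_congr rfl fun i _ => ?_
  rw [fourier_apply, fourier_apply, fourier_apply, smul_add, AddCircle.toCircle_add]; simp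

lemma hasDerivAt_mFourier (k : Fin 3 → ℤ) (j : Fin 3) (x : Torus) (r : ℝ) :
    HasDerivAt (fun r : ℝ => UnitAddTorus.mFourier k (x + Pi.single j (r : UnitAddCircle)))
      (2 * Real.pi * Complex.I * k j *
        UnitAddTorus.mFourier k (x + Pi.single j (r : UnitAddCircle))) r := by
  simp_rw [mFourier_apply_add, mFourier_single_coe]
  have := (hasDerivAt_fourier 1 (k j) r).const_mul (UnitAddTorus.mFourier k x)
  refine this.congr_deriv ?_
  push_cast; ring

/-- The Fourier multiplier of the partial derivative. -/
def mult (j : Fin 3) (k : Fin 3 → ℤ) : ℂ := 2 * Real.pi * Complex.I * k j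

lemma integral_mFourier_translate (f : C(Torus, ℝ)) (k : Fin 3 → ℤ) (y : Torus) :
    ∫ x, UnitAddTorus.mFourier (-k) x * (f (x + y) : ℂ) ∂haarT =
      UnitAddTorus.mFourier k y * fc f k := by
  rw [fc_eq, ← integral_const_mul]
  have := integral_add_right_eq_self (μ := haarT)
    (fun x => UnitAddTorus.mFourier (-k) (x - y) * (f x : ℂ)) y
  simp only [add_sub_cancel_right] at this
  rw [this]
  congr 1; ext x
  rw [← mul_assoc, sub_eq_add_neg, mFourier_apply_add]
  have : UnitAddTorus.mFourier (-k) (-y) = UnitAddTorus.mFourier k y := by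
    simp [UnitAddTorus.mFourier, fourier_apply]
  rw [this]; ring

lemma hasDerivAt_integral_translate {j : Fin 3} {f g : C(Torus, ℝ)} (h : HasPDeriv j f g)
    (k : Fin 3 → ℤ) :
    HasDerivAt (fun r : ℝ => ∫ x, UnitAddTorus.mFourier (-k) x *
      (f (x + Pi.single j (r : UnitAddCircle)) : ℂ) ∂haarT) (fc g k) 0 := by
  have hd : ∀ (x : Torus) (r : ℝ), HasDerivAt (fun r : ℝ => UnitAddTorus.mFourier (-k) x *
      (f (x + Pi.single j (r : UnitAddCircle)) : ℂ)) (UnitAddTorus.mFourier (-k) x *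
      (g (x + Pi.single j (r : UnitAddCircle)) : ℂ)) r := fun x r => by
    have h2 := (h.hasDerivAt x r).ofReal_comp
    exact h2.const_mul _
  have hc : ∀ (f : C(Torus, ℝ)) (r : ℝ), Integrable (fun x : Torus =>
      UnitAddTorus.mFourier (-k) x * (f (x + Pi.single j (r : UnitAddCircle)) : ℂ)) haarT :=
    fun f r => integrable_haarT (by fun_prop)
  have hb : ∀ (x : Torus) (r : ℝ), ‖UnitAddTorus.mFourier (-k) x *
      (g (x + Pi.single j (r : UnitAddCircle)) : ℂ)‖ ≤ ‖g‖ := fun x r => by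
    rw [norm_mul, norm_mFourier_apply, one_mul, Complex.norm_real]
    exact g.norm_coe_le_norm _
  have h2 := (hasDerivAt_integral_of_dominated_loc_of_deriv_le (𝕜 := ℝ) (μ := haarT)
    (Filter.univ_mem (f := nhds (0 : ℝ)))
    (Filter.Eventually.of_forall fun r => (hc f r).aestronglyMeasurable)
    (hc f 0) (hc g 0).aestronglyMeasurable
    (ae_of_all _ fun x r _ => hb x r) (integrable_const _)
    (ae_of_all _ fun x r _ => hd x r)).2
  refine h2.congr_deriv ?_
  rw [fc_eq]
  congr 1; ext x
  rw [QuotientAddGroup.mk_zero, Pi.single_zero, add_zero]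

/-- Translation by `r` in direction `j` multiplies the `k`-th coefficient by `eₖ` of the shift; both
sides of this identity are differentiated at `r = 0`. -/
lemma fc_of_hasPDeriv {j : Fin 3} {f g : C(Torus, ℝ)} (h : HasPDeriv j f g) (k : Fin 3 → ℤ) :
    fc g k = mult j k * fc f k := by
  have h2 := hasDerivAt_integral_translate h k
  have h3 := (hasDerivAt_mFourier k j 0 0).mul_const (fc f k)
  have e : (fun r : ℝ => ∫ x, UnitAddTorus.mFourier (-k) x *
      (f (x + Pi.single j (r : UnitAddCircle)) : ℂ) ∂haarT) = fun r : ℝ =>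
      UnitAddTorus.mFourier k (0 + Pi.single j (r : UnitAddCircle)) * fc f k := by
    ext r; rw [zero_add, integral_mFourier_translate]
  rw [e] at h2
  rw [h2.unique h3, mult]
  congr 1
  have : UnitAddTorus.mFourier k (0 : Torus) = 1 := by simp [UnitAddTorus.mFourier]
  rw [QuotientAddGroup.mk_zero, Pi.single_zero, add_zero, this, mul_one]

/-- The zero frequency of `fc_of_hasPDeriv`. This is the integration by parts behind the `L²`
estimates. -/
lemma integral_of_hasPDeriv {j : Fin 3} {f g : C(Torus, ℝ)} (h : HasPDeriv j f g) :
    ∫ x, g x ∂haarT = 0 := by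
  have := fc_of_hasPDeriv h 0
  rw [fc_eq, mult] at this
  simp only [neg_zero, UnitAddTorus.mFourier_zero, ContinuousMap.one_apply, one_mul,
    Pi.zero_apply, Int.cast_zero, mul_zero, zero_mul, integral_complex_ofReal] at this
  exact_mod_cast this

/-- Taking the real part, as a continuous linear map on continuous functions. -/
def reL : C(Torus, ℂ) →L[ℝ] C(Torus, ℝ) := Complex.reCLM.compLeftContinuous ℝ Torus

@[simp] lemma reL_apply (F : C(Torus, ℂ)) (x) : reL F x = (F x).re := rfl

lemma reL_toC (f : C(Torus, ℝ)) : reL (toC f) = f := by ext x; simp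

lemma norm_reL_le (F : C(Torus, ℂ)) : ‖reL F‖ ≤ ‖F‖ :=
  (ContinuousMap.norm_le _ (norm_nonneg _)).2 fun x =>
    (Complex.abs_re_le_norm _).trans (F.norm_coe_le_norm x)

/-- The real wave `Re (c e_k)`. -/
def wave (c : ℂ) (k : Fin 3 → ℤ) : C(Torus, ℝ) := reL (c • UnitAddTorus.mFourier k)

lemma norm_wave_le (c : ℂ) (k) : ‖wave c k‖ ≤ ‖c‖ := by
  refine (norm_reL_le _).trans ?_
  rw [norm_smul, UnitAddTorus.mFourier_norm, mul_one]

lemma wave_hasDerivAt (j : Fin 3) (c : ℂ) (k) (x : Torus) (r : ℝ) :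
    HasDerivAt (fun r : ℝ => wave c k (x + Pi.single j (r : UnitAddCircle)))
      (wave (mult j k * c) k (x + Pi.single j (r : UnitAddCircle))) r := by
  have h := (hasDerivAt_mFourier k j x r).const_mul c
  have h2 := Complex.reCLM.hasFDerivAt.comp_hasDerivAt r h
  refine h2.congr_deriv ?_
  simp only [wave, reL_apply, ContinuousMap.smul_apply, smul_eq_mul, Complex.reCLM_apply, mult]
  congr 1; ring

lemma hasPDeriv_wave (j : Fin 3) (c : ℂ) (k) : HasPDeriv j (wave c k) (wave (mult j k * c) k) :=
  fun x => by simpa using wave_hasDerivAt j c k x 0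

lemma norm_mult_le (j : Fin 3) (k) : ‖mult j k‖ ≤ 2 * Real.pi * jb k := by
  have : ‖mult j k‖ = 2 * Real.pi * |(k j : ℝ)| := by
    simp [mult, abs_of_pos Real.pi_pos]
  rw [this]
  have := abs_le_jb k j
  gcongr

lemma hasSum_wave {f : C(Torus, ℝ)} (h : ∑' k, ‖fc f k‖ₑ ≠ ⊤) :
    HasSum (fun k => wave (fc f k) k) f := by
  have := reL.hasSum (hasSum_fourier h)
  rwa [reL_toC] at this

/-- Bounds the `ℓ¹` norm of the coefficients of the first derivatives. The first factor on the right
is finite when `m - 1 > 3/2`, whence the threshold `5/2`. -/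
lemma tsum_jb_fc_sq_le (m : ℝ) (f : C(Torus, ℝ)) :
    (∑' k, W (1 / 2) k * ‖fc f k‖ₑ) ^ 2 ≤ (∑' k, W (-(m - 1)) k) * sobolevNormSq m f := by
  refine (tsum_sq_le_W (s := m - 1) (fun k => W (1 / 2) k * ‖fc f k‖ₑ)).trans (le_of_eq ?_)
  rw [sobolevNormSq_eq]
  congr 1
  refine tsum_congr fun k => ?_
  rw [mul_pow, W_half_sq, ← mul_assoc, ← W_add, sub_add_cancel]

lemma summable_jb_fc {m : ℝ} (hm : 5 / 2 < m) {f : C(Torus, ℝ)} (hf : MemH m f) :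
    Summable fun k => jb k * ‖fc f k‖ := by
  have h1 : (∑' k, W (1 / 2) k * ‖fc f k‖ₑ) ≠ ⊤ := by
    intro h
    have h2 := tsum_jb_fc_sq_le m f
    have h3 := ENNReal.mul_lt_top (tsum_W_neg_lt_top (s := m - 1) (by linarith)) hf
    rw [h, ENNReal.top_pow two_ne_zero, top_le_iff] at h2
    exact absurd h2 h3.ne
  have := ENNReal.summable_toReal h1
  refine this.congr fun k => ?_
  rw [W_eq_jb, ENNReal.toReal_mul, Real.rpow_one, ENNReal.toReal_ofReal (jb_pos k).le,
    toReal_enorm]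

lemma HasSum.apply_torus {g : (Fin 3 → ℤ) → C(Torus, ℝ)} {a : C(Torus, ℝ)} (h : HasSum g a)
    (x : Torus) : HasSum (fun k => g k x) (a x) :=
  (ContinuousMap.evalCLM ℝ x).hasSum h

/-- Termwise differentiation of the Fourier series, with the majorant `2π ⟨k⟩ |f̂(k)|` from
`summable_jb_fc`. -/
lemma exists_hasPDeriv {m : ℝ} (hm : 5 / 2 < m) {f : C(Torus, ℝ)} (hf : MemH m f) (j : Fin 3) :
    ∃ g, HasPDeriv j f g := by
  have hs := (summable_jb_fc hm hf).mul_left (2 * Real.pi)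
  have hbd : ∀ k, ‖mult j k * fc f k‖ ≤ 2 * Real.pi * (jb k * ‖fc f k‖) := fun k => by
    rw [norm_mul, ← mul_assoc]
    exact mul_le_mul_of_nonneg_right (norm_mult_le j k) (norm_nonneg _)
  have hs2 : Summable fun k => wave (mult j k * fc f k) k :=
    Summable.of_norm_bounded hs fun k => (norm_wave_le _ _).trans (hbd k)
  have hf1 := hasSum_wave (tsum_fc_ne_top (by linarith : 3 / 2 < m) hf)
  refine ⟨∑' k, wave (mult j k * fc f k) k, fun x => ?_⟩
  have hb : ∀ k (r : ℝ), ‖wave (mult j k * fc f k) k (x + Pi.single j (r : UnitAddCircle))‖ ≤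
      2 * Real.pi * (jb k * ‖fc f k‖) := fun k r =>
    ((ContinuousMap.norm_coe_le_norm _ _).trans (norm_wave_le _ _)).trans (hbd k)
  have h := hasDerivAt_tsum (𝕜 := ℝ) (F := ℝ) hs (y₀ := 0)
    (fun k r => wave_hasDerivAt j (fc f k) k x r) hb
    (HasSum.apply_torus hf1 _).summable 0
  have e1 : (fun r : ℝ => ∑' k, wave (fc f k) k (x + Pi.single j (r : UnitAddCircle))) =
      fun r : ℝ => f (x + Pi.single j (r : UnitAddCircle)) :=
    funext fun r => (HasSum.apply_torus hf1 _).tsum_eq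
  rw [e1] at h
  refine h.congr_deriv ?_
  rw [(HasSum.apply_torus hs2.hasSum _).tsum_eq]
  simp

lemma MemH.hasPDeriv {m : ℝ} (hm : 5 / 2 < m) {f : C(Torus, ℝ)} (hf : MemH m f) (j : Fin 3) :
    HasPDeriv j f (D j f) := (exists_hasPDeriv hm hf j).choose_spec.hasPDeriv_D

lemma sobolevNormSq_hasPDeriv_le {s : ℝ} {j : Fin 3} {f g : C(Torus, ℝ)} (h : HasPDeriv j f g) :
    sobolevNormSq (s - 1) g ≤ ENNReal.ofReal ((2 * Real.pi) ^ 2) * sobolevNormSq s f := by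
  rw [sobolevNormSq_eq, sobolevNormSq_eq, ← ENNReal.tsum_mul_left]
  refine ENNReal.tsum_le_tsum fun k => ?_
  rw [fc_of_hasPDeriv h, enorm_mul, mul_pow]
  have h1 : ‖mult j k‖ₑ ^ 2 ≤ ENNReal.ofReal ((2 * Real.pi) ^ 2) * W 1 k := by
    rw [← ofReal_norm, ← ENNReal.ofReal_pow (norm_nonneg _), W, Real.rpow_one,
      ← ENNReal.ofReal_mul (by positivity), ← jb_sq, ← mul_pow]
    exact ENNReal.ofReal_le_ofReal (pow_le_pow_left₀ (norm_nonneg _) (norm_mult_le j k) 2)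
  calc W (s - 1) k * (‖mult j k‖ₑ ^ 2 * ‖fc f k‖ₑ ^ 2)
      ≤ W (s - 1) k * (ENNReal.ofReal ((2 * Real.pi) ^ 2) * W 1 k * ‖fc f k‖ₑ ^ 2) := by gcongr
    _ = ENNReal.ofReal ((2 * Real.pi) ^ 2) * (W (s - 1) k * W 1 k * ‖fc f k‖ₑ ^ 2) := by ring
    _ = _ := by rw [← W_add, sub_add_cancel]

/-- `H^s` from `H^{s-1}` bounds on the function and its first derivatives. -/
lemma sobolevNormSq_le_hasPDeriv {s : ℝ} {f : C(Torus, ℝ)} {g : Fin 3 → C(Torus, ℝ)}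
    (h : ∀ j, HasPDeriv j f (g j)) :
    sobolevNormSq s f ≤ sobolevNormSq (s - 1) f + ∑ j, sobolevNormSq (s - 1) (g j) := by
  simp_rw [sobolevNormSq_eq]
  rw [← Summable.tsum_finsetSum (fun _ _ => ENNReal.summable), ← ENNReal.tsum_add]
  refine ENNReal.tsum_le_tsum fun k => ?_
  have e : W s k = W (s - 1) k * W 1 k := by rw [← W_add, sub_add_cancel]
  -- The multiplier has modulus `2π |kⱼ| ≥ |kⱼ|`, so the sum on the right already dominates `1 +
  -- |k|²`.
  have h1 : W 1 k ≤ 1 + ∑ j, ‖mult j k‖ₑ ^ 2 := by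
    rw [W, Real.rpow_one, wt, ENNReal.ofReal_add (by norm_num) (Finset.sum_nonneg fun i _ =>
      sq_nonneg _), ENNReal.ofReal_one, ENNReal.ofReal_sum_of_nonneg (fun i _ => sq_nonneg _)]
    gcongr with j
    rw [← ofReal_norm, ← ENNReal.ofReal_pow (norm_nonneg _)]
    apply ENNReal.ofReal_le_ofReal
    have : ‖mult j k‖ = 2 * Real.pi * |(k j : ℝ)| := by
      simp [mult, abs_of_pos Real.pi_pos]
    rw [this, mul_pow, sq_abs]
    have hp := Real.pi_gt_three
    have : 1 ≤ (2 * Real.pi) ^ 2 := by nlinarith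
    nlinarith [sq_nonneg (k j : ℝ)]
  simp_rw [fun j => fc_of_hasPDeriv (h j) k, enorm_mul, mul_pow]
  rw [e]
  calc W (s - 1) k * W 1 k * ‖fc f k‖ₑ ^ 2
      ≤ W (s - 1) k * (1 + ∑ j, ‖mult j k‖ₑ ^ 2) * ‖fc f k‖ₑ ^ 2 := by gcongr
    _ = _ := by
      rw [mul_add, add_mul, mul_one, Finset.mul_sum, Finset.sum_mul]
      congr 1
      refine Finset.sum_congr rfl fun j _ => ?_
      ring

lemma MemH.D {m : ℝ} (hm : 5 / 2 < m) {f : C(Torus, ℝ)} (hf : MemH m f) (j : Fin 3) :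
    MemH (m - 1) (D j f) :=
  (sobolevNormSq_hasPDeriv_le (hf.hasPDeriv hm j)).trans_lt
    (ENNReal.mul_lt_top ENNReal.ofReal_lt_top hf)

lemma exists_sobolev_D_le {m : ℝ} (hm : 5 / 2 < m) (M : ℝ≥0) :
    ∃ M' : ℝ≥0, ∀ f : C(Torus, ℝ), sobolevNormSq m f ≤ M → ∀ j,
      sobolevNormSq (m - 1) (SelfAlign.D j f) ≤ M' := by
  refine ⟨(Real.toNNReal ((2 * Real.pi) ^ 2)) * M, fun f hf j => ?_⟩
  refine (sobolevNormSq_hasPDeriv_le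
    (MemH.hasPDeriv hm (hf.trans_lt ENNReal.coe_lt_top) j)).trans ?_
  rw [ENNReal.coe_mul]
  exact mul_le_mul_right hf _

lemma exists_norm_le {s : ℝ} (hs : 3 / 2 < s) (M : ℝ≥0) :
    ∃ R : ℝ≥0, ∀ f : C(Torus, ℝ), sobolevNormSq s f ≤ M → ‖f‖ ≤ R := by
  set K := ∑' k, W (-s) k with hK
  have hKt : K < ⊤ := tsum_W_neg_lt_top hs
  refine ⟨NNReal.sqrt (K.toNNReal * M), fun f hf => ?_⟩
  have h1 := (enorm_sq_le_sobolev (s := s) f).trans (mul_le_mul_right hf _)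
  rw [← hK, ← ENNReal.coe_toNNReal hKt.ne, ← ENNReal.coe_mul] at h1
  have h2 : ‖f‖₊ ^ 2 ≤ K.toNNReal * M := by
    rw [← ENNReal.coe_le_coe, ENNReal.coe_pow]
    exact h1
  exact NNReal.coe_le_coe.2 (NNReal.le_sqrt_iff_sq_le.2 h2)

/-- The derivatives are bounded in `H^(m-1)` with `m - 1 > 3/2` and their coefficients converge, so
`tendsto_of_fc` applies to them. -/
lemma tendsto_D_of_tendsto {α : Type*} {l : Filter α} [l.NeBot] {m : ℝ} (hm : 5 / 2 < m) {M : ℝ≥0}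
    {f : α → C(Torus, ℝ)} {g : C(Torus, ℝ)} (hf : ∀ᶠ a in l, sobolevNormSq m (f a) ≤ M)
    (h : Filter.Tendsto f l (nhds g)) (j : Fin 3) :
    Filter.Tendsto (fun a => SelfAlign.D j (f a)) l (nhds (SelfAlign.D j g)) := by
  have hg := sobolevNormSq_le_of_tendsto hf h
  obtain ⟨M', hM'⟩ := exists_sobolev_D_le hm M
  refine tendsto_of_fc (s := m - 1) (by linarith) (hf.mono fun a ha => hM' _ ha j) (hM' _ hg j)
    fun k => ?_
  rw [fc_of_hasPDeriv (MemH.hasPDeriv hm (hg.trans_lt ENNReal.coe_lt_top) j)]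
  refine ((((continuous_fc k).tendsto g).comp h).const_mul (mult j k)).congr' ?_
  filter_upwards [hf] with a ha
  rw [fc_of_hasPDeriv (MemH.hasPDeriv hm (ha.trans_lt ENNReal.coe_lt_top) j)]; rfl

/-! ### Composition with smooth functions -/

section Nem
variable {ι : Type*}

/-- The value at `x` of a family of functions. -/
def ev (u : ι → C(Torus, ℝ)) (x : Torus) : ι → ℝ := fun a => u a x

lemma continuous_ev (u : ι → C(Torus, ℝ)) : Continuous (ev u) :=
  continuous_pi fun a => (u a).continuous

open Classical in
/-- The composition `F ∘ u` (zero if it is not continuous). -/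
def nem (F : (ι → ℝ) → ℝ) (u : ι → C(Torus, ℝ)) : C(Torus, ℝ) :=
  if h : Continuous fun x => F (ev u x) then ⟨_, h⟩ else 0

/-- The families of functions with values in `U`. -/
def Adm (U : Set (ι → ℝ)) : Set (ι → C(Torus, ℝ)) := {u | ∀ x, ev u x ∈ U}

variable {U : Set (ι → ℝ)} {F : (ι → ℝ) → ℝ}

lemma nem_apply (hF : ContinuousOn F U) {u : ι → C(Torus, ℝ)} (hu : u ∈ Adm U) (x : Torus) :
    nem F u x = F (ev u x) := by
  have h : Continuous fun x => F (ev u x) := hF.comp_continuous (continuous_ev u) hu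
  rw [nem, dif_pos h]; rfl

/-- The map `(u, x) ↦ F (u x)` is jointly continuous on admissible families times the torus;
currying gives continuity in the sup norm. -/
lemma continuousOn_nem (hF : ContinuousOn F U) : ContinuousOn (nem F) (Adm U) := by
  rw [continuousOn_iff_continuous_domRestrict]
  refine ContinuousMap.continuous_of_continuous_uncurry _ ?_
  have e : Function.uncurry (fun (u : Adm U) (x : Torus) => (Adm U).domRestrict (nem F) u x) =
      fun p : Adm U × Torus => F (ev p.1.1 p.2) := by
    ext p; exact nem_apply hF p.1.2 p.2
  rw [e]
  refine hF.comp_continuous (continuous_pi fun a => ?_) fun p => p.1.2 p.2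
  have : Continuous fun p : Adm U × Torus => ((p.1.1 a), p.2) :=
    ((continuous_apply a).comp (continuous_subtype_val.comp continuous_fst)).prodMk continuous_snd
  exact continuous_eval.comp this

lemma exists_norm_nem_le {K : Set (ι → ℝ)} (hK : IsCompact K) (hF : ContinuousOn F K) :
    ∃ C : ℝ≥0, ∀ u ∈ Adm K, ‖nem F u‖ ≤ C := by
  obtain ⟨C, hC⟩ := hK.exists_bound_of_continuousOn hF
  refine ⟨C.toNNReal, fun u hu => (ContinuousMap.norm_le _ (by positivity)).2 fun x => ?_⟩
  rw [nem_apply hF hu]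
  exact (hC _ (hu x)).trans (Real.le_coe_toNNReal C)

variable [Fintype ι] [DecidableEq ι]

/-- The partial derivatives of a function of several real variables. -/
def pd (a : ι) (F : (ι → ℝ) → ℝ) : (ι → ℝ) → ℝ := fun y => fderiv ℝ F y (Pi.single a 1)

lemma contDiffOn_pd (hU : IsOpen U) (hF : ContDiffOn ℝ ∞ F U) (a : ι) :
    ContDiffOn ℝ ∞ (pd a F) U :=
  (hF.fderiv_of_isOpen hU (by simp)).clm_apply contDiffOn_const

lemma hasDerivAt_comp_pd (hU : IsOpen U) (hF : ContDiffOn ℝ ∞ F U) {y : ℝ → ι → ℝ} {y' : ι → ℝ}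
    {t : ℝ} (hy : ∀ a, HasDerivAt (fun s => y s a) (y' a) t) (hyU : y t ∈ U) :
    HasDerivAt (fun s => F (y s)) (∑ a, pd a F (y t) * y' a) t := by
  have h1 : HasFDerivAt F (fderiv ℝ F (y t)) (y t) :=
    ((hF.contDiffAt (hU.mem_nhds hyU)).differentiableAt (by simp)).hasFDerivAt
  have h2 : HasDerivAt y y' t := hasDerivAt_pi.2 hy
  refine (h1.comp_hasDerivAt t h2).congr_deriv ?_
  conv_lhs => rw [← Finset.univ_sum_single y', map_sum]
  refine Finset.sum_congr rfl fun a _ => ?_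
  rw [pd, mul_comm, ← smul_eq_mul, ← map_smul, ← Pi.single_smul, smul_eq_mul, mul_one]

lemma hasPDeriv_nem (hU : IsOpen U) (hF : ContDiffOn ℝ ∞ F U) {u u' : ι → C(Torus, ℝ)}
    {j : Fin 3} (hu : u ∈ Adm U) (hu' : ∀ a, HasPDeriv j (u a) (u' a)) :
    HasPDeriv j (nem F u) (∑ a, nem (pd a F) u * u' a) := by
  intro x
  have h := hasDerivAt_comp_pd hU hF (t := 0)
    (y := fun r a => u a (x + Pi.single j (r : UnitAddCircle))) (fun a => hu' a x) (hu _)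
  have e : (fun r : ℝ => nem F u (x + Pi.single j (r : UnitAddCircle))) =
      fun r : ℝ => F (fun a => u a (x + Pi.single j (r : UnitAddCircle))) :=
    funext fun r => nem_apply hF.continuousOn hu _
  rw [e]
  refine h.congr_deriv ?_
  rw [ContinuousMap.sum_apply]
  refine Finset.sum_congr rfl fun a _ => ?_
  rw [ContinuousMap.mul_apply, nem_apply (contDiffOn_pd hU hF a).continuousOn hu,
    QuotientAddGroup.mk_zero, Pi.single_zero, add_zero]
  rfl

/-- Moser-type estimate: `u ↦ F ∘ u` is bounded on bounded sets of `H^m`. -/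
lemma exists_sobolev_nem_le_aux {m : ℝ} (hm : 5 / 2 < m) (hU : IsOpen U) {K : Set (ι → ℝ)}
    (hK : IsCompact K) (hKU : K ⊆ U) (M : ℝ≥0) (N : ℕ) :
    ∀ F : (ι → ℝ) → ℝ, ContDiffOn ℝ ∞ F U → ∀ s : ℝ, 0 ≤ s → s ≤ N → s ≤ m →
      ∃ C : ℝ≥0, ∀ u ∈ Adm K, (∀ a, sobolevNormSq m (u a) ≤ M) →
        sobolevNormSq s (nem F u) ≤ C := by
  -- Induction on the number of derivatives. `F` is quantified inside because the chain rule
  -- replaces it by its partial derivatives; the order `s` is real, and `N` only bounds it.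
  induction N with
  | zero =>
    intro F hF s hs0 hs1 _
    obtain rfl : s = 0 := le_antisymm (by simpa using hs1) hs0
    obtain ⟨C, hC⟩ := exists_norm_nem_le hK (hF.continuousOn.mono hKU)
    refine ⟨C ^ 2, fun u hu _ => ?_⟩
    have h1 : sobolevNormSq 0 (nem F u) = ∑' k, ‖fc (nem F u) k‖ₑ ^ 2 := by
      rw [sobolevNormSq_eq]; simp [W_zero]
    rw [h1]
    refine (tsum_fc_sq_le _).trans ?_
    rw [ENNReal.ofReal_pow (norm_nonneg _), ENNReal.coe_pow]
    gcongr
    rw [← ENNReal.ofReal_coe_nnreal]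
    exact ENNReal.ofReal_le_ofReal (hC u hu)
  | succ N ih =>
    intro F hF s hs0 hsN hsm
    push_cast at hsN
    -- One derivative is removed, but not below order zero; the `H^(r+1)` norm then dominates the
    -- `H^s` norm.
    have h0 : 0 ≤ max (s - 1) 0 := le_max_right _ _
    have h1 : max (s - 1) 0 ≤ N := max_le (by linarith) (by positivity)
    have h2 : max (s - 1) 0 ≤ m - 1 := max_le (by linarith) (by linarith)
    set r := max (s - 1) 0 with hr
    obtain ⟨C₀, hC₀⟩ := ih F hF r h0 h1 (by linarith)
    choose C₁ hC₁ using fun a => ih (pd a F) (contDiffOn_pd hU hF a) r h0 h1 (by linarith)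
    obtain ⟨C₂, hC₂⟩ := sobolev_mul h0 h2 (by linarith)
    obtain ⟨M', hM'⟩ := exists_sobolev_D_le hm M
    refine ⟨C₀ + ∑ _j : Fin 3, 2 ^ (Fintype.card ι) * ∑ a, C₂ * M' * C₁ a, fun u hu hum => ?_⟩
    have hH : ∀ a, MemH m (u a) := fun a => (hum a).trans_lt ENNReal.coe_lt_top
    have h3 := fun j => hasPDeriv_nem hU hF (fun x => hKU (hu x))
      fun a => MemH.hasPDeriv hm (hH a) j
    refine (sobolevNormSq_mono (show s ≤ r + 1 by
      have := le_max_left (s - 1) 0; linarith) _).trans ?_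
    refine (sobolevNormSq_le_hasPDeriv h3).trans ?_
    rw [add_sub_cancel_right]
    push_cast
    refine add_le_add (hC₀ u hu hum) (Finset.sum_le_sum fun j _ => ?_)
    refine (sobolevNormSq_sum_le _ _ _).trans ?_
    rw [Finset.card_univ]
    gcongr with a
    -- The factor `∂ⱼ u` comes first: it lies in `H^(m-1)` with `m - 1 > 3/2`, whereas the composed
    -- factor is controlled only in `H^r`.
    rw [mul_comm (nem _ _)]
    refine (hC₂ _ _ (MemH.D hm (hH a) j)).trans ?_
    gcongr
    · exact hM' _ (hum a) j
    · exact hC₁ a u hu hum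

lemma exists_sobolev_nem_le {m : ℝ} (hm : 5 / 2 < m) (hU : IsOpen U) {K : Set (ι → ℝ)}
    (hK : IsCompact K) (hKU : K ⊆ U) (M : ℝ≥0) (hF : ContDiffOn ℝ ∞ F U) :
    ∃ C : ℝ≥0, ∀ u ∈ Adm K, (∀ a, sobolevNormSq m (u a) ≤ M) →
        sobolevNormSq m (nem F u) ≤ C := by
  obtain ⟨N, hN⟩ := exists_nat_ge m
  exact exists_sobolev_nem_le_aux hm hU hK hKU M N F hF m (by linarith) hN le_rfl

end Nem

/-! ### The energy estimate -/

/-- Cauchy–Schwarz in `k` between `X` and the convolution of `b` and `Y`. The bounds involve full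
series, so the result does not depend on `F`. -/
lemma sum_sum_le_sqrt {F : Finset (Fin 3 → ℤ)} {X b Y : (Fin 3 → ℤ) → ℝ}
    (hX : ∀ k, 0 ≤ X k) (hb : ∀ k, 0 ≤ b k) (hY : ∀ k, 0 ≤ Y k) {M B : ℝ≥0}
    (h1 : ∑' k, ENNReal.ofReal (X k) ^ 2 ≤ M)
    (h2 : ∑' k, (∑' l, ENNReal.ofReal (b (k - l)) * ENNReal.ofReal (Y l)) ^ 2 ≤ B) :
    ∑ k ∈ F, ∑ l ∈ F, X k * (b (k - l) * Y l) ≤ Real.sqrt (M * B) := by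
  have h3 : ENNReal.ofReal (∑ k ∈ F, ∑ l ∈ F, X k * (b (k - l) * Y l)) ^ 2 ≤ M * B := by
    have h4 : ENNReal.ofReal (∑ k ∈ F, ∑ l ∈ F, X k * (b (k - l) * Y l)) ≤
        ∑' k, ENNReal.ofReal (X k) * ∑' l, ENNReal.ofReal (b (k - l)) * ENNReal.ofReal (Y l) := by
      rw [ENNReal.ofReal_sum_of_nonneg fun k _ => Finset.sum_nonneg fun l _ =>
        mul_nonneg (hX k) (mul_nonneg (hb _) (hY l))]
      refine le_trans (Finset.sum_le_sum fun k _ => ?_) (ENNReal.sum_le_tsum F)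
      rw [← Finset.mul_sum, ENNReal.ofReal_mul (hX k), ENNReal.ofReal_sum_of_nonneg
        fun l _ => mul_nonneg (hb _) (hY l)]
      gcongr
      refine le_trans (Finset.sum_le_sum fun l _ => ?_) (ENNReal.sum_le_tsum F)
      rw [ENNReal.ofReal_mul (hb _)]
    exact (pow_le_pow_left' h4 2).trans ((tsum_mul_sq_le _ _).trans (mul_le_mul' h1 h2))
  apply Real.le_sqrt_of_sq_le
  have h0 : 0 ≤ ∑ k ∈ F, ∑ l ∈ F, X k * (b (k - l) * Y l) := Finset.sum_nonneg fun k _ =>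
    Finset.sum_nonneg fun l _ => mul_nonneg (hX k) (mul_nonneg (hb _) (hY l))
  rw [← ENNReal.ofReal_pow h0, ← ENNReal.coe_mul, ENNReal.ofReal_le_iff_le_toReal ENNReal.coe_ne_top] at h3
  simpa using h3

lemma ofReal_jb_rpow_mul_norm (m : ℝ) (f : C(Torus, ℝ)) (k) :
    ENNReal.ofReal (jb k ^ m * ‖fc f k‖) = W (m / 2) k * ‖fc f k‖ₑ := by
  rw [W_eq_jb, ENNReal.ofReal_mul (Real.rpow_nonneg (jb_pos k).le _), ofReal_norm]

lemma tsum_ofReal_jb_sq (m : ℝ) (f : C(Torus, ℝ)) :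
    ∑' k, ENNReal.ofReal (jb k ^ m * ‖fc f k‖) ^ 2 = sobolevNormSq m f := by
  rw [sobolevNormSq_eq]
  refine tsum_congr fun k => ?_
  rw [ofReal_jb_rpow_mul_norm, mul_pow, W_half_sq]

/-- Bernoulli's inequality `1 + m s ≤ (1 + s)^m` at `s = a/b - 1`, multiplied by `b^m`. -/
lemma rpow_sub_rpow_le {a b m : ℝ} (ha : 0 < a) (hab : a ≤ b) (hm : 1 ≤ m) :
    b ^ m - a ^ m ≤ m * b ^ (m - 1) * (b - a) := by
  have hb : 0 < b := ha.trans_le hab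
  have h := one_add_mul_self_le_rpow_one_add (s := a / b - 1) (by
    have : 0 ≤ a / b := by positivity
    linarith) hm
  rw [add_sub_cancel, Real.div_rpow ha.le hb.le, le_div_iff₀ (by positivity)] at h
  have e : b ^ m = b ^ (m - 1) * b := by
    rw [← Real.rpow_add_one hb.ne', sub_add_cancel]
  have e2 : (1 + m * (a / b - 1)) * b ^ m = b ^ m + m * b ^ (m - 1) * (a - b) := by
    rw [e]; field_simp
  linarith

lemma abs_rpow_sub_rpow_le {a b m : ℝ} (ha : 0 < a) (hb : 0 < b) (hm : 1 ≤ m) :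
    |a ^ m - b ^ m| ≤ m * max a b ^ (m - 1) * |a - b| := by
  rcases le_total a b with h | h
  · rw [max_eq_right h, abs_sub_comm, abs_sub_comm a,
      abs_of_nonneg (sub_nonneg.2 (Real.rpow_le_rpow ha.le h (by linarith))),
      abs_of_nonneg (sub_nonneg.2 h)]
    exact rpow_sub_rpow_le ha h hm
  · rw [max_eq_left h,
      abs_of_nonneg (sub_nonneg.2 (Real.rpow_le_rpow hb.le h (by linarith))),
      abs_of_nonneg (sub_nonneg.2 h)]
    exact rpow_sub_rpow_le hb h hm

/-- The commutator estimate for the symbol `⟨k⟩^m`. -/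
lemma jb_commutator {m : ℝ} (hm : 1 ≤ m) (k l : Fin 3 → ℤ) :
    |jb k ^ m - jb l ^ m| * jb l ≤
      m * 2 ^ (m - 1) * (jb (k - l) ^ m * jb l + jb (k - l) * jb l ^ m) := by
  have hd := jb_pos (k - l)
  have hl := jb_pos l
  have h1 := abs_rpow_sub_rpow_le (jb_pos k) hl hm
  have h2 : max (jb k) (jb l) ^ (m - 1) ≤
      2 ^ (m - 1) * (jb (k - l) ^ (m - 1) + jb l ^ (m - 1)) := by
    refine (Real.rpow_le_rpow (le_max_of_le_right hl.le)
      (max_le (jb_le_add k l) (by linarith)) (by linarith)).trans ?_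
    exact add_rpow_le' hd.le hl.le (by linarith)
  have h3 : |jb k ^ m - jb l ^ m| ≤
      m * (2 ^ (m - 1) * (jb (k - l) ^ (m - 1) + jb l ^ (m - 1))) * jb (k - l) := by
    refine h1.trans ?_
    have := abs_jb_sub_le k l
    gcongr
  refine (mul_le_mul_of_nonneg_right h3 hl.le).trans (le_of_eq ?_)
  have e1 : jb (k - l) ^ m = jb (k - l) ^ (m - 1) * jb (k - l) := by
    rw [← Real.rpow_add_one hd.ne', sub_add_cancel]
  have e2 : jb l ^ m = jb l ^ (m - 1) * jb l := by
    rw [← Real.rpow_add_one hl.ne', sub_add_cancel]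
  rw [e1, e2]; ring

lemma conj_mult (j : Fin 3) (k) : conj (mult j k) = -mult j k := by
  have : mult j k = ((2 * Real.pi * k j : ℝ) : ℂ) * Complex.I := by
    simp only [mult]; push_cast; ring
  rw [this, map_mul, Complex.conj_ofReal, Complex.conj_I, mul_neg]

lemma norm_mult_sub_le (j : Fin 3) (k l) : ‖mult j l - mult j k‖ ≤ 2 * Real.pi * jb (k - l) := by
  have : mult j l - mult j k = -mult j (k - l) := by
    simp only [mult, Pi.sub_apply, Int.cast_sub]; ring
  rw [this, norm_neg]
  exact norm_mult_le j _

section Energy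
variable {ι : Type*} [Fintype ι]

/-- Exchanging `(a, k)` with `(b, l)` and conjugating preserves the kernel `α` and turns the
multiplier at `l` into minus the multiplier at `k`. Averaging the two forms leaves the difference of
the multipliers, which is of size `|k - l|`: the derivative has moved from the unknown to the
coefficient. -/
lemma sum_symmetrize (F : Finset (Fin 3 → ℤ)) (j : Fin 3) (V : ι → (Fin 3 → ℤ) → ℂ)
    (α : ι → ι → (Fin 3 → ℤ) → ℂ) (hα : ∀ a b d, α b a (-d) = conj (α a b d)) :
    2 * ∑ a, ∑ b, ∑ k ∈ F, ∑ l ∈ F, (conj (V a k) * (α a b (k - l) * (mult j l * V b l))).re =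
      ∑ a, ∑ b, ∑ k ∈ F, ∑ l ∈ F,
        (conj (V a k) * (α a b (k - l) * ((mult j l - mult j k) * V b l))).re := by
  have h1 : ∑ a, ∑ b, ∑ k ∈ F, ∑ l ∈ F,
      (conj (V a k) * (α a b (k - l) * (mult j l * V b l))).re =
      ∑ a, ∑ b, ∑ k ∈ F, ∑ l ∈ F,
        -(conj (V a k) * (α a b (k - l) * (mult j k * V b l))).re := by
    rw [Finset.sum_comm]
    refine Finset.sum_congr rfl fun a _ => Finset.sum_congr rfl fun b _ => ?_
    rw [Finset.sum_comm]
    refine Finset.sum_congr rfl fun k _ => Finset.sum_congr rfl fun l _ => ?_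
    rw [← Complex.conj_re, ← Complex.neg_re]
    congr 1
    have : conj (α b a (l - k)) = α a b (k - l) := by
      rw [← neg_sub k l, hα a b, Complex.conj_conj]
    rw [map_mul, map_mul, map_mul, this, conj_mult, Complex.conj_conj]; ring
  rw [two_mul]
  nth_rewrite 2 [h1]
  simp_rw [← Finset.sum_add_distrib]
  refine Finset.sum_congr rfl fun a _ => Finset.sum_congr rfl fun b _ => Finset.sum_congr rfl
    fun k _ => Finset.sum_congr rfl fun l _ => ?_
  rw [← Complex.neg_re, ← Complex.add_re]
  congr 1; ring

lemma fc_mul_D_eq {m : ℝ} (hm : 5 / 2 < m) {F : Finset (Fin 3 → ℤ)} {j : Fin 3}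
    {g w : C(Torus, ℝ)} (hw : MemH m w) (hF : ∀ k ∉ F, fc w k = 0) (k) :
    fc (g * D j w) k = ∑ l ∈ F, fc g (k - l) * (mult j l * fc w l) := by
  have h := (hasSum_fc_mul (g := g) (tsum_fc_ne_top (by linarith : 3 / 2 < m - 1)
    (MemH.D hm hw j)) k).tsum_eq
  rw [mul_comm, ← h, tsum_eq_sum (s := F)]
  · refine Finset.sum_congr rfl fun l _ => ?_
    rw [fc_of_hasPDeriv (hw.hasPDeriv hm j)]; ring
  · intro l hl
    rw [fc_of_hasPDeriv (hw.hasPDeriv hm j), hF l hl]; simp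

/-- The energy estimate for symmetric first order operators, on trigonometric polynomials. -/
lemma exists_energy_le {m : ℝ} (hm : 5 / 2 < m) (M G : ℝ≥0) :
    ∃ C : ℝ≥0, ∀ (F : Finset (Fin 3 → ℤ)) (j : Fin 3) (v : ι → C(Torus, ℝ))
      (g : ι → ι → C(Torus, ℝ)), (∀ a b, g a b = g b a) → (∀ a, sobolevNormSq m (v a) ≤ M) →
      (∀ a b, sobolevNormSq m (g a b) ≤ G) → (∀ a, ∀ k ∉ F, fc (v a) k = 0) →
      |∑ a, ∑ b, ∑ k ∈ F, wt k ^ m * (conj (fc (v a) k) * fc (g a b * D j (v b)) k).re| ≤ C := by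
  set K := (∑' k, W (-(m - 1)) k).toNNReal with hK
  have hKt : ∑' k, W (-(m - 1)) k = K :=
    (ENNReal.coe_toNNReal (tsum_W_neg_lt_top (by linarith)).ne).symm
  set c₀ : ℝ := m * 2 ^ (m - 1) with hc₀
  have hc₀0 : 0 ≤ c₀ := by positivity
  -- `S₁` bounds the terms in which the weight `⟨·⟩^m` falls on the coefficient, `S₂` those in which
  -- it falls on the unknown. The remaining factor, with one derivative, is summed in `ℓ¹` by means
  -- of `K`.
  set S₁ : ℝ := Real.sqrt (M * (K * M * G : ℝ≥0)) with hS₁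
  set S₂ : ℝ := Real.sqrt (M * (K * G * M : ℝ≥0)) with hS₂
  set C : ℝ := ∑ _a : ι, ∑ _b : ι, 2 * Real.pi * c₀ * (S₁ + S₂) +
    ∑ _a : ι, ∑ _b : ι, 2 * Real.pi * S₂ with hC
  refine ⟨C.toNNReal, fun F j v g hg hv hgG hF => ?_⟩
  rw [Real.coe_toNNReal C (by positivity)]
  have hvm : ∀ a, MemH m (v a) := fun a => (hv a).trans_lt ENNReal.coe_lt_top
  have hJ : ∀ (f : C(Torus, ℝ)), ∑' k, ENNReal.ofReal (jb k * ‖fc f k‖) =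
      ∑' k, W (1 / 2) k * ‖fc f k‖ₑ := fun f => tsum_congr fun k => by
    rw [← ofReal_jb_rpow_mul_norm, Real.rpow_one]
  -- the two bilinear bounds
  have B₁ : ∀ a b c, ∑ k ∈ F, ∑ l ∈ F, (jb k ^ m * ‖fc (v a) k‖) *
      ((jb (k - l) ^ m * ‖fc (g a b) (k - l)‖) * (jb l * ‖fc (v c) l‖)) ≤ S₁ := fun a b c => by
    refine sum_sum_le_sqrt (b := fun d => jb d ^ m * ‖fc (g a b) d‖)
      (fun k => by have := jb_pos k; positivity)
      (fun k => by have := jb_pos k; positivity) (fun k => by have := jb_pos k; positivity)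
      ((tsum_ofReal_jb_sq m (v a)).trans_le (hv a)) ?_
    have := tsum_conv_sq_le (fun l => ENNReal.ofReal (jb l * ‖fc (v c) l‖))
      (fun d => ENNReal.ofReal (jb d ^ m * ‖fc (g a b) d‖))
    simp_rw [mul_comm (ENNReal.ofReal (jb _ ^ m * _))]
    refine this.trans ?_
    rw [tsum_ofReal_jb_sq, hJ, ENNReal.coe_mul, ENNReal.coe_mul]
    refine mul_le_mul' ((tsum_jb_fc_sq_le m _).trans ?_) (hgG a b)
    rw [hKt]
    exact mul_le_mul_right (hv c) _
  have B₂ : ∀ a b c, ∑ k ∈ F, ∑ l ∈ F, (jb k ^ m * ‖fc (v a) k‖) *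
      ((jb (k - l) * ‖fc (g a b) (k - l)‖) * (jb l ^ m * ‖fc (v c) l‖)) ≤ S₂ := fun a b c => by
    refine sum_sum_le_sqrt (b := fun d => jb d * ‖fc (g a b) d‖)
      (fun k => by have := jb_pos k; positivity)
      (fun k => by have := jb_pos k; positivity) (fun k => by have := jb_pos k; positivity)
      ((tsum_ofReal_jb_sq m (v a)).trans_le (hv a)) ?_
    have := tsum_conv_sq_le (fun d => ENNReal.ofReal (jb d * ‖fc (g a b) d‖))
      (fun l => ENNReal.ofReal (jb l ^ m * ‖fc (v c) l‖))
    simp_rw [fun k => tsum_conv_comm (fun d => ENNReal.ofReal (jb d * ‖fc (g a b) d‖))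
      (fun l => ENNReal.ofReal (jb l ^ m * ‖fc (v c) l‖)) k] at this
    simp_rw [mul_comm (ENNReal.ofReal (jb (_ - _) * _))]
    refine this.trans ?_
    rw [tsum_ofReal_jb_sq, hJ, ENNReal.coe_mul, ENNReal.coe_mul]
    refine mul_le_mul' ((tsum_jb_fc_sq_le m _).trans ?_) (hv c)
    rw [hKt]
    exact mul_le_mul_right (hgG a b) _
  set V : ι → (Fin 3 → ℤ) → ℂ := fun a k => (jb k ^ m : ℝ) * fc (v a) k with hV
  have hVn : ∀ a k, ‖V a k‖ = jb k ^ m * ‖fc (v a) k‖ := fun a k => by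
    have := jb_pos k
    rw [hV, norm_mul, Complex.norm_real, Real.norm_of_nonneg (by positivity)]
  -- decomposition into the symmetric part and the commutator
  have split : ∑ a, ∑ b, ∑ k ∈ F, wt k ^ m * (conj (fc (v a) k) * fc (g a b * D j (v b)) k).re =
      ∑ a, ∑ b, ∑ k ∈ F, ∑ l ∈ F,
        (conj (V a k) * (fc (g a b) (k - l) * (mult j l * V b l))).re +
      ∑ a, ∑ b, ∑ k ∈ F, ∑ l ∈ F, (jb k ^ m - jb l ^ m) *
        (conj (V a k) * (fc (g a b) (k - l) * (mult j l * fc (v b) l))).re := by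
    simp_rw [← Finset.sum_add_distrib]
    refine Finset.sum_congr rfl fun a _ => Finset.sum_congr rfl fun b _ => Finset.sum_congr rfl
      fun k _ => ?_
    rw [fc_mul_D_eq hm (hvm b) (hF b), Finset.mul_sum, Complex.re_sum, Finset.mul_sum]
    refine Finset.sum_congr rfl fun l _ => ?_
    have hw : wt k ^ m = jb k ^ m * jb k ^ m := by
      rw [wt_rpow, two_mul, Real.rpow_add (jb_pos k)]
    have e1 : conj (V a k) * (fc (g a b) (k - l) * (mult j l * V b l)) =
        ((jb k ^ m * jb l ^ m : ℝ) : ℂ) *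
          (conj (fc (v a) k) * (fc (g a b) (k - l) * (mult j l * fc (v b) l))) := by
      simp only [hV, map_mul, Complex.conj_ofReal]; push_cast; ring
    have e2 : conj (V a k) * (fc (g a b) (k - l) * (mult j l * fc (v b) l)) =
        ((jb k ^ m : ℝ) : ℂ) *
          (conj (fc (v a) k) * (fc (g a b) (k - l) * (mult j l * fc (v b) l))) := by
      simp only [hV, map_mul, Complex.conj_ofReal]; ring
    rw [e1, e2, Complex.re_ofReal_mul, Complex.re_ofReal_mul, hw]; ring
  have hsym := sum_symmetrize F j V (fun a b => fc (g a b)) (fun a b d => by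
    rw [hg b a, fc_conj])
  have main : |∑ a, ∑ b, ∑ k ∈ F, ∑ l ∈ F,
      (conj (V a k) * (fc (g a b) (k - l) * ((mult j l - mult j k) * V b l))).re| ≤
      ∑ _a : ι, ∑ _b : ι, 2 * Real.pi * S₂ := by
    refine (Finset.abs_sum_le_sum_abs _ _).trans (Finset.sum_le_sum fun a _ => ?_)
    refine (Finset.abs_sum_le_sum_abs _ _).trans (Finset.sum_le_sum fun b _ => ?_)
    refine le_trans ?_ (mul_le_mul_of_nonneg_left (B₂ a b b) (by positivity))
    rw [Finset.mul_sum]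
    refine (Finset.abs_sum_le_sum_abs _ _).trans (Finset.sum_le_sum fun k _ => ?_)
    rw [Finset.mul_sum]
    refine (Finset.abs_sum_le_sum_abs _ _).trans (Finset.sum_le_sum fun l _ => ?_)
    refine (Complex.abs_re_le_norm _).trans ?_
    rw [norm_mul, norm_mul, norm_mul, RCLike.norm_conj, hVn, hVn]
    have h1 := norm_mult_sub_le j k l
    have := jb_pos k
    have := jb_pos l
    calc _ ≤ jb k ^ m * ‖fc (v a) k‖ * (‖fc (g a b) (k - l)‖ *
          ((2 * Real.pi * jb (k - l)) * (jb l ^ m * ‖fc (v b) l‖))) := by gcongr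
      _ = _ := by ring
  have comm : |∑ a, ∑ b, ∑ k ∈ F, ∑ l ∈ F, (jb k ^ m - jb l ^ m) *
        (conj (V a k) * (fc (g a b) (k - l) * (mult j l * fc (v b) l))).re| ≤
      ∑ _a : ι, ∑ _b : ι, 2 * Real.pi * c₀ * (S₁ + S₂) := by
    refine (Finset.abs_sum_le_sum_abs _ _).trans (Finset.sum_le_sum fun a _ => ?_)
    refine (Finset.abs_sum_le_sum_abs _ _).trans (Finset.sum_le_sum fun b _ => ?_)
    refine le_trans ?_ (mul_le_mul_of_nonneg_left (add_le_add (B₁ a b b) (B₂ a b b))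
      (by positivity))
    rw [← Finset.sum_add_distrib, Finset.mul_sum]
    refine (Finset.abs_sum_le_sum_abs _ _).trans (Finset.sum_le_sum fun k _ => ?_)
    rw [← Finset.sum_add_distrib, Finset.mul_sum]
    refine (Finset.abs_sum_le_sum_abs _ _).trans (Finset.sum_le_sum fun l _ => ?_)
    rw [abs_mul]
    refine (mul_le_mul_of_nonneg_left (Complex.abs_re_le_norm _) (abs_nonneg _)).trans ?_
    rw [norm_mul, norm_mul, norm_mul, RCLike.norm_conj, hVn]
    have h1 := norm_mult_le j l
    have h2 := jb_commutator (by linarith : 1 ≤ m) k l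
    have := jb_pos k
    have := jb_pos l
    calc _ ≤ |jb k ^ m - jb l ^ m| * (jb k ^ m * ‖fc (v a) k‖ * (‖fc (g a b) (k - l)‖ *
          ((2 * Real.pi * jb l) * ‖fc (v b) l‖))) := by gcongr
      _ = (|jb k ^ m - jb l ^ m| * jb l) * (2 * Real.pi * (jb k ^ m * ‖fc (v a) k‖ *
          (‖fc (g a b) (k - l)‖ * ‖fc (v b) l‖))) := by ring
      _ ≤ (c₀ * (jb (k - l) ^ m * jb l + jb (k - l) * jb l ^ m)) *
          (2 * Real.pi * (jb k ^ m * ‖fc (v a) k‖ *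
          (‖fc (g a b) (k - l)‖ * ‖fc (v b) l‖))) := by gcongr
      _ = _ := by ring
  rw [split, hC]
  have h2 := abs_le.1 main
  have h3 := abs_le.1 comm
  rw [← hsym] at h2
  have h4 : 0 ≤ ∑ _a : ι, ∑ _b : ι, 2 * Real.pi * S₂ := by positivity
  rw [abs_le]
  constructor <;> linarith [h2.1, h2.2, h3.1, h3.2]

end Energy

/-! ### Fourier truncation -/

/-- By translation invariance the integral `I` satisfies `eₙ(y) I = I` for all `y`; differentiating
at `y = 0` in a direction with `nⱼ ≠ 0` forces `I = 0`. -/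
lemma integral_mFourier (n : Fin 3 → ℤ) :
    ∫ x, UnitAddTorus.mFourier n x ∂haarT = if n = 0 then 1 else 0 := by
  split_ifs with h
  · subst h; simp [UnitAddTorus.mFourier_zero]
  obtain ⟨j, hj⟩ := Function.ne_iff.1 h
  set I := ∫ x, UnitAddTorus.mFourier n x ∂haarT with hI
  have h1 : ∀ y : Torus, UnitAddTorus.mFourier n y * I = I := fun y => by
    have := integral_add_right_eq_self (μ := haarT) (fun x => UnitAddTorus.mFourier n x) y
    rw [hI, ← integral_const_mul]
    refine Eq.trans ?_ this
    congr 1; ext x; rw [mFourier_apply_add, mul_comm]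
  have h2 := (hasDerivAt_mFourier n j 0 0).mul_const I
  simp_rw [h1] at h2
  have h3 := h2.unique (hasDerivAt_const _ _)
  have h4 : UnitAddTorus.mFourier n (0 : Torus) = 1 := by simp [UnitAddTorus.mFourier]
  rw [QuotientAddGroup.mk_zero, Pi.single_zero, add_zero, h4, mul_one] at h3
  refine (mul_eq_zero.1 h3).resolve_left ?_
  have : (n j : ℂ) ≠ 0 := by exact_mod_cast hj
  have := Real.pi_ne_zero
  simp_all

lemma fc_wave (c : ℂ) (k l : Fin 3 → ℤ) :
    fc (wave c k) l = ((if l = k then c else 0) + if l = -k then conj c else 0) / 2 := by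
  have h : ∀ x, UnitAddTorus.mFourier (-l) x * ((wave c k x : ℝ) : ℂ) =
      (c / 2) * UnitAddTorus.mFourier (k - l) x +
        (conj c / 2) * UnitAddTorus.mFourier (-k - l) x := fun x => by
    have : ((wave c k x : ℝ) : ℂ) = (c * UnitAddTorus.mFourier k x +
        conj (c * UnitAddTorus.mFourier k x)) / 2 := by
      exact Complex.re_eq_add_conj _
    rw [this, map_mul, ← UnitAddTorus.mFourier_neg, sub_eq_add_neg, sub_eq_add_neg,
      UnitAddTorus.mFourier_add, UnitAddTorus.mFourier_add]
    ring
  rw [fc_eq]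
  simp_rw [h]
  rw [integral_add (integrable_haarT (by fun_prop)) (integrable_haarT (by fun_prop)),
    integral_const_mul, integral_const_mul, integral_mFourier, integral_mFourier]
  have e1 : (k - l = 0) = (l = k) := by rw [sub_eq_zero]; exact propext eq_comm
  have e2 : (-k - l = 0) = (l = -k) := by rw [sub_eq_zero]; exact propext eq_comm
  simp only [e1, e2]
  split_ifs <;> ring

/-- `c ↦ Re (c e_k)` as a continuous linear map. -/
def waveL (k : Fin 3 → ℤ) : ℂ →L[ℝ] C(Torus, ℝ) :=
  reL ∘L ((ContinuousLinearMap.id ℂ ℂ).smulRight (UnitAddTorus.mFourier k)).restrictScalars ℝ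

lemma waveL_apply (k) (c : ℂ) : waveL k c = wave c k := rfl

/-- Truncation of the Fourier series to the frequencies in `F`. -/
def trunc (F : Finset (Fin 3 → ℤ)) : C(Torus, ℝ) →L[ℝ] C(Torus, ℝ) :=
  ∑ k ∈ F, waveL k ∘L fcL k

/-- The partial derivative of the truncation. -/
def truncD (F : Finset (Fin 3 → ℤ)) (j : Fin 3) : C(Torus, ℝ) →L[ℝ] C(Torus, ℝ) :=
  ∑ k ∈ F, waveL k ∘L (ContinuousLinearMap.mul ℝ ℂ (mult j k)) ∘L fcL k

lemma trunc_apply (F : Finset (Fin 3 → ℤ)) (f : C(Torus, ℝ)) :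
    trunc F f = ∑ k ∈ F, wave (fc f k) k := by
  simp [trunc, waveL_apply]

lemma truncD_apply (F : Finset (Fin 3 → ℤ)) (j : Fin 3) (f : C(Torus, ℝ)) :
    truncD F j f = ∑ k ∈ F, wave (mult j k * fc f k) k := by
  simp [truncD, waveL_apply]

lemma D_trunc (F : Finset (Fin 3 → ℤ)) (j : Fin 3) (f : C(Torus, ℝ)) :
    D j (trunc F f) = truncD F j f := by
  rw [trunc_apply, truncD_apply]
  exact (HasPDeriv.sum fun k _ => hasPDeriv_wave j (fc f k) k).D_eq

/-- A real wave carries half of its amplitude at `k` and the conjugate half at `-k`. Because `f` is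
real and `F` is symmetric, the halves contributed by `k` and `-k` add up to the full coefficient. -/
lemma fc_trunc {F : Finset (Fin 3 → ℤ)} (hF : ∀ k ∈ F, -k ∈ F) (f : C(Torus, ℝ)) (l) :
    fc (trunc F f) l = if l ∈ F then fc f l else 0 := by
  rw [trunc_apply, fc_sum]
  simp_rw [fc_wave]
  rw [← Finset.sum_div, Finset.sum_add_distrib, Finset.sum_ite_eq]
  have h : ∑ k ∈ F, (if l = -k then conj (fc f k) else 0) = if l ∈ F then fc f l else 0 := by
    have e : ∀ k, (if l = -k then conj (fc f k) else 0) = if -l = k then fc f l else 0 :=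
      fun k => by
        by_cases h : l = -k
        · rw [if_pos h, if_pos (by rw [h, neg_neg]), h, fc_conj]
        · rw [if_neg h, if_neg (fun h' => h (by rw [← h', neg_neg]))]
    simp_rw [e]
    rw [Finset.sum_ite_eq]
    have : -l ∈ F ↔ l ∈ F := ⟨fun h => by simpa using hF _ h, hF l⟩
    simp only [this]
  rw [h]
  split_ifs <;> simp

lemma trunc_trunc {F : Finset (Fin 3 → ℤ)} (hF : ∀ k ∈ F, -k ∈ F) (f : C(Torus, ℝ)) :
    trunc F (trunc F f) = trunc F f :=
  fc_injective fun k => by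
    rw [fc_trunc hF, fc_trunc hF]; split_ifs <;> rfl

lemma sobolevNormSq_trunc {F : Finset (Fin 3 → ℤ)} (hF : ∀ k ∈ F, -k ∈ F) (m : ℝ)
    (f : C(Torus, ℝ)) :
    sobolevNormSq m (trunc F f) = ENNReal.ofReal (∑ k ∈ F, wt k ^ m * ‖fc f k‖ ^ 2) := by
  rw [sobolevNormSq_eq, tsum_eq_sum (s := F) (fun k hk => by simp [fc_trunc hF, hk]),
    ENNReal.ofReal_sum_of_nonneg fun k _ => by have := wt_pos k; positivity]
  refine Finset.sum_congr rfl fun k hk => ?_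
  rw [fc_trunc hF, if_pos hk, ENNReal.ofReal_mul (by have := wt_pos k; positivity),
    ENNReal.ofReal_pow (norm_nonneg _), ofReal_norm]
  rfl

/-! ### Functions that are bounded and Lipschitz on a set -/

section LB
variable {X Y : Type*} [SeminormedAddCommGroup X] [SeminormedAddCommGroup Y]

/-- `f` is bounded and Lipschitz on `S`. -/
def LB (S : Set X) (f : X → Y) : Prop :=
  (∃ K : ℝ, 0 ≤ K ∧ ∀ x ∈ S, ∀ y ∈ S, ‖f x - f y‖ ≤ K * ‖x - y‖) ∧
    ∃ B : ℝ, 0 ≤ B ∧ ∀ x ∈ S, ‖f x‖ ≤ B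

variable {S : Set X}

lemma LB.add {f g : X → Y} (hf : LB S f) (hg : LB S g) : LB S (fun x => f x + g x) := by
  obtain ⟨⟨K, hK, hK'⟩, B, hB, hB'⟩ := hf
  obtain ⟨⟨L, hL, hL'⟩, C, hC, hC'⟩ := hg
  refine ⟨⟨K + L, by positivity, fun x hx y hy => ?_⟩, B + C, by positivity, fun x hx =>
    (norm_add_le _ _).trans (add_le_add (hB' x hx) (hC' x hx))⟩
  rw [add_sub_add_comm, add_mul]
  exact (norm_add_le _ _).trans (add_le_add (hK' x hx y hy) (hL' x hx y hy))

lemma LB.const (c : Y) : LB S (fun _ => c) :=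
  ⟨⟨0, le_rfl, fun x _ y _ => by simp⟩, ‖c‖, norm_nonneg _, fun x _ => le_rfl⟩

lemma LB.sum {ι : Type*} {s : Finset ι} {f : ι → X → Y} (h : ∀ i ∈ s, LB S (f i)) :
    LB S (fun x => ∑ i ∈ s, f i x) := by
  classical
  induction s using Finset.induction_on with
  | empty => simpa using LB.const 0
  | insert a s ha ih =>
    simp_rw [Finset.sum_insert ha]
    exact (h a (Finset.mem_insert_self _ _)).add
      (ih fun i hi => h i (Finset.mem_insert_of_mem hi))

lemma LB.bilin {Z V : Type*} [SeminormedAddCommGroup Z] [SeminormedAddCommGroup V]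
    {f : X → Y} {g : X → Z} (B : Y → Z → V)
    (hB : ∀ y z, ‖B y z‖ ≤ ‖y‖ * ‖z‖) (hl : ∀ y y' z, B (y - y') z = B y z - B y' z)
    (hr : ∀ y z z', B y (z - z') = B y z - B y z')
    (hf : LB S f) (hg : LB S g) : LB S (fun x => B (f x) (g x)) := by
  obtain ⟨⟨K, hK, hK'⟩, b, hb, hb'⟩ := hf
  obtain ⟨⟨L, hL, hL'⟩, c, hc, hc'⟩ := hg
  refine ⟨⟨K * c + b * L, by positivity, fun x hx y hy => ?_⟩, b * c, by positivity, fun x hx =>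
    (hB _ _).trans (mul_le_mul (hb' x hx) (hc' x hx) (norm_nonneg _) hb)⟩
  have e : B (f x) (g x) - B (f y) (g y) = B (f x - f y) (g x) + B (f y) (g x - g y) := by
    rw [hl, hr]; abel
  rw [e]
  refine (norm_add_le _ _).trans ?_
  have h1 := mul_le_mul (hK' x hx y hy) (hc' x hx) (norm_nonneg _) (by positivity)
  have h2 := mul_le_mul (hb' y hy) (hL' x hx y hy) (norm_nonneg _) hb
  have h3 := hB (f x - f y) (g x)
  have h4 := hB (f y) (g x - g y)
  linarith

lemma LB.mul {R : Type*} [NormedRing R] {f g : X → R} (hf : LB S f) (hg : LB S g) :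
    LB S (fun x => f x * g x) :=
  LB.bilin (fun a b => a * b) norm_mul_le sub_mul mul_sub hf hg

lemma LB.smul {V : Type*} [NormedAddCommGroup V] [NormedSpace ℝ V] {f : X → ℝ} {g : X → V}
    (hf : LB S f) (hg : LB S g) : LB S (fun x => f x • g x) :=
  LB.bilin (fun a b => a • b) norm_smul_le sub_smul smul_sub hf hg

lemma LB.comp_lip {Z : Type*} [SeminormedAddCommGroup Z] {f : X → Y} (g : Y → Z) {K : ℝ}
    (hK : 0 ≤ K) (hg : ∀ x y, ‖g x - g y‖ ≤ K * ‖x - y‖) (hf : LB S f) :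
    LB S (fun x => g (f x)) := by
  obtain ⟨⟨L, hL, hL'⟩, b, hb, hb'⟩ := hf
  refine ⟨⟨K * L, by positivity, fun x hx y hy => ?_⟩, ‖g 0‖ + K * b, by positivity,
    fun x hx => ?_⟩
  · rw [mul_assoc]
    exact (hg _ _).trans (mul_le_mul_of_nonneg_left (hL' x hx y hy) hK)
  · have h1 := hg (f x) 0
    rw [sub_zero] at h1
    have h2 := mul_le_mul_of_nonneg_left (hb' x hx) hK
    have h3 := norm_sub_norm_le (g (f x)) (g 0)
    linarith

lemma LB.pi {ι : Type*} [Fintype ι] {f : X → ι → Y} (h : ∀ i, LB S (fun x => f x i)) :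
    LB S f := by
  choose K hK using fun i => (h i).1
  choose B hB using fun i => (h i).2
  refine ⟨⟨∑ i, K i, Finset.sum_nonneg fun i _ => (hK i).1, fun x hx y hy => ?_⟩,
    ∑ i, B i, Finset.sum_nonneg fun i _ => (hB i).1, fun x hx => ?_⟩
  · rw [pi_norm_le_iff_of_nonneg (mul_nonneg (Finset.sum_nonneg fun i _ => (hK i).1)
      (norm_nonneg _))]
    intro i
    refine ((hK i).2 x hx y hy).trans ?_
    gcongr
    exact Finset.single_le_sum (fun i _ => (hK i).1) (Finset.mem_univ i)
  · rw [pi_norm_le_iff_of_nonneg (Finset.sum_nonneg fun i _ => (hB i).1)]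
    intro i
    exact ((hB i).2 x hx).trans (Finset.single_le_sum (fun i _ => (hB i).1) (Finset.mem_univ i))

end LB

lemma LB.clm {X Y : Type*} [NormedAddCommGroup X] [NormedSpace ℝ X] [NormedAddCommGroup Y]
    [NormedSpace ℝ Y] {S : Set X} (L : X →L[ℝ] Y) {R : ℝ} (hR : 0 ≤ R) (hS : ∀ x ∈ S, ‖x‖ ≤ R) :
    LB S (fun x => L x) :=
  ⟨⟨‖L‖, norm_nonneg _, fun x _ y _ => by rw [← map_sub]; exact L.le_opNorm _⟩, ‖L‖ * R,
    by positivity, fun x hx => (L.le_opNorm x).trans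
      (mul_le_mul_of_nonneg_left (hS x hx) (norm_nonneg _))⟩

lemma LB.comp_clm {X Y Z : Type*} [SeminormedAddCommGroup X] [NormedAddCommGroup Y]
    [NormedSpace ℝ Y] [NormedAddCommGroup Z] [NormedSpace ℝ Z] {S : Set X} {f : X → Y}
    (L : Y →L[ℝ] Z) (hf : LB S f) : LB S (fun x => L (f x)) :=
  hf.comp_lip L (norm_nonneg L) fun x y => by rw [← map_sub]; exact L.le_opNorm _

/-! ### Galerkin approximations with an energy cutoff. -/

section Galerkin
variable {ι : Type*} [Fintype ι]

lemma norm_ev_le (u : ι → C(Torus, ℝ)) (x : Torus) : ‖ev u x‖ ≤ ‖u‖ :=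
  (pi_norm_le_iff_of_nonneg (norm_nonneg _)).2 fun a =>
    ((u a).norm_coe_le_norm x).trans (norm_le_pi_norm u a)

lemma LB.nem {X : Type*} [SeminormedAddCommGroup X] {S : Set X} {f : X → ι → C(Torus, ℝ)}
    {A : (ι → ℝ) → ℝ} (hA : ContDiff ℝ ∞ A) (hf : LB S f) :
    LB S (fun x => SelfAlign.nem A (f x)) := by
  obtain ⟨⟨L, hL, hL'⟩, b, hb, hb'⟩ := hf
  have hm : ∀ x ∈ S, f x ∈ Adm (Metric.closedBall 0 b) := fun x hx y => by
    rw [mem_closedBall_zero_iff]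
    exact (norm_ev_le _ _).trans (hb' x hx)
  obtain ⟨K, hK⟩ := hA.contDiffOn.exists_lipschitzOnWith (by simp)
    (convex_closedBall (0 : ι → ℝ) b) (isCompact_closedBall _ _)
  obtain ⟨C, hC⟩ := exists_norm_nem_le (isCompact_closedBall (0 : ι → ℝ) b)
    hA.continuous.continuousOn
  refine ⟨⟨K * L, by positivity, fun x hx y hy => ?_⟩, C, C.2, fun x hx => hC _ (hm x hx)⟩
  rw [ContinuousMap.norm_le _ (by positivity)]
  intro z
  rw [ContinuousMap.sub_apply, nem_apply hA.continuous.continuousOn (hm x hx),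
    nem_apply hA.continuous.continuousOn (hm y hy)]
  have h1 := hK.norm_sub_le (hm x hx z) (hm y hy z)
  refine h1.trans ?_
  rw [mul_assoc]
  refine mul_le_mul_of_nonneg_left ?_ K.2
  exact (norm_ev_le (f x - f y) z).trans (hL' x hx y hy)

/-- The first order operator `∑ⱼ ∑_b A_j^{ab}(v) ∂ⱼ v_b`. -/
def Bop (A : Fin 3 → ι → ι → (ι → ℝ) → ℝ) (v : ι → C(Torus, ℝ)) (a : ι) : C(Torus, ℝ) :=
  ∑ j, ∑ b, nem (A j a b) v * D j (v b)

variable {A : Fin 3 → ι → ι → (ι → ℝ) → ℝ}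

lemma exists_norm_le_pi {m : ℝ} (hm : 5 / 2 < m) (M : ℝ≥0) :
    ∃ R : ℝ≥0, ∀ v : ι → C(Torus, ℝ), (∀ a, sobolevNormSq m (v a) ≤ M) →
      v ∈ Adm (Metric.closedBall 0 (R : ℝ)) := by
  obtain ⟨R, hR⟩ := exists_norm_le (by linarith : 3 / 2 < m) M
  refine ⟨R, fun v hv x => mem_closedBall_zero_iff.2 ?_⟩
  exact (norm_ev_le v x).trans ((pi_norm_le_iff_of_nonneg R.2).2 fun a => hR _ (hv a))

lemma exists_norm_Bop_le {m : ℝ} (hm : 5 / 2 < m) (hA : ∀ j a b, ContDiff ℝ ∞ (A j a b))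
    (M : ℝ≥0) : ∃ L : ℝ≥0, ∀ v : ι → C(Torus, ℝ), (∀ a, sobolevNormSq m (v a) ≤ M) →
      ∀ a, ‖Bop A v a‖ ≤ L := by
  obtain ⟨R, hR⟩ := exists_norm_le_pi (ι := ι) hm M
  obtain ⟨M', hM'⟩ := exists_sobolev_D_le hm M
  obtain ⟨R', hR'⟩ := exists_norm_le (by linarith : 3 / 2 < m - 1) M'
  choose C hC using fun j a b => exists_norm_nem_le (isCompact_closedBall (0 : ι → ℝ) R)
    (hA j a b).continuous.continuousOn
  refine ⟨∑ a, ∑ j, ∑ b, C j a b * R', fun v hv a => ?_⟩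
  have h1 : ‖Bop A v a‖ ≤ ∑ j, ∑ b, (C j a b : ℝ) * R' := by
    refine (norm_sum_le _ _).trans (Finset.sum_le_sum fun j _ => ?_)
    refine (norm_sum_le _ _).trans (Finset.sum_le_sum fun b _ => ?_)
    refine (norm_mul_le _ _).trans ?_
    exact mul_le_mul (hC j a b v (hR v hv)) (hR' _ (hM' _ (hv b) j)) (norm_nonneg _) (C j a b).2
  push_cast
  refine h1.trans (Finset.single_le_sum (f := fun a => ∑ j, ∑ b, (C j a b : ℝ) * R')
    (fun a _ => ?_) (Finset.mem_univ a))
  positivity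

/-- The energy of the frequencies in `F`. -/
def energy (m : ℝ) (F : Finset (Fin 3 → ℤ)) (u : ι → C(Torus, ℝ)) : ℝ :=
  ∑ a, ∑ k ∈ F, wt k ^ m * ‖fc (u a) k‖ ^ 2

lemma sobolevNormSq_trunc_le_energy {F : Finset (Fin 3 → ℤ)} (hF : ∀ k ∈ F, -k ∈ F) (m : ℝ)
    (u : ι → C(Torus, ℝ)) (a : ι) :
    sobolevNormSq m (trunc F (u a)) ≤ ENNReal.ofReal (energy m F u) := by
  rw [sobolevNormSq_trunc hF]
  refine ENNReal.ofReal_le_ofReal ?_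
  exact Finset.single_le_sum (f := fun a => ∑ k ∈ F, wt k ^ m * ‖fc (u a) k‖ ^ 2)
    (fun a _ => Finset.sum_nonneg fun k _ => by have := wt_pos k; positivity) (Finset.mem_univ a)

lemma energy_le {m : ℝ} {F : Finset (Fin 3 → ℤ)} {u : ι → C(Torus, ℝ)} {N : ι → ℝ≥0}
    (h : ∀ a, sobolevNormSq m (u a) ≤ N a) : energy m F u ≤ ∑ a, (N a : ℝ) := by
  refine Finset.sum_le_sum fun a _ => ?_
  have h1 : ENNReal.ofReal (∑ k ∈ F, wt k ^ m * ‖fc (u a) k‖ ^ 2) ≤ N a := by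
    refine le_trans ?_ (h a)
    rw [ENNReal.ofReal_sum_of_nonneg fun k _ => by have := wt_pos k; positivity]
    exact ENNReal.sum_le_tsum F
  rw [ENNReal.ofReal_le_iff_le_toReal ENNReal.coe_ne_top] at h1
  exact h1

/-- The cutoff function equal to `1` below `N + 1` and to `0` above `N + 2`. -/
def cut (N E : ℝ) : ℝ := max 0 (min 1 (N + 2 - E))

lemma cut_nonneg (N E : ℝ) : 0 ≤ cut N E := le_max_left _ _
lemma cut_le_one (N E : ℝ) : cut N E ≤ 1 := max_le zero_le_one (min_le_left _ _)
lemma cut_eq_one {N E : ℝ} (h : E ≤ N + 1) : cut N E = 1 := by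
  rw [cut, min_eq_left (by linarith), max_eq_right zero_le_one]
lemma cut_eq_zero {N E : ℝ} (h : N + 2 ≤ E) : cut N E = 0 := by
  rw [cut, max_eq_left ((min_le_right _ _).trans (by linarith))]
lemma cut_lip (N x y : ℝ) : ‖cut N x - cut N y‖ ≤ 1 * ‖x - y‖ := by
  rw [Real.norm_eq_abs, Real.norm_eq_abs, one_mul]
  refine (abs_max_sub_max_le_max _ _ _ _).trans ?_
  rw [sub_self, abs_zero, max_eq_right (abs_nonneg _)]
  refine (abs_min_sub_min_le_max _ _ _ _).trans ?_
  rw [sub_self, abs_zero, max_eq_right (abs_nonneg _), abs_sub_comm x y]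
  apply le_of_eq; congr 1; ring

/-- The truncated Galerkin vector field. -/
def galerkin (A : Fin 3 → ι → ι → (ι → ℝ) → ℝ) (m N : ℝ) (F : Finset (Fin 3 → ℤ))
    (u : ι → C(Torus, ℝ)) : ι → C(Torus, ℝ) := fun a =>
  -(cut N (energy m F u) • trunc F (Bop A (fun b => trunc F (u b)) a))

/-- Differentiating a truncated function is the bounded operator `truncD`, so the field loses no
derivative and is an ordinary differential equation on continuous functions. -/
lemma LB_galerkin (hA : ∀ j a b, ContDiff ℝ ∞ (A j a b)) (m N : ℝ) (F : Finset (Fin 3 → ℤ))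
    {S : Set (ι → C(Torus, ℝ))} {R : ℝ} (hR : 0 ≤ R) (hS : ∀ u ∈ S, ‖u‖ ≤ R) :
    LB S (galerkin A m N F) := by
  have hproj : ∀ a, LB S (fun u : ι → C(Torus, ℝ) => u a) := fun a =>
    LB.clm (ContinuousLinearMap.proj (R := ℝ) (φ := fun _ : ι => C(Torus, ℝ)) a) hR hS
  refine LB.pi fun a => ?_
  have h1 : LB S fun u => cut N (energy m F u) := by
    refine LB.comp_lip (cut N) zero_le_one (cut_lip N) ?_
    refine LB.sum fun a _ => LB.sum fun k _ => (LB.const _).mul ?_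
    simp_rw [sq]
    have : LB S fun u : ι → C(Torus, ℝ) => ‖fc (u a) k‖ :=
      ((hproj a).comp_clm (fcL k)).comp_lip (fun z => ‖z‖) zero_le_one fun x y => by
        rw [one_mul]; exact abs_norm_sub_norm_le x y
    exact this.mul this
  have h2 : LB S fun u => Bop A (fun b => trunc F (u b)) a := by
    refine LB.sum fun j _ => LB.sum fun b _ => ?_
    simp_rw [D_trunc]
    exact (LB.nem (hA j a b) (LB.pi fun b => (hproj b).comp_clm (trunc F))).mul
      ((hproj b).comp_clm (truncD F j))
  have h3 := (h1.smul (h2.comp_clm (trunc F)))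
  have h4 := h3.comp_clm (-ContinuousLinearMap.id ℝ C(Torus, ℝ))
  exact h4

/-- The cutoff vanishes once the energy reaches `N + 2`, and below that level the truncated function
is bounded in `H^m`. The global bound, which depends on `F`, gives solutions on any prescribed time
interval. -/
lemma exists_norm_galerkin_le {m : ℝ} (hm : 5 / 2 < m) (hA : ∀ j a b, ContDiff ℝ ∞ (A j a b))
    (N : ℝ) {F : Finset (Fin 3 → ℤ)} (hF : ∀ k ∈ F, -k ∈ F) :
    ∃ L : ℝ≥0, ∀ u, ‖galerkin A m N F u‖ ≤ L := by
  obtain ⟨L, hL⟩ := exists_norm_Bop_le hm hA (N + 2).toNNReal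
  refine ⟨‖trunc F‖₊ * L, fun u => (pi_norm_le_iff_of_nonneg (NNReal.coe_nonneg _)).2 fun a => ?_⟩
  rw [galerkin, norm_neg, norm_smul]
  by_cases h : N + 2 ≤ energy m F u
  · rw [cut_eq_zero h, norm_zero, zero_mul]; exact NNReal.coe_nonneg _
  · have h1 := hL (fun b => trunc F (u b)) (fun b =>
      (sobolevNormSq_trunc_le_energy hF m u b).trans
        (ENNReal.ofReal_le_ofReal (not_le.1 h).le)) a
    rw [Real.norm_of_nonneg (cut_nonneg _ _)]
    have h2 := (trunc F).le_opNorm (Bop A (fun b => trunc F (u b)) a)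
    have h3 := mul_le_mul_of_nonneg_left h1 (norm_nonneg (trunc F))
    have h4 := mul_le_mul (cut_le_one N (energy m F u)) (h2.trans h3) (norm_nonneg _) zero_le_one
    rw [one_mul] at h4
    exact h4

lemma exists_galerkin_flow {m : ℝ} (hm : 5 / 2 < m) (hA : ∀ j a b, ContDiff ℝ ∞ (A j a b))
    (N : ℝ) {F : Finset (Fin 3 → ℤ)} (hF : ∀ k ∈ F, -k ∈ F) (u₀ : ι → C(Torus, ℝ)) {T : ℝ}
    (hT : 0 ≤ T) : ∃ u : ℝ → ι → C(Torus, ℝ), u 0 = u₀ ∧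
      ∀ t ∈ Icc 0 T, HasDerivWithinAt u (galerkin A m N F (u t)) (Icc 0 T) t := by
  obtain ⟨L, hL⟩ := exists_norm_galerkin_le hm hA N hF
  obtain ⟨⟨K, hK, hK'⟩, -⟩ := LB_galerkin hA m N F
    (S := Metric.closedBall u₀ (L * T.toNNReal : ℝ≥0)) (R := ‖u₀‖ + (L * T.toNNReal : ℝ≥0))
    (by positivity) (fun u hu => by
      rw [mem_closedBall_iff_norm] at hu
      have := norm_sub_norm_le u u₀
      linarith)
  -- With speed at most `L`, the trajectory stays in the ball of radius `L T` during `[0, T]`.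
  have hp := IsPicardLindelof.of_time_independent (f := galerkin A m N F) (tmin := 0) (tmax := T)
    (t₀ := ⟨0, le_rfl, hT⟩) (x₀ := u₀) (a := L * T.toNNReal) (r := 0) (L := L) (K := K.toNNReal)
    (fun x _ => hL x) (LipschitzOnWith.of_dist_le_mul fun x hx y hy => by
      rw [dist_eq_norm, dist_eq_norm, Real.coe_toNNReal K hK]; exact hK' x hx y hy)
    (by simp [hT])
  exact hp.exists_eq_forall_mem_Icc_hasDerivWithinAt₀

/-- The Galerkin approximations, bounded in `H^m` on a time interval independent of `F`. -/
lemma exists_galerkin_solution [DecidableEq ι] {m : ℝ} (hm : 5 / 2 < m)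
    (hA : ∀ j a b, ContDiff ℝ ∞ (A j a b)) (hsym : ∀ j a b, A j a b = A j b a)
    {u₀ : ι → C(Torus, ℝ)} (hu₀ : ∀ a, MemH m (u₀ a)) :
    ∃ T : ℝ, 0 < T ∧ ∃ M : ℝ≥0, ∀ F : Finset (Fin 3 → ℤ), (∀ k ∈ F, -k ∈ F) →
      ∃ v : ℝ → ι → C(Torus, ℝ), (∀ a, v 0 a = trunc F (u₀ a)) ∧
        (∀ t ∈ Icc 0 T, ∀ a, sobolevNormSq m (v t a) ≤ M) ∧
        ∀ t ∈ Icc 0 T, HasDerivWithinAt v (fun a => -trunc F (Bop A (v t) a)) (Icc 0 T) t := by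
  -- `N` bounds the initial energy for every `F`; the cutoff is inactive up to `N + 1`, and above `N
  -- + 2` the field is zero.
  set N : ℝ := ∑ a, ((sobolevNormSq m (u₀ a)).toNNReal : ℝ) with hN
  have hN0 : 0 ≤ N := Finset.sum_nonneg fun a _ => NNReal.coe_nonneg _
  set M : ℝ≥0 := (N + 2).toNNReal with hM
  obtain ⟨R, hR⟩ := exists_norm_le_pi (ι := ι) hm M
  choose G hG using fun j a b => exists_sobolev_nem_le hm isOpen_univ
    (isCompact_closedBall (0 : ι → ℝ) R) (subset_univ _) M (hA j a b).contDiffOn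
  set G' : ℝ≥0 := ∑ j, ∑ a, ∑ b, G j a b with hG'
  have hGG : ∀ j a b, G j a b ≤ G' := fun j a b =>
    ((Finset.single_le_sum (f := fun b => G j a b) (fun _ _ => zero_le) (Finset.mem_univ b)).trans
      (Finset.single_le_sum (f := fun a => ∑ b, G j a b) (fun _ _ => zero_le)
        (Finset.mem_univ a))).trans
      (Finset.single_le_sum (f := fun j => ∑ a, ∑ b, G j a b) (fun _ _ => zero_le)
        (Finset.mem_univ j))
  obtain ⟨C, hC⟩ := exists_energy_le (ι := ι) hm M G'
  -- The factor `2` comes from differentiating a square and the factor `3` from the three space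
  -- directions. With `T = 1 / (C₀ + 1)` the energy grows by at most one, so the cutoff never acts
  -- on the solution.
  set C₀ : ℝ := 2 * (3 * C) with hC₀
  have hC₀0 : 0 ≤ C₀ := by positivity
  refine ⟨1 / (C₀ + 1), by positivity, M, fun F hF => ?_⟩
  set T := 1 / (C₀ + 1) with hT
  have hT0 : 0 < T := by positivity
  -- The flow starts from the untruncated data. The field sees only frequencies in `F`, and `v`
  -- retains exactly these.
  obtain ⟨u, hu0, hu⟩ := exists_galerkin_flow hm hA N hF u₀ hT0.le
  set v : ℝ → ι → C(Torus, ℝ) := fun t a => trunc F (u t a) with hv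
  have hfc : ∀ t ∈ Icc 0 T, ∀ a, ∀ k ∈ F, HasDerivWithinAt (fun t => fc (u t a) k)
      (-(cut N (energy m F (u t)) • fc (Bop A (v t) a) k)) (Icc 0 T) t := by
    intro t ht a k hk
    have h1 := hasDerivWithinAt_pi.1 (hu t ht) a
    have h2 := (fcL k).hasFDerivAt.comp_hasDerivWithinAt t h1
    refine h2.congr_deriv ?_
    rw [galerkin, fcL_apply, fc_neg, fc_smul, fc_trunc hF, if_pos hk]
  have hE : ∀ t ∈ Icc 0 T, ∃ e', HasDerivWithinAt (fun t => energy m F (u t)) e' (Icc 0 T) t ∧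
      e' ≤ C₀ := by
    intro t ht
    set χ := cut N (energy m F (u t)) with hχ
    have h1 : HasDerivWithinAt (fun t => energy m F (u t))
        (∑ a, ∑ k ∈ F, wt k ^ m * (2 * inner ℝ (fc (u t a) k) (-(χ • fc (Bop A (v t) a) k))))
        (Icc 0 T) t :=
      HasDerivWithinAt.fun_sum fun a _ => HasDerivWithinAt.fun_sum fun k hk =>
        ((hfc t ht a k hk).norm_sq).const_mul _
    refine ⟨_, h1, ?_⟩
    have h2 : ∑ a, ∑ k ∈ F, wt k ^ m * (2 * inner ℝ (fc (u t a) k)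
        (-(χ • fc (Bop A (v t) a) k))) = -(2 * χ) * ∑ j, ∑ a, ∑ b, ∑ k ∈ F, wt k ^ m *
          (conj (fc (v t a) k) * fc (nem (A j a b) (v t) * D j (v t b)) k).re := by
      rw [Finset.sum_comm (s := (Finset.univ : Finset (Fin 3))), Finset.mul_sum]
      refine Finset.sum_congr rfl fun a _ => ?_
      simp_rw [Finset.sum_comm (s := (Finset.univ : Finset ι)) (t := F)]
      rw [Finset.sum_comm (s := (Finset.univ : Finset (Fin 3))), Finset.mul_sum]
      refine Finset.sum_congr rfl fun k hk => ?_
      have e : fc (v t a) k = fc (u t a) k := by rw [hv, fc_trunc hF, if_pos hk]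
      have e2 : fc (Bop A (v t) a) k = ∑ j, ∑ b, fc (nem (A j a b) (v t) * D j (v t b)) k := by
        rw [Bop, fc_sum]
        exact Finset.sum_congr rfl fun j _ => fc_sum _ _ _
      have e3 : (conj (fc (u t a) k) * fc (Bop A (v t) a) k).re =
          ∑ j, ∑ b, (conj (fc (u t a) k) * fc (nem (A j a b) (v t) * D j (v t b)) k).re := by
        rw [e2, Finset.mul_sum, Complex.re_sum]
        refine Finset.sum_congr rfl fun j _ => ?_
        rw [Finset.mul_sum, Complex.re_sum]
      simp_rw [← Finset.mul_sum]
      rw [e, ← e3, inner_neg_right, real_inner_smul_right, Complex.inner,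
        mul_comm (conj (fc (u t a) k))]
      ring
    rw [h2]
    -- Above the threshold the factor `χ` vanishes; below it `v` obeys the bound `M` required by the
    -- energy estimate.
    by_cases h : N + 2 ≤ energy m F (u t)
    · rw [hχ, cut_eq_zero h]; simpa using hC₀0
    · have hvM : ∀ a, sobolevNormSq m (v t a) ≤ M := fun a =>
        (sobolevNormSq_trunc_le_energy hF m (u t) a).trans
          (ENNReal.ofReal_le_ofReal (not_le.1 h).le)
      have h3 : |∑ j, ∑ a, ∑ b, ∑ k ∈ F, wt k ^ m *
          (conj (fc (v t a) k) * fc (nem (A j a b) (v t) * D j (v t b)) k).re| ≤ 3 * C := by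
        refine (Finset.abs_sum_le_sum_abs _ _).trans ?_
        refine (Finset.sum_le_sum fun j _ => hC F j (v t) (fun a b => nem (A j a b) (v t))
          (fun a b => by rw [hsym]) hvM (fun a b => ?_) (fun a k hk => ?_)).trans (by simp)
        · exact (hG j a b _ (hR _ hvM) hvM).trans (ENNReal.coe_le_coe.2 (hGG j a b))
        · rw [hv, fc_trunc hF, if_neg hk]
      have h4 := abs_le.1 h3
      have h5 := cut_nonneg N (energy m F (u t))
      have h6 := cut_le_one N (energy m F (u t))
      rw [← hχ] at h5 h6
      have h7 : χ * (3 * C : ℝ) ≤ 3 * C := mul_le_of_le_one_left (by positivity) h6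
      nlinarith [mul_le_mul_of_nonneg_left h4.1 h5]
  choose! e' he' heC using hE
  have hEb : ∀ t ∈ Icc 0 T, energy m F (u t) ≤ N + 1 := by
    intro t ht
    have h1 := image_le_of_deriv_right_le_deriv_boundary (f := fun t => energy m F (u t))
      (f' := e') (B := fun t => N + C₀ * t) (B' := fun _ => C₀) (a := 0) (b := T)
      (fun t ht => (he' t ht).continuousWithinAt)
      (fun t ht => (he' t ⟨ht.1, ht.2.le⟩).mono_of_mem_nhdsWithin
        (Filter.mem_of_superset (Icc_mem_nhdsGE ht.2) (Icc_subset_Icc_left ht.1)))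
      (by
        simp only [hu0, mul_zero, add_zero]
        exact energy_le fun a => (ENNReal.coe_toNNReal (hu₀ a).ne).ge) (by fun_prop)
      (fun t _ => by
        simpa using ((hasDerivAt_id t).const_mul C₀).const_add N |>.hasDerivWithinAt)
      (fun t ht => heC t ⟨ht.1, ht.2.le⟩) ht
    have h2 : C₀ * t ≤ 1 := by
      calc C₀ * t ≤ (C₀ + 1) * T := mul_le_mul (by linarith) ht.2 ht.1 (by positivity)
        _ = 1 := by rw [hT]; field_simp
    linarith
  refine ⟨v, fun a => by rw [hv]; simp only [hu0], fun t ht a => ?_, fun t ht => ?_⟩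
  · refine (sobolevNormSq_trunc_le_energy hF m (u t) a).trans ?_
    exact ENNReal.ofReal_le_ofReal ((hEb t ht).trans (by linarith))
  · refine hasDerivWithinAt_pi.2 fun a => ?_
    have h1 := hasDerivWithinAt_pi.1 (hu t ht) a
    refine ((trunc F).hasFDerivAt.comp_hasDerivWithinAt t h1).congr_deriv ?_
    rw [galerkin, cut_eq_one (hEb t ht), one_smul, map_neg, trunc_trunc hF]

end Galerkin

/-! ### Passage to the limit -/

lemma hasDerivWithinAt_of_eq_integral {E : Type*} [NormedAddCommGroup E] [NormedSpace ℝ E]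
    [CompleteSpace E] {T : ℝ} {u f : ℝ → E} (hf : ContinuousOn f (Icc 0 T))
    (hu : ∀ t ∈ Icc 0 T, u t = u 0 + ∫ s in (0 : ℝ)..t, f s) {t : ℝ} (ht : t ∈ Icc 0 T) :
    HasDerivWithinAt u (f t) (Icc 0 T) t := by
  have hT : 0 ≤ T := ht.1.trans ht.2
  -- Clamping the time extends `f` continuously to the line, which allows the two-sided fundamental
  -- theorem of calculus at the endpoints too.
  set c : ℝ → ℝ := fun s => max 0 (min T s) with hc
  have hcm : ∀ s, c s ∈ Icc 0 T := fun s => ⟨le_max_left _ _, max_le hT (min_le_left _ _)⟩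
  have hce : ∀ s ∈ Icc 0 T, c s = s := fun s hs => by
    rw [hc]; simp only [min_eq_right hs.2, max_eq_right hs.1]
  have hg : Continuous fun s => f (c s) := hf.comp_continuous (by fun_prop) hcm
  have h1 := (hg.integral_hasStrictDerivAt 0 t).hasDerivAt.const_add (u 0)
  have h2 : ∀ s ∈ Icc 0 T, u s = u 0 + ∫ r in (0 : ℝ)..s, f (c r) := fun s hs => by
    rw [hu s hs]
    congr 1
    refine intervalIntegral.integral_congr fun r hr => ?_
    rw [uIcc_of_le hs.1] at hr
    simp only [hce r ⟨hr.1, hr.2.trans hs.2⟩]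
  rw [hce t ht] at h1
  exact h1.hasDerivWithinAt.congr h2 (h2 t ht)

lemma continuous_nem {ι : Type*} {F : (ι → ℝ) → ℝ} (hF : Continuous F) : Continuous (nem F) := by
  have := continuousOn_nem (U := univ) hF.continuousOn
  rwa [show Adm (univ : Set (ι → ℝ)) = univ from eq_univ_of_forall fun u x => mem_univ _,
    continuousOn_univ] at this

section Limit
variable {ι : Type*} [Fintype ι] {A : Fin 3 → ι → ι → (ι → ℝ) → ℝ}

lemma tendsto_Bop {m : ℝ} (hm : 5 / 2 < m) (hA : ∀ j a b, Continuous (A j a b)) {M : ℝ≥0}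
    {α : Type*} {l : Filter α} [l.NeBot] {v : α → ι → C(Torus, ℝ)} {u : ι → C(Torus, ℝ)}
    (hv : ∀ᶠ i in l, ∀ a, sobolevNormSq m (v i a) ≤ M) (h : Filter.Tendsto v l (nhds u)) (a : ι) :
    Filter.Tendsto (fun i => Bop A (v i) a) l (nhds (Bop A u a)) := by
  refine tendsto_finsetSum _ fun j _ => tendsto_finsetSum _ fun b _ => ?_
  refine Filter.Tendsto.mul (((continuous_nem (hA j a b)).tendsto u).comp h) ?_
  exact tendsto_D_of_tendsto hm (hv.mono fun i hi => hi b) (tendsto_pi_nhds.1 h b) j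

lemma continuousOn_Bop {m : ℝ} (hm : 5 / 2 < m) (hA : ∀ j a b, Continuous (A j a b)) {M : ℝ≥0}
    {v : ℝ → ι → C(Torus, ℝ)} {S : Set ℝ} (hv : ∀ t ∈ S, ∀ a, sobolevNormSq m (v t a) ≤ M)
    (h : ContinuousOn v S) (a : ι) : ContinuousOn (fun t => Bop A (v t) a) S := fun t ht => by
  have : (nhdsWithin t S).NeBot := mem_closure_iff_nhdsWithin_neBot.1 (subset_closure ht)
  exact tendsto_Bop hm hA (eventually_mem_nhdsWithin.mono fun s hs => hv s hs) (h t ht) a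

/-- The cube of frequencies of size `n`. -/
def cube (n : ℕ) : Finset (Fin 3 → ℤ) := Fintype.piFinset fun _ => Finset.Icc (-n : ℤ) n

lemma mem_cube {n : ℕ} {k : Fin 3 → ℤ} : k ∈ cube n ↔ ∀ i, -(n : ℤ) ≤ k i ∧ k i ≤ n := by
  simp [cube, Fintype.mem_piFinset]

lemma neg_mem_cube (n : ℕ) : ∀ k ∈ cube n, -k ∈ cube n := fun k hk => by
  rw [mem_cube] at hk ⊢
  intro i
  have := hk i
  simp only [Pi.neg_apply]; omega

lemma eventually_mem_cube (k : Fin 3 → ℤ) : ∀ᶠ n in Filter.atTop, k ∈ cube n := by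
  filter_upwards [Filter.eventually_ge_atTop (∑ i, (k i).natAbs)] with n hn
  rw [mem_cube]
  intro i
  have := Finset.single_le_sum (f := fun i => (k i).natAbs) (fun _ _ => Nat.zero_le _)
    (Finset.mem_univ i)
  omega

/-- Diagonal extraction: equi-Lipschitz uniformly bounded functions of time have a subsequence
converging at all times. -/
lemma exists_subseq_cauchy {β : Type*} [Countable β] {T : ℝ} (hT : 0 < T) {R L : ℝ}
    {f : ℕ → β → ℝ → ℂ} (hR : ∀ n b, ∀ t ∈ Icc 0 T, ‖f n b t‖ ≤ R)
    (hL : ∀ n b, ∀ s ∈ Icc 0 T, ∀ t ∈ Icc 0 T, ‖f n b t - f n b s‖ ≤ L * |t - s|) :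
    ∃ φ : ℕ → ℕ, StrictMono φ ∧ ∀ b, ∀ t ∈ Icc 0 T, CauchySeq fun n => f (φ n) b t := by
  classical
  have hR0 : ∀ n (b : β), 0 ≤ R := fun n b =>
    (norm_nonneg _).trans (hR n b 0 ⟨le_rfl, hT.le⟩)
  -- Restricting to rational times leaves countably many bounded sequences, so a single subsequence
  -- works in the product of closed discs. Outside `[0, T]` the value is set to zero to stay in the
  -- disc.
  set x : ℕ → (β × ℚ) → ℂ := fun n p => if (p.2 : ℝ) ∈ Icc 0 T then f n p.1 p.2 else 0 with hx
  have hxm : ∀ n, x n ∈ Set.pi univ fun _ : β × ℚ => Metric.closedBall (0 : ℂ) R := fun n p _ => by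
    rw [mem_closedBall_zero_iff, hx]
    simp only
    split_ifs with h
    · exact hR n _ _ h
    · simpa using hR0 n p.1
  obtain ⟨y, -, φ, hφ, hy⟩ := (isCompact_univ_pi fun _ : β × ℚ =>
    isCompact_closedBall (0 : ℂ) R).tendsto_subseq hxm
  refine ⟨φ, hφ, fun b t ht => Metric.cauchySeq_iff.2 fun ε hε => ?_⟩
  have hL0 : 0 ≤ |L| := abs_nonneg L
  -- A rational time within `δ` of `t` changes each function by less than `ε/3`.
  set δ := ε / (3 * (|L| + 1)) with hδ
  have hδ0 : 0 < δ := by positivity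
  obtain ⟨q, hq1, hq2⟩ := exists_rat_btwn (show max 0 (t - δ) < min T (t + δ) from
    max_lt (lt_min hT (by linarith [ht.1])) (lt_min (by linarith [ht.2]) (by linarith)))
  have hq : (q : ℝ) ∈ Icc 0 T := ⟨(le_max_left _ _).trans hq1.le, hq2.le.trans (min_le_left _ _)⟩
  have hqt : |t - q| < δ := by
    have := (le_max_right _ _).trans_lt hq1
    have := hq2.trans_le (min_le_right _ _)
    rw [abs_lt]; constructor <;> linarith
  have hc := (tendsto_pi_nhds.1 hy (b, q)).cauchySeq
  obtain ⟨n₀, hn₀⟩ := Metric.cauchySeq_iff.1 hc (ε / 3) (by positivity)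
  refine ⟨n₀, fun n hn p hp => ?_⟩
  have h1 := hn₀ n hn p hp
  simp only [Function.comp, hx, if_pos hq] at h1
  have hLδ : L * |t - q| < ε / 3 := by
    calc L * |t - q| ≤ (|L| + 1) * |t - q| :=
          mul_le_mul_of_nonneg_right ((le_abs_self L).trans (by linarith)) (abs_nonneg _)
      _ < (|L| + 1) * δ := mul_lt_mul_of_pos_left hqt (by positivity)
      _ = ε / 3 := by rw [hδ]; field_simp
  have h2 := (hL (φ n) b q hq t ht).trans_lt hLδ
  have h3 := (hL (φ p) b q hq t ht).trans_lt hLδ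
  rw [← dist_eq_norm] at h2 h3
  have h4 := dist_triangle4 (f (φ n) b t) (f (φ n) b q) (f (φ p) b q) (f (φ p) b t)
  rw [dist_comm (f (φ p) b q)] at h4
  linarith

/-- Local existence for quasilinear symmetric hyperbolic systems in `H^m`, `m > 5/2`. -/
theorem exists_solution_symmetric [DecidableEq ι] {m : ℝ} (hm : 5 / 2 < m)
    (hA : ∀ j a b, ContDiff ℝ ∞ (A j a b)) (hsym : ∀ j a b, A j a b = A j b a)
    {u₀ : ι → C(Torus, ℝ)} (hu₀ : ∀ a, MemH m (u₀ a)) :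
    ∃ T : ℝ, 0 < T ∧ ∃ M : ℝ≥0, ∃ u : ℝ → ι → C(Torus, ℝ), u 0 = u₀ ∧
      (∀ t ∈ Icc 0 T, ∀ a, sobolevNormSq m (u t a) ≤ M) ∧
      (∀ t ∈ Icc 0 T, HasDerivWithinAt u (fun a => -Bop A (u t) a) (Icc 0 T) t) ∧
      ∀ a, ContinuousOn (fun t => Bop A (u t) a) (Icc 0 T) := by
  obtain ⟨T, hT, M, hG⟩ := exists_galerkin_solution hm hA hsym hu₀
  choose v hv0 hvM hvd using fun n => hG (cube n) (neg_mem_cube n)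
  obtain ⟨L, hL⟩ := exists_norm_Bop_le hm hA M
  obtain ⟨R, hR⟩ := exists_norm_le (by linarith : 3 / 2 < m) M
  have hAc : ∀ j a b, Continuous (A j a b) := fun j a b => (hA j a b).continuous
  have hm' : 3 / 2 < m := by linarith
  have hfd : ∀ n a k, ∀ t ∈ Icc 0 T, HasDerivWithinAt (fun t => fc (v n t a) k)
      (if k ∈ cube n then -fc (Bop A (v n t) a) k else 0) (Icc 0 T) t := by
    intro n a k t ht
    have h1 := hasDerivWithinAt_pi.1 (hvd n t ht) a
    refine ((fcL k).hasFDerivAt.comp_hasDerivWithinAt t h1).congr_deriv ?_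
    rw [fcL_apply, fc_neg, fc_trunc (neg_mem_cube n)]
    split_ifs <;> simp
  -- The equation bounds the time derivative of each coefficient uniformly in `n`; this is the
  -- equicontinuity for the diagonal extraction.
  have hlip : ∀ n a k, ∀ s ∈ Icc 0 T, ∀ t ∈ Icc 0 T,
      ‖fc (v n t a) k - fc (v n s a) k‖ ≤ L * |t - s| := by
    intro n a k s hs t ht
    refine (convex_Icc 0 T).norm_image_sub_le_of_norm_hasDerivWithin_le (hfd n a k)
      (fun r hr => ?_) hs ht
    split_ifs
    · rw [norm_neg]; exact (norm_fc_le _ _).trans (hL _ (hvM n r hr) a)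
    · simp
  obtain ⟨φ, hφ, hcau⟩ := exists_subseq_cauchy (β := ι × (Fin 3 → ℤ)) hT
    (f := fun n p t => fc (v n t p.1) p.2) (R := R) (L := L)
    (fun n p t ht => (norm_fc_le _ _).trans (hR _ (hvM n t ht p.1)))
    (fun n p s hs t ht => hlip n p.1 p.2 s hs t ht)
  -- At each time the convergence of all coefficients and the `H^m` bound give uniform convergence.
  have hex : ∀ t ∈ Icc 0 T, ∃ u : ι → C(Torus, ℝ),
      Filter.Tendsto (fun n => v (φ n) t) Filter.atTop (nhds u) := fun t ht => by
    choose u hu using fun a => exists_tendsto_of_fc_cauchy hm' (f := fun n => v (φ n) t a)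
      (fun n => hvM (φ n) t ht a) fun k => hcau (a, k) t ht
    exact ⟨u, tendsto_pi_nhds.2 hu⟩
  choose! u hu using hex
  have huM : ∀ t ∈ Icc 0 T, ∀ a, sobolevNormSq m (u t a) ≤ M := fun t ht a =>
    sobolevNormSq_le_of_tendsto (Filter.Eventually.of_forall fun n => hvM (φ n) t ht a)
      (tendsto_pi_nhds.1 (hu t ht) a)
  have hfc : ∀ t ∈ Icc 0 T, ∀ a k, Filter.Tendsto (fun n => fc (v (φ n) t a) k) Filter.atTop
      (nhds (fc (u t a) k)) := fun t ht a k =>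
    ((continuous_fc k).tendsto _).comp (tendsto_pi_nhds.1 (hu t ht) a)
  have hulip : ∀ a k, ∀ s ∈ Icc 0 T, ∀ t ∈ Icc 0 T,
      ‖fc (u t a) k - fc (u s a) k‖ ≤ L * |t - s| := fun a k s hs t ht =>
    le_of_tendsto ((hfc t ht a k).sub (hfc s hs a k)).norm
      (Filter.Eventually.of_forall fun n => hlip (φ n) a k s hs t ht)
  have hucont : ContinuousOn u (Icc 0 T) := by
    refine continuousOn_pi.2 fun a t ht => ?_
    refine tendsto_of_fc hm' (eventually_mem_nhdsWithin.mono fun s hs => huM s hs a) (huM t ht a)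
      fun k => ?_
    have h1 : Filter.Tendsto (fun s => (L : ℝ) * |s - t|) (nhdsWithin t (Icc 0 T)) (nhds 0) := by
      have : Continuous fun s : ℝ => (L : ℝ) * |s - t| := by fun_prop
      simpa using (this.tendsto t).mono_left nhdsWithin_le_nhds
    exact tendsto_iff_norm_sub_tendsto_zero.2 (squeeze_zero' (Filter.Eventually.of_forall
      fun s => norm_nonneg _) (eventually_mem_nhdsWithin.mono fun s hs =>
        hulip a k t ht s hs) h1)
  have hBu := fun a => continuousOn_Bop hm hAc huM hucont a
  have h00 : (0 : ℝ) ∈ Icc 0 T := ⟨le_rfl, hT.le⟩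
  have hu0 : u 0 = u₀ := by
    ext1 a
    refine fc_injective fun k => ?_
    refine tendsto_nhds_unique (hfc 0 h00 a k) (tendsto_const_nhds.congr' ?_)
    filter_upwards [hφ.tendsto_atTop.eventually (eventually_mem_cube k)] with n hn
    rw [hv0, fc_trunc (neg_mem_cube _), if_pos hn]
  -- The integrated equation passes to the limit coefficient by coefficient, with dominating
  -- constant `L`; for fixed `k` the truncation is invisible once `k` lies in the cube.
  have hint : ∀ t ∈ Icc 0 T, ∀ a, u t a = u 0 a + ∫ s in (0 : ℝ)..t, -Bop A (u s) a := by
    intro t ht a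
    have hsub : uIcc 0 t ⊆ Icc 0 T := by rw [uIcc_of_le ht.1]; exact Icc_subset_Icc_right ht.2
    have hsub' : uIoc 0 t ⊆ Icc 0 T := uIoc_subset_uIcc.trans hsub
    refine fc_injective fun k => ?_
    have hi : IntervalIntegrable (fun s => -Bop A (u s) a) volume 0 t :=
      ((hBu a).neg.mono hsub).intervalIntegrable
    have e1 : fc (∫ s in (0 : ℝ)..t, -Bop A (u s) a) k =
        ∫ s in (0 : ℝ)..t, -fc (Bop A (u s) a) k := by
      have := (fcL k).intervalIntegral_comp_comm hi
      simp only [fcL_apply, fc_neg] at this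
      exact this.symm
    rw [fc_add, e1]
    have hlim : Filter.Tendsto (fun n => ∫ s in (0 : ℝ)..t, -fc (Bop A (v (φ n) s) a) k)
        Filter.atTop (nhds (∫ s in (0 : ℝ)..t, -fc (Bop A (u s) a) k)) := by
      refine intervalIntegral.tendsto_integral_filter_of_dominated_convergence (fun _ => (L : ℝ))
        (Filter.Eventually.of_forall fun n => ?_) (Filter.Eventually.of_forall fun n =>
          ae_of_all _ fun s hs => ?_) (by simp) (ae_of_all _ fun s hs => ?_)
      · have h1 := (continuousOn_Bop hm hAc (hvM (φ n))
          (fun s hs => (hvd (φ n) s hs).continuousWithinAt) a)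
        exact (((continuous_fc k).comp_continuousOn (h1.mono hsub')).neg).aestronglyMeasurable
          measurableSet_uIoc
      · rw [norm_neg]; exact (norm_fc_le _ _).trans (hL _ (hvM _ s (hsub' hs)) a)
      · exact (((continuous_fc k).tendsto _).comp (tendsto_Bop hm hAc
          (Filter.Eventually.of_forall fun n => hvM (φ n) s (hsub' hs)) (hu s (hsub' hs)) a)).neg
    have hlim2 := (hfc 0 h00 a k).add hlim
    refine tendsto_nhds_unique (hfc t ht a k) (hlim2.congr' ?_)
    filter_upwards [hφ.tendsto_atTop.eventually (eventually_mem_cube k)] with n hn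
    have h2 : ContinuousOn (fun s => fc (v (φ n) s a) k) (Icc 0 t) := fun s hs =>
      (hfd (φ n) a k s ⟨hs.1, hs.2.trans ht.2⟩).continuousWithinAt.mono
        (Icc_subset_Icc_right ht.2)
    have h3 := intervalIntegral.integral_eq_sub_of_hasDerivAt_of_le ht.1 h2
      (f' := fun s => -fc (Bop A (v (φ n) s) a) k) (fun s hs => by
        have := hfd (φ n) a k s ⟨hs.1.le, hs.2.le.trans ht.2⟩
        rw [if_pos hn] at this
        exact this.hasDerivAt (Icc_mem_nhds hs.1 (hs.2.trans_le ht.2))) (by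
        have h1 := (continuousOn_Bop hm hAc (hvM (φ n))
          (fun s hs => (hvd (φ n) s hs).continuousWithinAt) a)
        exact (((continuous_fc k).comp_continuousOn (h1.mono hsub)).neg).intervalIntegrable)
    rw [h3]; ring
  refine ⟨T, hT, M, u, hu0, huM, fun t ht => hasDerivWithinAt_pi.2 fun a => ?_, hBu⟩
  exact hasDerivWithinAt_of_eq_integral (u := fun t => u t a) (hBu a).neg
    (fun s hs => hint s hs a) ht

end Limit

/-! ### The `L²` energy inequality and uniqueness -/

/-- Gronwall's inequality for the primitive `G` of `E`, which satisfies `G' ≤ K G` and `G 0 = 0`. -/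
lemma eq_zero_of_le_integral {T K : ℝ} {E : ℝ → ℝ} (hc : ContinuousOn E (Icc 0 T))
    (h0 : ∀ t ∈ Icc 0 T, 0 ≤ E t) (hE : ∀ t ∈ Icc 0 T, E t ≤ K * ∫ s in (0 : ℝ)..t, E s) :
    ∀ t ∈ Icc 0 T, E t = 0 := by
  set G : ℝ → ℝ := fun t => ∫ s in (0 : ℝ)..t, E s with hG
  have hGd : ∀ t ∈ Icc 0 T, HasDerivWithinAt G (E t) (Icc 0 T) t := fun t ht =>
    hasDerivWithinAt_of_eq_integral hc (fun s _ => by simp [hG]) ht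
  have hG0 : ∀ t ∈ Icc 0 T, 0 ≤ G t := fun t ht =>
    intervalIntegral.integral_nonneg ht.1 fun s hs => h0 s ⟨hs.1, hs.2.trans ht.2⟩
  have h1 := norm_le_gronwallBound_of_norm_deriv_right_le (f := G) (f' := E) (δ := 0) (K := K)
    (ε := 0) (a := 0) (b := T) (fun t ht => (hGd t ht).continuousWithinAt)
    (fun t ht => (hGd t ⟨ht.1, ht.2.le⟩).mono_of_mem_nhdsWithin
      (Filter.mem_of_superset (Icc_mem_nhdsGE ht.2) (Icc_subset_Icc_left ht.1)))
    (by simp [hG]) (fun t ht => by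
      have ht' : t ∈ Icc 0 T := ⟨ht.1, ht.2.le⟩
      rw [Real.norm_of_nonneg (h0 t ht'), Real.norm_of_nonneg (hG0 t ht'), add_zero]
      exact hE t ht')
  intro t ht
  have h2 := h1 t ht
  rw [gronwallBound_ε0_δ0] at h2
  have h3 : G t = 0 := norm_le_zero_iff.1 h2
  have h4 := hE t ht
  change E t ≤ K * G t at h4
  rw [h3, mul_zero] at h4
  exact le_antisymm h4 (h0 t ht)

/-- A Lipschitz function is absolutely continuous, so a differential inequality valid almost
everywhere may be integrated. -/
lemma eq_zero_of_lipschitz_of_deriv_le {T K L : ℝ} {E : ℝ → ℝ}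
    (hL : ∀ s ∈ Icc 0 T, ∀ t ∈ Icc 0 T, |E t - E s| ≤ L * |t - s|)
    (h0 : ∀ t ∈ Icc 0 T, 0 ≤ E t) (hE0 : E 0 = 0)
    (hE : ∀ᵐ t ∂volume.restrict (Ioo 0 T), ∃ e, HasDerivAt E e t ∧ e ≤ K * E t) :
    ∀ t ∈ Icc 0 T, E t = 0 := by
  have hlip : LipschitzOnWith L.toNNReal E (Icc 0 T) :=
    LipschitzOnWith.of_dist_le_mul fun t ht s hs => by
      rw [Real.dist_eq, Real.dist_eq]
      exact (hL s hs t ht).trans (mul_le_mul_of_nonneg_right (Real.le_coe_toNNReal L)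
        (abs_nonneg _))
  refine eq_zero_of_le_integral (K := K) hlip.continuousOn h0 fun t ht => ?_
  have hsub : uIcc 0 t ⊆ Icc 0 T := by rw [uIcc_of_le ht.1]; exact Icc_subset_Icc_right ht.2
  have hac : AbsolutelyContinuousOnInterval E 0 t :=
    (hlip.mono hsub).absolutelyContinuousOnInterval
  have h1 := hac.integral_deriv_eq_sub
  rw [hE0, sub_zero] at h1
  rw [← h1, ← intervalIntegral.integral_const_mul]
  refine intervalIntegral.integral_mono_ae_restrict ht.1 hac.intervalIntegrable_deriv
    ((hlip.continuousOn.mono hsub).intervalIntegrable.const_mul K) ?_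
  rw [restrict_Ioo_eq_restrict_Icc] at hE
  filter_upwards [ae_restrict_of_ae_restrict_of_subset (Icc_subset_Icc_right ht.2) hE] with s hs
  obtain ⟨e, he, hle⟩ := hs
  rw [he.deriv]; exact hle

section L2
variable {κ : Type*} [Fintype κ]

lemma sum_abs_mul_sum_abs_le (w : κ → ℝ) :
    (∑ a, |w a|) * ∑ b, |w b| ≤ Fintype.card κ * ∑ a, w a ^ 2 := by
  have := sq_sum_le_card_mul_sum_sq (s := (Finset.univ : Finset κ)) (f := fun a => |w a|)
  simpa [sq_abs, sq] using this

/-- Integration by parts for symmetric first order operators. -/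
lemma integral_symmetric_eq {W : κ → C(Torus, ℝ)} {B : Fin 3 → κ → κ → C(Torus, ℝ)}
    (hB : ∀ j a b, B j a b = B j b a) (hBd : ∀ j a b, HasPDeriv j (B j a b) (D j (B j a b)))
    (hWd : ∀ j a, HasPDeriv j (W a) (D j (W a))) :
    ∫ x, 2 * ∑ j, ∑ a, ∑ b, W a x * B j a b x * D j (W b) x ∂haarT =
      -∫ x, ∑ j, ∑ a, ∑ b, W a x * D j (B j a b) x * W b x ∂haarT := by
  -- The divergence of `W · Bⱼ W` integrates to zero. By symmetry of `Bⱼ` the two terms in which `W`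
  -- is differentiated agree, which leaves only the derivative of the coefficients.
  have h1 : ∀ j, HasPDeriv j (∑ a, ∑ b, W a * B j a b * W b)
      (∑ a, ∑ b, ((D j (W a) * B j a b + W a * D j (B j a b)) * W b +
        W a * B j a b * D j (W b))) := fun j =>
    HasPDeriv.sum fun a _ => HasPDeriv.sum fun b _ => ((hWd j a).mul (hBd j a b)).mul (hWd j b)
  have h2 : ∀ x, 2 * ∑ j, ∑ a, ∑ b, W a x * B j a b x * D j (W b) x +
      ∑ j, ∑ a, ∑ b, W a x * D j (B j a b) x * W b x =
      ∑ j, (∑ a, ∑ b, ((D j (W a) * B j a b + W a * D j (B j a b)) * W b +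
        W a * B j a b * D j (W b))) x := fun x => by
    rw [Finset.mul_sum, ← Finset.sum_add_distrib]
    refine Finset.sum_congr rfl fun j _ => ?_
    have e : ∑ a, ∑ b, D j (W a) x * B j a b x * W b x =
        ∑ a, ∑ b, W a x * B j a b x * D j (W b) x := by
      rw [Finset.sum_comm]
      refine Finset.sum_congr rfl fun a _ => Finset.sum_congr rfl fun b _ => ?_
      rw [hB j b a]; ring
    simp only [ContinuousMap.sum_apply, ContinuousMap.add_apply, ContinuousMap.mul_apply, add_mul,
      Finset.sum_add_distrib]
    rw [e]; ring
  have h3 : ∫ x, ∑ j, (∑ a, ∑ b, ((D j (W a) * B j a b + W a * D j (B j a b)) * W b +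
        W a * B j a b * D j (W b))) x ∂haarT = 0 := by
    rw [integral_finsetSum _ fun j _ => integrable_haarT (ContinuousMap.continuous _)]
    exact Finset.sum_eq_zero fun j _ => integral_of_hasPDeriv (h1 j)
  simp_rw [← h2] at h3
  rw [integral_add (integrable_haarT (by fun_prop)) (integrable_haarT (by fun_prop))] at h3
  linarith

/-- Uniqueness of the zero solution for linear symmetric hyperbolic systems. -/
theorem eq_zero_of_symmetric_hyperbolic {T L C : ℝ} (hC : 0 ≤ C) {W : ℝ → κ → C(Torus, ℝ)}
    (hL : ∀ a x, ∀ s ∈ Icc 0 T, ∀ t ∈ Icc 0 T, |W t a x - W s a x| ≤ L * |t - s|)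
    (h0 : ∀ a x, W 0 a x = 0)
    (hae : ∀ᵐ t ∂volume.restrict (Ioo 0 T), ∃ (V : κ → C(Torus, ℝ))
      (B : Fin 3 → κ → κ → C(Torus, ℝ)),
      (∀ a x, HasDerivAt (fun s => W s a x) (V a x) t) ∧ (∀ j a b, B j a b = B j b a) ∧
      (∀ j a b, HasPDeriv j (B j a b) (D j (B j a b))) ∧
      (∀ j a b x, |D j (B j a b) x| ≤ C) ∧ (∀ j a, HasPDeriv j (W t a) (D j (W t a))) ∧
      ∀ a x, |V a x + ∑ j, ∑ b, B j a b x * D j (W t b) x| ≤ C * ∑ b, |W t b x|) :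
    ∀ t ∈ Icc 0 T, ∀ a x, W t a x = 0 := by
  by_cases hT : 0 ≤ T
  swap
  · intro t ht; exact absurd (ht.1.trans ht.2) hT
  have h00 : (0 : ℝ) ∈ Icc 0 T := ⟨le_rfl, hT⟩
  have hWb : ∀ t ∈ Icc 0 T, ∀ a x, |W t a x| ≤ |L| * T := fun t ht a x => by
    have := hL a x 0 h00 t ht
    rw [h0, sub_zero, sub_zero, abs_of_nonneg ht.1] at this
    refine this.trans ?_
    have := le_abs_self L
    have := abs_nonneg L
    have := ht.1
    have := ht.2
    nlinarith
  set n : ℝ := (Fintype.card κ : ℝ) with hn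
  set E : ℝ → ℝ := fun t => ∫ x, ∑ a, W t a x ^ 2 ∂haarT with hE
  set L₁ : ℝ := n * (2 * (|L| * T) * |L|) with hL₁
  have hn0 : 0 ≤ n := Nat.cast_nonneg _
  have hL₁0 : 0 ≤ L₁ := by positivity
  have hFl : ∀ x, ∀ s ∈ Icc 0 T, ∀ t ∈ Icc 0 T,
      |∑ a, W t a x ^ 2 - ∑ a, W s a x ^ 2| ≤ L₁ * |t - s| := fun x s hs t ht => by
    rw [← Finset.sum_sub_distrib]
    refine (Finset.abs_sum_le_sum_abs _ _).trans ?_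
    have : ∀ a ∈ Finset.univ, |W t a x ^ 2 - W s a x ^ 2| ≤ 2 * (|L| * T) * (|L| * |t - s|) := by
      intro a _
      rw [sq_sub_sq, abs_mul]
      refine mul_le_mul ?_ ?_ (abs_nonneg _) (by positivity)
      · refine (abs_add_le _ _).trans ?_
        have := hWb t ht a x
        have := hWb s hs a x
        linarith
      · exact (hL a x s hs t ht).trans
          (mul_le_mul_of_nonneg_right (le_abs_self L) (abs_nonneg _))
    refine (Finset.sum_le_sum this).trans (le_of_eq ?_)
    rw [Finset.sum_const, nsmul_eq_mul, Finset.card_univ, hL₁, hn]; ring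
  have hFi : ∀ t, Integrable (fun x => ∑ a, W t a x ^ 2) haarT := fun t =>
    integrable_haarT (by fun_prop)
  have hEz : ∀ t ∈ Icc 0 T, E t = 0 := by
    -- `5 = 2 + 3`: twice the bound on the residual, and one bound on `∂ⱼ Bⱼ` for each of the three
    -- directions. The factor `n` is from `(∑ |wₐ|)² ≤ n ∑ wₐ²`.
    refine eq_zero_of_lipschitz_of_deriv_le (K := 5 * C * n) (L := L₁)
      (fun s hs t ht => ?_) (fun t _ => integral_nonneg fun x =>
        Finset.sum_nonneg fun a _ => sq_nonneg _) (by simp [hE, h0]) ?_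
    · rw [hE]
      simp only
      rw [← integral_sub (hFi t) (hFi s)]
      have := norm_integral_le_of_norm_le_const (μ := haarT)
        (f := fun x => ∑ a, W t a x ^ 2 - ∑ a, W s a x ^ 2) (C := L₁ * |t - s|)
        (ae_of_all _ fun x => hFl x s hs t ht)
      rwa [probReal_univ, mul_one] at this
    · filter_upwards [hae, ae_restrict_mem measurableSet_Ioo] with t h ht
      obtain ⟨V, B, hV, hB, hBd, hBC, hWd, hZ⟩ := h
      have hd := (hasDerivAt_integral_of_dominated_loc_of_lip (𝕜 := ℝ) (μ := haarT)
        (F := fun s x => ∑ a, W s a x ^ 2) (F' := fun x => ∑ a, 2 * (W t a x * V a x))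
        (bound := fun _ => L₁) (Ioo_mem_nhds ht.1 ht.2)
        (Filter.Eventually.of_forall fun s => (hFi s).aestronglyMeasurable) (hFi t)
        (integrable_haarT (by fun_prop)).aestronglyMeasurable
        (ae_of_all _ fun x => LipschitzOnWith.of_dist_le_mul fun r hr s hs => by
          rw [Real.dist_eq, Real.dist_eq, Real.coe_nnabs, abs_of_nonneg hL₁0]
          exact hFl x s ⟨hs.1.le, hs.2.le⟩ r ⟨hr.1.le, hr.2.le⟩) (integrable_const _)
        (ae_of_all _ fun x => HasDerivAt.fun_sum fun a _ => by
          refine ((hV a x).fun_pow 2).congr_deriv ?_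
          push_cast; ring)).2
      refine ⟨_, hd, ?_⟩
      have hbp := integral_symmetric_eq hB hBd hWd
      have hsplit : ∀ x, ∑ a, 2 * (W t a x * V a x) =
          2 * ∑ a, W t a x * (V a x + ∑ j, ∑ b, B j a b x * D j (W t b) x) -
          2 * ∑ j, ∑ a, ∑ b, W t a x * B j a b x * D j (W t b) x := fun x => by
        have e : ∑ a, W t a x * ∑ j, ∑ b, B j a b x * D j (W t b) x =
            ∑ j, ∑ a, ∑ b, W t a x * B j a b x * D j (W t b) x := by
          simp_rw [Finset.mul_sum, mul_assoc]
          rw [Finset.sum_comm]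
        simp_rw [mul_add, Finset.sum_add_distrib]
        rw [e, ← Finset.mul_sum]
        ring
      simp_rw [hsplit]
      rw [integral_sub (integrable_haarT (by fun_prop)) (integrable_haarT (by fun_prop)), hbp,
        sub_neg_eq_add, ← integral_add (integrable_haarT (by fun_prop))
          (integrable_haarT (by fun_prop)), hE]
      simp only
      rw [← integral_const_mul]
      refine integral_mono (integrable_haarT (by fun_prop)) ((hFi t).const_mul _) fun x => ?_
      simp only
      have hs := sum_abs_mul_sum_abs_le fun a => W t a x
      rw [← hn] at hs
      set S := ∑ a, |W t a x| with hS
      have k1 : ∑ a, W t a x * (V a x + ∑ j, ∑ b, B j a b x * D j (W t b) x) ≤ C * (S * S) := by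
        calc _ ≤ ∑ a, |W t a x| * (C * S) := Finset.sum_le_sum fun a _ => by
              refine (le_abs_self _).trans ?_
              rw [abs_mul]
              exact mul_le_mul_of_nonneg_left (hZ a x) (abs_nonneg _)
          _ = _ := by rw [← Finset.sum_mul]; ring
      have k2 : ∑ j, ∑ a, ∑ b, W t a x * D j (B j a b) x * W t b x ≤ 3 * (C * (S * S)) := by
        have : ∀ j ∈ (Finset.univ : Finset (Fin 3)),
            ∑ a, ∑ b, W t a x * D j (B j a b) x * W t b x ≤ C * (S * S) := fun j _ => by
          calc _ ≤ ∑ a, ∑ b, |W t a x| * C * |W t b x| := Finset.sum_le_sum fun a _ =>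
                Finset.sum_le_sum fun b _ => by
                  refine (le_abs_self _).trans ?_
                  rw [abs_mul, abs_mul]
                  have := hBC j a b x
                  gcongr
            _ = _ := by
              simp_rw [← Finset.mul_sum]
              rw [← Finset.sum_mul, ← Finset.sum_mul]; ring
        refine (Finset.sum_le_sum this).trans (le_of_eq (by simp))
      have k3 := mul_le_mul_of_nonneg_left hs hC
      linarith
  intro t ht a x
  have h1 := (integral_eq_zero_iff_of_nonneg (fun x => Finset.sum_nonneg fun a _ =>
    sq_nonneg (W t a x)) (hFi t)).1 (hEz t ht)
  have h2 := (Continuous.ae_eq_iff_eq haarT (by fun_prop) (by fun_prop)).1 h1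
  have h3 := (Finset.sum_eq_zero_iff_of_nonneg fun a _ => sq_nonneg (W t a x)).1
    (congrFun h2 x) a (Finset.mem_univ a)
  exact pow_eq_zero_iff two_ne_zero |>.1 h3

end L2

/-! ### Weak time derivatives and absolute continuity -/

/-- The primitive from `0` vanishes to the left of the support of `ζ`, and to the right of it
because `ζ` has mean zero. -/
lemma exists_primitive_test {T : ℝ} (hT : 0 < T) {ζ : ℝ → ℝ} (hζ : ContDiff ℝ ∞ ζ)
    (hc : HasCompactSupport ζ) (hs : tsupport ζ ⊆ Ioo 0 T) (h0 : ∫ t, ζ t = 0) :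
    ∃ ψ : ℝ → ℝ, ContDiff ℝ ∞ ψ ∧ HasCompactSupport ψ ∧ tsupport ψ ⊆ Ioo 0 T ∧ deriv ψ = ζ := by
  -- The midpoint is added so that the set is nonempty and has a least and a greatest element, even
  -- if `ζ = 0`.
  have hK : IsCompact (insert (T / 2) (tsupport ζ)) := IsCompact.insert hc _
  have hKs : insert (T / 2) (tsupport ζ) ⊆ Ioo 0 T :=
    insert_subset ⟨by linarith, by linarith⟩ hs
  obtain ⟨a, ha, ha'⟩ := hK.exists_isLeast (insert_nonempty _ _)
  obtain ⟨b, hb, hb'⟩ := hK.exists_isGreatest (insert_nonempty _ _)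
  have hz : ∀ t, t ∉ Icc a b → ζ t = 0 := fun t ht => by
    by_contra h
    have : t ∈ insert (T / 2) (tsupport ζ) := mem_insert_of_mem _ (subset_tsupport _ h)
    exact ht ⟨ha' this, hb' this⟩
  have hd : ∀ t, HasDerivAt (fun t => ∫ s in (0 : ℝ)..t, ζ s) (ζ t) t := fun t =>
    intervalIntegral.integral_hasDerivAt_right (hζ.continuous.intervalIntegrable _ _)
      (hζ.continuous.stronglyMeasurableAtFilter _ _) hζ.continuous.continuousAt
  have hd' : deriv (fun t => ∫ s in (0 : ℝ)..t, ζ s) = ζ := funext fun t => (hd t).deriv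
  have hsupp : Function.support (fun t => ∫ s in (0 : ℝ)..t, ζ s) ⊆ Icc a b := by
    intro t ht
    by_contra hn
    apply ht
    rcases lt_or_ge t a with h | h
    · change ∫ s in (0 : ℝ)..t, ζ s = 0
      refine (intervalIntegral.integral_congr (g := fun _ => 0) fun s hs' =>
        hz s fun hsab => ?_).trans intervalIntegral.integral_zero
      have h1 : s ≤ max 0 t := hs'.2
      exact absurd (hsab.1.trans h1) (not_le.2 (max_lt (hKs ha).1 h))
    · have h2 : b < t := not_le.1 fun h3 => hn ⟨h, h3⟩
      change ∫ s in (0 : ℝ)..t, ζ s = 0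
      rw [intervalIntegral.integral_eq_integral_of_support_subset, h0]
      intro s hs'
      have h3 : s ∈ Icc a b := by_contra fun h4 => hs' (hz s h4)
      exact ⟨(hKs ha).1.trans_le h3.1, h3.2.trans h2.le⟩
  have hts : tsupport (fun t => ∫ s in (0 : ℝ)..t, ζ s) ⊆ Icc a b :=
    closure_minimal hsupp isClosed_Icc
  refine ⟨_, ?_, IsCompact.of_isClosed_subset isCompact_Icc (isClosed_tsupport _) hts,
    hts.trans fun t ht => ⟨(hKs ha).1.trans_le ht.1, ht.2.trans_lt (hKs hb).2⟩, hd'⟩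
  rw [contDiff_infty_iff_deriv, hd']
  exact ⟨fun t => (hd t).differentiableAt, hζ⟩

/-- The du Bois-Reymond lemma. Subtracting from a test function `η` the multiple `(∫ η) χ` of a
fixed bump of mass one gives a function of mean zero, hence the derivative of a test function; so
`h` minus its `χ`-average is orthogonal to every `η`. -/
lemma exists_const_of_integral_deriv_test {T : ℝ} (hT : 0 < T) {h : ℝ → ℝ}
    (hc : ContinuousOn h (Icc 0 T))
    (hw : ∀ ψ : ℝ → ℝ, ContDiff ℝ ∞ ψ → HasCompactSupport ψ → tsupport ψ ⊆ Ioo 0 T →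
      ∫ t in Ioo 0 T, deriv ψ t * h t = 0) :
    ∃ C, ∀ t ∈ Icc 0 T, h t = C := by
  let f : ContDiffBump (T / 2) := ⟨T / 8, T / 4, by linarith, by linarith⟩
  set χ : ℝ → ℝ := f.normed volume with hχ
  have hχc : ContDiff ℝ ∞ χ := f.contDiff_normed
  have hχs : tsupport χ ⊆ Ioo 0 T := by
    rw [hχ, f.tsupport_normed_eq, Real.closedBall_eq_Icc]
    intro t ht
    have h1 : f.rOut = T / 4 := rfl
    rw [h1] at ht
    exact ⟨by linarith [ht.1], by linarith [ht.2]⟩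
  have hχk : HasCompactSupport χ := f.hasCompactSupport_normed
  have hχ1 : ∫ t, χ t = 1 := f.integral_normed
  have hint : ∀ η : ℝ → ℝ, Continuous η → IntegrableOn (fun t => η t * h t) (Ioo 0 T) :=
    fun η hη => by
      rw [← integrableOn_Icc_iff_integrableOn_Ioo]
      exact (hη.continuousOn.mul hc).integrableOn_Icc
  refine ⟨∫ t in Ioo 0 T, χ t * h t, ?_⟩
  set C := ∫ t in Ioo 0 T, χ t * h t
  have key := isOpen_Ioo.ae_eq_zero_of_integral_contDiff_smul_eq_zero (U := Ioo 0 T)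
    (f := fun t => h t - C) (μ := volume)
    (((hc.mono Ioo_subset_Icc_self).sub continuousOn_const).locallyIntegrableOn
      measurableSet_Ioo) (fun η hη hηc hηs => by
      set I := ∫ t, η t
      obtain ⟨ψ, hψ, hψc, hψs, hψd⟩ := exists_primitive_test hT (ζ := fun t => η t - I * χ t)
        (hη.sub (contDiff_const.mul hχc)) (hηc.sub hχk.mul_left)
        ((tsupport_sub _ _).trans (union_subset hηs
          ((closure_mono (Function.support_mul_subset_right _ _)).trans hχs)))
        (by
          rw [integral_sub (hη.continuous.integrable_of_hasCompactSupport hηc)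
            ((hχc.continuous.integrable_of_hasCompactSupport hχk).const_mul I),
            integral_const_mul, hχ1, mul_one, sub_self])
      have h1 := hw ψ hψ hψc hψs
      rw [hψd] at h1
      have h2 : ∫ t in Ioo 0 T, (η t - I * χ t) * h t = (∫ t in Ioo 0 T, η t * h t) - I * C := by
        rw [← integral_const_mul, ← integral_sub (hint η hη.continuous)
          ((hint χ hχc.continuous).const_mul I)]
        congr 1; ext t; ring
      have hηI : I = ∫ t in Ioo 0 T, η t :=
        (setIntegral_eq_integral_of_forall_compl_eq_zero fun t ht =>
          image_eq_zero_of_notMem_tsupport fun h => ht (hηs h)).symm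
      rw [← setIntegral_eq_integral_of_forall_compl_eq_zero (s := Ioo 0 T) (fun t ht => by
        rw [image_eq_zero_of_notMem_tsupport fun h => ht (hηs h), zero_smul])]
      have h3 : ∫ t in Ioo 0 T, η t • (h t - C)
          = (∫ t in Ioo 0 T, η t * h t) - ∫ t in Ioo 0 T, η t * C := by
        rw [← integral_sub (hint η hη.continuous)
          ((hη.continuous.integrable_of_hasCompactSupport hηc).integrableOn.mul_const C)]
        congr 1; ext t; rw [smul_eq_mul]; ring
      rw [h3, integral_mul_const, ← hηI, ← h2, h1])
  refine Measure.eqOn_Icc_of_ae_eq volume hT.ne (f := h) (g := fun _ => C) ?_ hc continuousOn_const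
  rw [← restrict_Ioo_eq_restrict_Icc]
  refine (ae_restrict_iff' measurableSet_Ioo).2 ?_
  filter_upwards [key] with t ht hm
  exact sub_eq_zero.1 (ht hm)

/-- The primitive `G` of `g` is absolutely continuous with derivative `g` almost everywhere, so by
parts `f - G` has weak derivative zero and is constant. -/
lemma absolutelyContinuous_of_weak_deriv {T : ℝ} (hT : 0 < T) {f g : ℝ → ℝ}
    (hf : ContinuousOn f (Icc 0 T)) (hg : IntegrableOn g (Ioo 0 T))
    (hw : ∀ ψ : ℝ → ℝ, ContDiff ℝ ∞ ψ → HasCompactSupport ψ → tsupport ψ ⊆ Ioo 0 T →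
      ∫ t in Ioo 0 T, deriv ψ t * f t = -∫ t in Ioo 0 T, ψ t * g t) :
    AbsolutelyContinuousOnInterval f 0 T := by
  have hgi : IntervalIntegrable g volume 0 T := by
    rw [intervalIntegrable_iff_integrableOn_Ioo_of_le hT.le]; exact hg
  set G : ℝ → ℝ := fun t => ∫ s in (0 : ℝ)..t, g s with hGdef
  have hG : AbsolutelyContinuousOnInterval G 0 T :=
    hgi.absolutelyContinuousOnInterval_intervalIntegral left_mem_uIcc
  have hGc : ContinuousOn G (Icc 0 T) := by rw [← uIcc_of_le hT.le]; exact hG.continuousOn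
  obtain ⟨C, hC⟩ := exists_const_of_integral_deriv_test hT (h := fun t => f t - G t)
    (hf.sub hGc) (fun ψ hψ hψc hψs => by
      have hi : ∀ F : ℝ → ℝ, ContinuousOn F (Icc 0 T) →
          IntegrableOn (fun t => deriv ψ t * F t) (Ioo 0 T) := fun F hF => by
        rw [← integrableOn_Icc_iff_integrableOn_Ioo]
        exact ((hψ.continuous_deriv (by simp)).continuousOn.mul hF).integrableOn_Icc
      have hψ0 : ψ 0 = 0 := image_eq_zero_of_notMem_tsupport fun h => lt_irrefl _ (hψs h).1
      have hψT : ψ T = 0 := image_eq_zero_of_notMem_tsupport fun h => lt_irrefl _ (hψs h).2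
      have h1 := hG.integral_mul_deriv_eq_deriv_mul
        ((hψ.of_le (by norm_cast) : ContDiff ℝ 1 ψ).contDiffOn
          (s := uIcc 0 T)).absolutelyContinuousOnInterval
      rw [hψ0, hψT, mul_zero, mul_zero, sub_zero, zero_sub] at h1
      have h2 : ∫ x in (0 : ℝ)..T, deriv G x * ψ x = ∫ x in (0 : ℝ)..T, ψ x * g x := by
        refine intervalIntegral.integral_congr_ae ?_
        filter_upwards [hgi.ae_hasDerivAt_integral] with t ht hm
        rw [(ht (uIoc_subset_uIcc hm) 0 left_mem_uIcc).deriv, mul_comm]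
      rw [h2, intervalIntegral.integral_of_le hT.le, intervalIntegral.integral_of_le hT.le,
        integral_Ioc_eq_integral_Ioo, integral_Ioc_eq_integral_Ioo] at h1
      simp_rw [mul_sub]
      rw [integral_sub (hi f hf) (hi G hGc), hw ψ hψ hψc hψs, ← h1, sub_eq_zero]
      simp_rw [mul_comm])
  have hh : AbsolutelyContinuousOnInterval (fun t => f t - G t) 0 T := by
    refine LipschitzOnWith.absolutelyContinuousOnInterval (K := 0) ?_
    rw [uIcc_of_le hT.le]
    refine LipschitzOnWith.of_dist_le_mul fun s hs t ht => ?_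
    rw [hC s hs, hC t ht, dist_self]; simp
  have := hh.fun_add hG
  simpa using this

lemma absolutelyContinuous_comp_lipschitzOn {f φ : ℝ → ℝ} {K : ℝ≥0} {a b : ℝ} {S : Set ℝ}
    (hf : AbsolutelyContinuousOnInterval f a b) (hφ : LipschitzOnWith K φ S)
    (hS : MapsTo f (uIcc a b) S) : AbsolutelyContinuousOnInterval (fun t => φ (f t)) a b := by
  rw [absolutelyContinuousOnInterval_iff] at hf ⊢
  intro ε hε
  obtain ⟨δ, hδ, h⟩ := hf (ε / (K + 1)) (by positivity)
  refine ⟨δ, hδ, fun E hE hEd => ?_⟩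
  calc _ ≤ ∑ i ∈ Finset.range E.1, ((K : ℝ) + 1) * dist (f (E.2 i).1) (f (E.2 i).2) := by
        refine Finset.sum_le_sum fun i hi => (hφ.dist_le_mul _ (hS (hE.1 i hi).1) _
          (hS (hE.1 i hi).2)).trans ?_
        gcongr; simp
    _ < ε := by
        rw [← Finset.mul_sum]
        have := h E hE hEd
        rw [lt_div_iff₀ (by positivity)] at this
        linarith

/-- An absolutely continuous function is the integral of its derivative, so an almost everywhere
bound on the derivative suffices. -/
lemma lipschitz_of_absolutelyContinuous {T C : ℝ} {f : ℝ → ℝ}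
    (hf : AbsolutelyContinuousOnInterval f 0 T)
    (hd : ∀ᵐ t ∂volume.restrict (Ioo 0 T), ∃ d, HasDerivAt f d t ∧ |d| ≤ C) :
    ∀ s ∈ Icc 0 T, ∀ t ∈ Icc 0 T, |f t - f s| ≤ C * |t - s| := by
  intro s hs t ht
  have hT : 0 ≤ T := hs.1.trans hs.2
  have hsub : uIcc s t ⊆ Icc 0 T := fun r hr =>
    ⟨(le_min hs.1 ht.1).trans hr.1, hr.2.trans (max_le hs.2 ht.2)⟩
  have h1 := (hf.mono (c := s) (d := t) (by rwa [uIcc_of_le hT])).integral_deriv_eq_sub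
  rw [← h1, ← Real.norm_eq_abs]
  refine intervalIntegral.norm_integral_le_of_norm_le_const_ae ?_
  rw [restrict_Ioo_eq_restrict_Icc, ae_restrict_iff' measurableSet_Icc] at hd
  filter_upwards [hd] with r hr hm
  obtain ⟨d, h2, h3⟩ := hr (hsub (uIoc_subset_uIcc hm))
  rw [h2.deriv]; exact h3

/-- On a bounded interval `‖v‖ ≤ 1 + ‖v‖²`, and the square is controlled by the `H^s` norm through
the Sobolev embedding. -/
lemma MemL2H.integrableOn {T s : ℝ} (hs : 3 / 2 < s) {v : ℝ → C(Torus, ℝ)} (hv : MemL2H T s v) :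
    IntegrableOn v (Ioo 0 T) := by
  refine ⟨hv.1, ?_⟩
  set K := ∑' k, W (-s) k
  have hK : K < ⊤ := tsum_W_neg_lt_top hs
  calc ∫⁻ t in Ioo 0 T, ‖v t‖ₑ ≤ ∫⁻ t in Ioo 0 T, (1 + K * sobolevNormSq s (v t)) := by
        refine lintegral_mono fun t => ?_
        refine le_trans ?_ (add_le_add_right (enorm_sq_le_sobolev (s := s) (f := v t)) 1)
        rcases le_total ‖v t‖ₑ 1 with h | h
        · exact h.trans le_self_add
        · exact (le_self_pow₀ h two_ne_zero).trans le_add_self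
    _ = volume (Ioo 0 T) + K * ∫⁻ t in Ioo 0 T, sobolevNormSq s (v t) := by
        rw [lintegral_add_left measurable_const, lintegral_const_mul' _ _ hK.ne]
        simp
    _ < ⊤ := by
        refine ENNReal.add_lt_top.2 ⟨by simp, ENNReal.mul_lt_top hK hv.2⟩

lemma setIntegral_smul_apply {T : ℝ} {η : ℝ → ℝ} {w : ℝ → C(Torus, ℝ)} (hη : Continuous η)
    (hw : IntegrableOn w (Ioo 0 T)) (x : Torus) :
    (∫ t in Ioo 0 T, η t • w t) x = ∫ t in Ioo 0 T, η t * w t x := by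
  change ContinuousMap.evalCLM ℝ x (∫ t in Ioo 0 T, η t • w t) = _
  rw [← ContinuousLinearMap.integral_comp_comm]
  · rfl
  · rw [IntegrableOn, restrict_Ioo_eq_restrict_Icc] at hw
    rw [restrict_Ioo_eq_restrict_Icc]
    exact IntegrableOn.continuousOn_smul hw hη.continuousOn isCompact_Icc

/-- Functions of the class `C([0,T]; C) ∩ H¹(0,T; H^s)` are absolutely continuous in time at every
point of the torus. -/
lemma MemH1H.absolutelyContinuous {T s : ℝ} (hT : 0 < T) (hs : 3 / 2 < s) {u : ℝ → C(Torus, ℝ)}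
    (hc : ContinuousOn u (Icc 0 T)) (hu : MemH1H T s u) (x : Torus) :
    AbsolutelyContinuousOnInterval (fun t => u t x) 0 T := by
  obtain ⟨-, v, hv, hw⟩ := hu
  have hvi := hv.integrableOn hs
  have hui : IntegrableOn u (Ioo 0 T) := hc.integrableOn_Icc.mono_set Ioo_subset_Icc_self
  refine absolutelyContinuous_of_weak_deriv hT (g := fun t => v t x)
    ((ContinuousMap.evalCLM ℝ x).continuous.comp_continuousOn hc)
    ((ContinuousMap.evalCLM ℝ x : C(Torus, ℝ) →L[ℝ] ℝ).integrable_comp hvi)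
    fun ψ hψ hψc hψs => ?_
  rw [← setIntegral_smul_apply (hψ.continuous_deriv (by simp)) hui, hw ψ hψ hψc hψs,
    ContinuousMap.neg_apply, setIntegral_smul_apply hψ.continuous hvi]

/-! ### The sound speed and the symmetrizing density variable -/

section Sound
variable {p : ℝ → ℝ}

/-- The symmetrizing density variable, with derivative `√(p' r) / r`. -/
def potential (p : ℝ → ℝ) (r : ℝ) : ℝ := ∫ z in (1 : ℝ)..r, √(deriv p z) / z

lemma contDiffOn_sound (hp : ContDiffOn ℝ ∞ p (Ioi 0)) (hp' : ∀ r, 0 < r → 0 < deriv p r) :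
    ContDiffOn ℝ ∞ (fun z => √(deriv p z)) (Ioi 0) :=
  ((contDiffOn_infty_iff_deriv_of_isOpen isOpen_Ioi).1 hp).2.sqrt fun r hr => (hp' r hr).ne'

lemma contDiffOn_sound_div (hp : ContDiffOn ℝ ∞ p (Ioi 0)) (hp' : ∀ r, 0 < r → 0 < deriv p r) :
    ContDiffOn ℝ ∞ (fun z => √(deriv p z) / z) (Ioi 0) :=
  (contDiffOn_sound hp hp').div contDiffOn_id fun _ hr => ne_of_gt hr

lemma hasDerivAt_potential (hp : ContDiffOn ℝ ∞ p (Ioi 0)) (hp' : ∀ r, 0 < r → 0 < deriv p r)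
    {r : ℝ} (hr : 0 < r) : HasDerivAt (potential p) (√(deriv p r) / r) r := by
  have hc := (contDiffOn_sound_div hp hp').continuousOn
  refine intervalIntegral.integral_hasDerivAt_right ?_ ?_ (hc.continuousAt (Ioi_mem_nhds hr))
  · refine (hc.mono fun z hz => ?_).intervalIntegrable
    exact (lt_min one_pos hr).trans_le hz.1
  · exact hc.stronglyMeasurableAtFilter isOpen_Ioi r hr

lemma contDiffOn_potential (hp : ContDiffOn ℝ ∞ p (Ioi 0)) (hp' : ∀ r, 0 < r → 0 < deriv p r) :
    ContDiffOn ℝ ∞ (potential p) (Ioi 0) := by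
  rw [contDiffOn_infty_iff_deriv_of_isOpen isOpen_Ioi]
  refine ⟨fun r hr => (hasDerivAt_potential hp hp' hr).differentiableAt.differentiableWithinAt, ?_⟩
  exact (contDiffOn_sound_div hp hp').congr fun r hr => (hasDerivAt_potential hp hp' hr).deriv

lemma sound_div_pos (hp' : ∀ r, 0 < r → 0 < deriv p r) {r : ℝ} (hr : 0 < r) :
    0 < √(deriv p r) / r := div_pos (Real.sqrt_pos.2 (hp' r hr)) hr

lemma strictMonoOn_potential (hp : ContDiffOn ℝ ∞ p (Ioi 0))
    (hp' : ∀ r, 0 < r → 0 < deriv p r) : StrictMonoOn (potential p) (Ioi 0) := by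
  refine strictMonoOn_of_deriv_pos (convex_Ioi 0) (contDiffOn_potential hp hp').continuousOn ?_
  intro r hr
  rw [interior_Ioi] at hr
  rw [(hasDerivAt_potential hp hp' hr).deriv]
  exact sound_div_pos hp' hr

/-- The potential as a homeomorphism of `(0,∞)` onto its open range. -/
lemma exists_potential_homeomorph (hp : ContDiffOn ℝ ∞ p (Ioi 0))
    (hp' : ∀ r, 0 < r → 0 < deriv p r) :
    ∃ e : OpenPartialHomeomorph ℝ ℝ, e.source = Ioi 0 ∧ (∀ r, e r = potential p r) ∧
      ContDiffOn ℝ ∞ e.symm e.target := by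
  have hinj := (strictMonoOn_potential hp hp').injOn
  have hcd := contDiffOn_potential hp hp'
  let e : OpenPartialHomeomorph ℝ ℝ := OpenPartialHomeomorph.ofContinuousOpenRestrict
    (hinj.toPartialEquiv (potential p) (Ioi 0)) hcd.continuousOn (by
      rw [isOpenMap_iff_nhds_le]
      rintro ⟨r, hr⟩
      have hr : (0 : ℝ) < r := hr
      have h1 : HasStrictDerivAt (potential p) (√(deriv p r) / r) r :=
        (hcd.contDiffAt (Ioi_mem_nhds hr)).hasStrictDerivAt' (hasDerivAt_potential hp hp' hr)
          (by simp)
      have h2 := h1.map_nhds_eq (sound_div_pos hp' hr).ne'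
      change nhds (potential p r) ≤ _
      rw [← h2]
      have h3 : nhds r = Filter.map Subtype.val (nhds (⟨r, hr⟩ : Ioi (0 : ℝ))) :=
        (map_nhds_subtype_coe_eq_nhds hr (Ioi_mem_nhds hr)).symm
      rw [h3, Filter.map_map]
      rfl) isOpen_Ioi
  refine ⟨e, rfl, fun _ => rfl, fun y hy => ?_⟩
  have h0 : 0 < e.symm y := e.map_target hy
  refine (e.contDiffAt_symm_deriv (f₀' := √(deriv p (e.symm y)) / e.symm y)
    (sound_div_pos hp' h0).ne' hy (hasDerivAt_potential hp hp' h0)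
    (hcd.contDiffAt (Ioi_mem_nhds h0))).contDiffWithinAt

/-- The inverse of the potential, and a globally smooth function expressing the sound speed in
terms of the potential for densities in a compact range. -/
lemma exists_inverse_potential (hp : ContDiffOn ℝ ∞ p (Ioi 0))
    (hp' : ∀ r, 0 < r → 0 < deriv p r) {α β : ℝ} (hα : 0 < α) (hαβ : α < β) :
    ∃ R q : ℝ → ℝ, ContDiffOn ℝ ∞ R (Ioo (potential p α) (potential p β)) ∧
      (∀ y ∈ Ioo (potential p α) (potential p β), R y ∈ Ioo α β ∧ potential p (R y) = y) ∧
      (∀ r, 0 < r → R (potential p r) = r) ∧ ContDiff ℝ ∞ q ∧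
      ∀ r ∈ Icc α β, q (potential p r) = √(deriv p r) := by
  obtain ⟨e, hes, he, hesymm⟩ := exists_potential_homeomorph hp hp'
  have hmono := strictMonoOn_potential hp hp'
  have hβ : 0 < β := hα.trans hαβ
  have htar : ∀ a b, 0 < a → a ≤ b → Icc (potential p a) (potential p b) ⊆ e.target := by
    intro a b ha hab y hy
    have hsub : Icc a b ⊆ Ioi 0 := fun r hr => ha.trans_le hr.1
    obtain ⟨r, hr, rfl⟩ := intermediate_value_Icc hab
      ((contDiffOn_potential hp hp').continuousOn.mono hsub) hy
    rw [← he]; exact e.map_source (hes ▸ hsub hr)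
  have hinv : ∀ r, 0 < r → e.symm (potential p r) = r := fun r hr => by
    rw [← he]; exact e.left_inv (hes ▸ hr)
  set a := potential p α with ha
  set b := potential p β with hb
  have hab : a < b := hmono hα hβ hαβ
  have ha' : potential p (α / 2) < a := hmono (half_pos hα) hα (half_lt_self hα)
  have hb' : b < potential p (2 * β) := hmono hβ (by positivity : (0 : ℝ) < 2 * β) (by linarith)
  -- With the margin `δ` the bump equals one on `[a, b]` and is supported in the image of `[α/2,
  -- 2β]`. There the sound speed is a smooth function of the potential, so the product extended by
  -- zero is smooth on the whole line.
  set δ := min (a - potential p (α / 2)) (potential p (2 * β) - b) with hδ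
  have hδ0 : 0 < δ := lt_min (by linarith) (by linarith)
  let f : ContDiffBump ((a + b) / 2) :=
    ⟨(b - a) / 2, (b - a) / 2 + δ, by linarith, by linarith⟩
  have hfs : tsupport f ⊆ e.target := by
    rw [f.tsupport_eq, Real.closedBall_eq_Icc]
    have h1 : f.rOut = (b - a) / 2 + δ := rfl
    rw [h1]
    refine Subset.trans (fun y hy => ?_) (htar (α / 2) (2 * β) (by positivity) (by linarith))
    have h2 := min_le_left (a - potential p (α / 2)) (potential p (2 * β) - b)
    have h3 := min_le_right (a - potential p (α / 2)) (potential p (2 * β) - b)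
    exact ⟨by linarith [hy.1], by linarith [hy.2]⟩
  have hq : ContDiffOn ℝ ∞ (fun y => √(deriv p (e.symm y))) e.target :=
    (contDiffOn_sound hp hp').comp hesymm fun y hy => by
      have := e.map_target hy; rwa [hes] at this
  refine ⟨e.symm, fun y => f y * √(deriv p (e.symm y)),
    hesymm.mono (Ioo_subset_Icc_self.trans (htar α β hα hαβ.le)), fun y hy => ?_, hinv, ?_, ?_⟩
  · have hy' := htar α β hα hαβ.le (Ioo_subset_Icc_self hy)
    have h1 : potential p (e.symm y) = y := by rw [← he]; exact e.right_inv hy'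
    have h0 : (0 : ℝ) < e.symm y := by have := e.map_target hy'; rwa [hes] at this
    refine ⟨⟨(hmono.lt_iff_lt hα h0).1 ?_, (hmono.lt_iff_lt h0 hβ).1 ?_⟩, h1⟩
    · rw [h1]; exact hy.1
    · rw [h1]; exact hy.2
  · refine contDiff_iff_contDiffAt.2 fun y => ?_
    by_cases hy : y ∈ tsupport f
    · exact f.contDiff.contDiffAt.mul (hq.contDiffAt (e.open_target.mem_nhds (hfs hy)))
    · refine contDiffAt_const (c := (0 : ℝ)) |>.congr_of_eventuallyEq ?_
      filter_upwards [(isClosed_tsupport f).isOpen_compl.mem_nhds hy] with z hz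
      rw [image_eq_zero_of_notMem_tsupport hz, zero_mul]
  · intro r hr
    have hr0 : 0 < r := hα.trans_le hr.1
    have h1 : potential p r ∈ Metric.closedBall ((a + b) / 2) f.rIn := by
      have h2 : f.rIn = (b - a) / 2 := rfl
      rw [Real.closedBall_eq_Icc, h2]
      have h3 : a ≤ potential p r := hmono.monotoneOn hα hr0 hr.1
      have h4 : potential p r ≤ b := hmono.monotoneOn hr0 hβ hr.2
      exact ⟨by linarith, by linarith⟩
    change f (potential p r) * √(deriv p (e.symm (potential p r))) = _
    rw [f.one_of_mem_closedBall h1, one_mul, hinv r hr0]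

end Sound

/-! ### The symmetric form of the system -/

/-- The coefficients of the symmetric form of the system, for the unknowns
`(potential p ρ, Ω)`. -/
def symA (c : ℝ) (q : ℝ → ℝ) (j : Fin 3) :
    Option (Fin 3) → Option (Fin 3) → (Option (Fin 3) → ℝ) → ℝ
  | none, none => fun y => y (some j)
  | none, some i => fun y => q (y none) * ((if i = j then 1 else 0) - y (some i) * y (some j))
  | some i, none => fun y => q (y none) * ((if i = j then 1 else 0) - y (some i) * y (some j))
  | some i, some k => fun y => if i = k then c * y (some j) else 0

lemma symA_symm (c : ℝ) (q : ℝ → ℝ) (j : Fin 3) (a b : Option (Fin 3)) :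
    symA c q j a b = symA c q j b a := by
  rcases a with _ | i <;> rcases b with _ | k <;> simp only [symA]
  simp only [eq_comm]

lemma contDiff_symA (c : ℝ) {q : ℝ → ℝ} (hq : ContDiff ℝ ∞ q) (j : Fin 3)
    (a b : Option (Fin 3)) : ContDiff ℝ ∞ (symA c q j a b) := by
  have hy : ∀ d : Option (Fin 3), ContDiff ℝ ∞ fun y : Option (Fin 3) → ℝ => y d :=
    fun d => contDiff_apply ℝ ℝ d
  have h1 : ∀ i, ContDiff ℝ ∞ fun y : Option (Fin 3) → ℝ =>
      q (y none) * ((if i = j then 1 else 0) - y (some i) * y (some j)) := fun i =>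
    (hq.comp (hy none)).mul (contDiff_const.sub ((hy _).mul (hy _)))
  rcases a with _ | i <;> rcases b with _ | k <;> simp only [symA]
  · exact hy _
  · exact h1 k
  · exact h1 i
  · split_ifs
    · exact contDiff_const.mul (hy _)
    · exact contDiff_const

section Algebra
variable {c r s rt : ℝ} {q : ℝ → ℝ} {n dr nt : Fin 3 → ℝ} {dn : Fin 3 → Fin 3 → ℝ}
  {y : Option (Fin 3) → ℝ} {dy : Fin 3 → Option (Fin 3) → ℝ}

/-- The symmetric coefficients contain `δᵢⱼ - nᵢ nⱼ` where the divergence has `δᵢⱼ`. The additional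
terms vanish by `hn`, the derivative of `|n|² = 1`. -/
lemma mass_iff (hr : 0 < r) (hs : 0 < s) (hq : q (y none) = s) (hy : ∀ i, y (some i) = n i)
    (hdy0 : ∀ j, dy j none = s / r * dr j) (hdy : ∀ j i, dy j (some i) = dn j i)
    (hn : ∀ j, ∑ i, n i * dn j i = 0) :
    rt + ∑ j, (dr j * n j + r * dn j j) = 0 ↔
      s / r * rt + ∑ j, ∑ b, symA c q j none b y * dy j b = 0 := by
  have key : s / r * rt + ∑ j, ∑ b, symA c q j none b y * dy j b =
      s / r * (rt + ∑ j, (dr j * n j + r * dn j j)) := by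
    simp only [Fintype.sum_option, symA, hq, hy, hdy0, hdy, Fin.sum_univ_three] at hn ⊢
    have h0 := hn 0
    have h1 := hn 1
    have h2 := hn 2
    simp only [Fin.isValue, Fin.reduceEq, if_true, if_false]
    field_simp
    linear_combination (-(r * n 0)) * h0 - r * n 1 * h1 - r * n 2 * h2
  rw [key, mul_eq_zero, or_iff_right (div_pos hs hr).ne']

/-- Dividing by `r` turns the pressure term `s² dr` into `s` times the derivative `(s / r) dr` of
the potential. The factor `s` is the one multiplying the projected divergence in the mass equation,
which yields symmetry. -/
lemma momentum_iff (hr : 0 < r) (hq : q (y none) = s) (hy : ∀ i, y (some i) = n i)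
    (hdy0 : ∀ j, dy j none = s / r * dr j) (hdy : ∀ j i, dy j (some i) = dn j i) :
    r • (nt + c • ∑ j, n j • dn j) + projPerp n (fun j => s ^ 2 * dr j) = 0 ↔
      ∀ i, nt i + ∑ j, ∑ b, symA c q j (some i) b y * dy j b = 0 := by
  have key : ∀ i, (r • (nt + c • ∑ j, n j • dn j) + projPerp n (fun j => s ^ 2 * dr j)) i =
      r * (nt i + ∑ j, ∑ b, symA c q j (some i) b y * dy j b) := fun i => by
    simp only [Fintype.sum_option, symA, hq, hy, hdy0, hdy, Fin.sum_univ_three, Pi.add_apply,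
      Pi.smul_apply, smul_eq_mul, projPerp, dotProduct, Pi.sub_apply]
    fin_cases i <;> simp <;> field_simp <;> ring
  rw [funext_iff]
  refine forall_congr' fun i => ?_
  rw [key, Pi.zero_apply, mul_eq_zero, or_iff_right hr.ne']

end Algebra

/-! ### Curves of functions and membership in the solution class -/

lemma exists_abs_D_le {m : ℝ} (hm : 5 / 2 < m) (M : ℝ≥0) :
    ∃ C : ℝ≥0, ∀ f : C(Torus, ℝ), sobolevNormSq m f ≤ M → ∀ j x, |D j f x| ≤ C := by
  obtain ⟨M', hM'⟩ := exists_sobolev_D_le hm M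
  obtain ⟨C, hC⟩ := exists_norm_le (by linarith : 3 / 2 < m - 1) M'
  exact ⟨C, fun f hf j x => ((D j f).norm_coe_le_norm x).trans (hC _ (hM' f hf j))⟩

section Curves
variable {ι : Type*} {U : Set (ι → ℝ)} {T : ℝ}

/-- A compact-open condition, since the torus is compact. It keeps a continuous curve inside the
recovery domain for a short time. -/
lemma isOpen_adm (hU : IsOpen U) : IsOpen (Adm U) := by
  set Φ : (ι → C(Torus, ℝ)) → C(Torus, ι → ℝ) := fun u => ⟨ev u, continuous_ev u⟩
  have hΦ : Continuous Φ := ContinuousMap.continuous_of_continuous_uncurry _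
    (continuous_pi fun a => by
      have : Continuous fun p : (ι → C(Torus, ℝ)) × Torus => (p.1 a, p.2) :=
        ((continuous_apply a).comp continuous_fst).prodMk continuous_snd
      exact continuous_eval.comp this)
  have h : Adm U = Φ ⁻¹' {f | MapsTo f univ U} := by
    ext u
    exact ⟨fun h x _ => h x, fun h x => h (mem_univ x)⟩
  rw [h]
  exact (ContinuousMap.isOpen_setOfPred_mapsTo isCompact_univ hU).preimage hΦ

/-- All values form the image of the compact set `[0, T] × torus`; the Moser estimate needs such a
compact subset of `U`. -/
lemma exists_compact_adm {v : ℝ → ι → C(Torus, ℝ)}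
    (hv : ∀ a, ContinuousOn (fun t => v t a) (Icc 0 T)) (hU : ∀ t ∈ Icc 0 T, v t ∈ Adm U) :
    ∃ K ⊆ U, IsCompact K ∧ ∀ t ∈ Icc 0 T, v t ∈ Adm K := by
  refine ⟨(fun p : ℝ × Torus => ev (v p.1) p.2) '' (Icc 0 T ×ˢ univ), ?_, ?_, ?_⟩
  · rintro _ ⟨⟨t, x⟩, ⟨ht, -⟩, rfl⟩
    exact hU t ht x
  · refine (isCompact_Icc.prod isCompact_univ).image_of_continuousOn
      (continuousOn_pi.2 fun a => ?_)
    have h : ContinuousOn (fun p : ℝ × Torus => (v p.1 a, p.2)) (Icc 0 T ×ˢ univ) :=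
      ((hv a).comp continuousOn_fst fun p hp => hp.1).prodMk continuousOn_snd
    exact continuous_eval.comp_continuousOn h
  · exact fun t ht x => ⟨(t, x), ⟨ht, mem_univ x⟩, rfl⟩

lemma hasDerivAt_apply_of_curve {v v' : ℝ → ι → C(Torus, ℝ)}
    {t : ℝ} (ht : t ∈ Ioo 0 T) (hv : ∀ a, HasDerivWithinAt (fun t => v t a) (v' t a) (Icc 0 T) t)
    (a : ι) (x : Torus) : HasDerivAt (fun s => v s a x) (v' t a x) t :=
  (ContinuousMap.evalCLM ℝ x : C(Torus, ℝ) →L[ℝ] ℝ).hasFDerivAt.comp_hasDerivAt t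
    ((hv a).hasDerivAt (Icc_mem_nhds ht.1 ht.2))

variable [Fintype ι] [DecidableEq ι]

lemma hasDerivAt_nem {F : (ι → ℝ) → ℝ} (hUo : IsOpen U) (hF : ContDiffOn ℝ ∞ F U)
    {v : ℝ → ι → C(Torus, ℝ)} {y' : ι → ℝ} {t : ℝ} {x : Torus} (ht : t ∈ Ioo 0 T)
    (hU : ∀ t ∈ Icc 0 T, v t ∈ Adm U) (hv : ∀ a, HasDerivAt (fun s => v s a x) (y' a) t) :
    HasDerivAt (fun s => nem F (v s) x) (∑ a, pd a F (ev (v t) x) * y' a) t := by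
  refine (hasDerivAt_comp_pd hUo hF (y := fun s => ev (v s) x) hv
    (hU t (Ioo_subset_Icc_self ht) x)).congr_of_eventuallyEq ?_
  filter_upwards [Icc_mem_nhds ht.1 ht.2] with s hs
  exact nem_apply hF.continuousOn (hU s hs) x

/-- Smooth functions of a `C¹` curve which is bounded in `H^m` with derivative bounded in
`H^(m-1)` belong to the solution class. -/
lemma inSolutionClass_nem {m : ℝ} (hm : 5 / 2 < m) {F : (ι → ℝ) → ℝ} (hUo : IsOpen U)
    (hF : ContDiffOn ℝ ∞ F U) {v v' : ℝ → ι → C(Torus, ℝ)} {M M' : ℝ≥0}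
    (hv : ∀ t ∈ Icc 0 T, ∀ a, HasDerivWithinAt (fun t => v t a) (v' t a) (Icc 0 T) t)
    (hv' : ∀ a, ContinuousOn (fun t => v' t a) (Icc 0 T))
    (hM : ∀ t ∈ Icc 0 T, ∀ a, sobolevNormSq m (v t a) ≤ M)
    (hM' : ∀ t ∈ Icc 0 T, ∀ a, sobolevNormSq (m - 1) (v' t a) ≤ M')
    (hU : ∀ t ∈ Icc 0 T, v t ∈ Adm U) :
    InSolutionClass T m (fun t => nem F (v t)) := by
  have hvc : ∀ a, ContinuousOn (fun t => v t a) (Icc 0 T) :=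
    fun a t ht => (hv t ht a).continuousWithinAt
  obtain ⟨K, hKU, hKc, hK⟩ := exists_compact_adm hvc hU
  have hvc' : ContinuousOn v (Icc 0 T) := continuousOn_pi.2 hvc
  have hcomp : ∀ G : (ι → ℝ) → ℝ, ContDiffOn ℝ ∞ G U →
      ContinuousOn (fun t => nem G (v t)) (Icc 0 T) := fun G hG =>
    (continuousOn_nem hG.continuousOn).comp hvc' hU
  have hms : ∀ w : ℝ → C(Torus, ℝ), ContinuousOn w (Icc 0 T) →
      AEStronglyMeasurable w (volume.restrict (Ioo 0 T)) := fun w hw =>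
    (hw.mono Ioo_subset_Icc_self).aestronglyMeasurable measurableSet_Ioo
  have hL2 : ∀ (w : ℝ → C(Torus, ℝ)) (C : ℝ≥0), ContinuousOn w (Icc 0 T) →
      (∀ t ∈ Icc 0 T, sobolevNormSq (m - 1) (w t) ≤ C) → MemL2H T (m - 1) w :=
    fun w C hw hC => ⟨hms w hw, (setLIntegral_mono' measurableSet_Ioo fun t ht =>
      hC t (Ioo_subset_Icc_self ht)).trans_lt (by
        rw [setLIntegral_const]
        exact ENNReal.mul_lt_top ENNReal.coe_lt_top (by simp))⟩
  obtain ⟨C, hC⟩ := exists_sobolev_nem_le hm hUo hKc hKU M hF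
  choose C₁ hC₁ using fun a => exists_sobolev_nem_le hm hUo hKc hKU M (contDiffOn_pd hUo hF a)
  obtain ⟨C₂, hC₂⟩ := sobolev_mul (by linarith : 0 ≤ m - 1) (by linarith : m - 1 ≤ m)
    (by linarith)
  -- The candidate for the weak time derivative, given by the chain rule.
  set y' : ℝ → C(Torus, ℝ) := fun t => ∑ a, nem (pd a F) (v t) * v' t a with hy'
  have hy'c : ContinuousOn y' (Icc 0 T) := continuousOn_finsetSum _ fun a _ =>
    (hcomp _ (contDiffOn_pd hUo hF a)).mul (hv' a)
  have hbd : ∀ t ∈ Icc 0 T, sobolevNormSq m (nem F (v t)) ≤ C := fun t ht =>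
    hC _ (hK t ht) (hM t ht)
  refine ⟨hcomp F hF, ⟨hms _ (hcomp F hF), C, ?_⟩, hL2 _ C (hcomp F hF) fun t ht =>
    (sobolevNormSq_mono (by linarith) _).trans (hbd t ht), y',
    hL2 y' (2 ^ Fintype.card ι * ∑ a, C₂ * C₁ a * M') hy'c fun t ht => ?_,
    fun ψ hψ hψc hψs => ?_⟩
  · exact ae_restrict_of_forall_mem measurableSet_Ioo fun t ht => hbd t (Ioo_subset_Icc_self ht)
  · refine (sobolevNormSq_sum_le _ _ _).trans ?_
    push_cast
    rw [Finset.card_univ]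
    gcongr with a
    have h1 := hC₁ a _ (hK t ht) (hM t ht)
    refine (hC₂ _ _ (h1.trans_lt ENNReal.coe_lt_top)).trans ?_
    gcongr
    exact hM' t ht a
  · ext x
    have hi : ∀ w : ℝ → C(Torus, ℝ), ContinuousOn w (Icc 0 T) → IntegrableOn w (Ioo 0 T) :=
      fun w hw => hw.integrableOn_Icc.mono_set Ioo_subset_Icc_self
    have hψd : Continuous (deriv ψ) := hψ.continuous_deriv (by simp)
    rw [ContinuousMap.neg_apply, setIntegral_smul_apply hψd (hi _ (hcomp F hF)),
      setIntegral_smul_apply hψ.continuous (hi _ hy'c), eq_neg_iff_add_eq_zero]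
    rcases lt_or_ge T 0 with hT | hT
    · rw [Ioo_eq_empty (by linarith)]; simp
    have hev : ∀ w : ℝ → C(Torus, ℝ), ContinuousOn w (Icc 0 T) →
        ContinuousOn (fun t => w t x) (Icc 0 T) := fun w hw =>
      (ContinuousMap.evalCLM ℝ x : C(Torus, ℝ) →L[ℝ] ℝ).continuous.comp_continuousOn hw
    have c1 : ContinuousOn (fun t => deriv ψ t * nem F (v t) x) (Icc 0 T) :=
      hψd.continuousOn.mul (hev _ (hcomp F hF))
    have c2 : ContinuousOn (fun t => ψ t * y' t x) (Icc 0 T) :=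
      hψ.continuous.continuousOn.mul (hev _ hy'c)
    -- At a fixed point `x` the claim is that the derivative of `ψ · F(v)` has integral zero, `ψ`
    -- vanishing at both ends.
    rw [← integral_add (c1.integrableOn_Icc.mono_set Ioo_subset_Icc_self)
      (c2.integrableOn_Icc.mono_set Ioo_subset_Icc_self), ← integral_Ioc_eq_integral_Ioo,
      ← intervalIntegral.integral_of_le hT]
    refine (intervalIntegral.integral_eq_sub_of_hasDerivAt_of_le hT
      (f := fun t => ψ t * nem F (v t) x)
      (hψ.continuous.continuousOn.mul (hev _ (hcomp F hF)))
      (fun t ht => ?_) ((c1.add c2).intervalIntegrable_of_Icc hT)).trans ?_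
    rotate_left
    · have hψ0 : ψ 0 = 0 := image_eq_zero_of_notMem_tsupport fun h => lt_irrefl _ (hψs h).1
      have hψT : ψ T = 0 := image_eq_zero_of_notMem_tsupport fun h => lt_irrefl _ (hψs h).2
      rw [hψ0, hψT, zero_mul, zero_mul, sub_zero]
    · have h1 : HasDerivAt ψ (deriv ψ t) t :=
        (hψ.differentiable (by simp)).differentiableAt.hasDerivAt
      have h2 := hasDerivAt_nem hUo hF ht hU
        (fun a => hasDerivAt_apply_of_curve ht (hv t (Ioo_subset_Icc_self ht)) a x)
      refine (h1.mul h2).congr_deriv ?_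
      have h3 : y' t x = ∑ a, pd a F (ev (v t) x) * v' t a x := by
        rw [hy', ContinuousMap.sum_apply]
        refine Finset.sum_congr rfl fun a _ => ?_
        rw [ContinuousMap.mul_apply, nem_apply (contDiffOn_pd hUo hF a).continuousOn
        (hU t (Ioo_subset_Icc_self ht))]
      rw [← h3]; rfl

end Curves

/-! ### The unknowns of the symmetric system as functions of density and angles -/

/-- The unknowns of the symmetric system as functions of density and angles. -/
def stateFun (p : ℝ → ℝ) : Option (Fin 3) → (Fin 3 → ℝ) → ℝ
  | none => fun y => potential p (y 0)
  | some i => fun y => direction (y 1) (y 2) i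

/-- The values with positive density. -/
def posDensity : Set (Fin 3 → ℝ) := {y | 0 < y 0}

/-- The unknowns of the symmetric system for given density and angles. -/
def state (p : ℝ → ℝ) (ρ θ φ : C(Torus, ℝ)) (a : Option (Fin 3)) : C(Torus, ℝ) :=
  nem (stateFun p a) ![ρ, θ, φ]

lemma isOpen_posDensity : IsOpen posDensity := isOpen_lt continuous_const (continuous_apply 0)

lemma contDiff_direction (i : Fin 3) :
    ContDiff ℝ ∞ (fun y : Fin 3 → ℝ => direction (y 1) (y 2) i) := by
  have h1 : ContDiff ℝ ∞ fun y : Fin 3 → ℝ => y 1 := contDiff_apply ℝ ℝ 1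
  have h2 : ContDiff ℝ ∞ fun y : Fin 3 → ℝ => y 2 := contDiff_apply ℝ ℝ 2
  fin_cases i
  · exact h1.sin.mul h2.cos
  · exact h1.sin.mul h2.sin
  · exact h1.cos

lemma sum_direction_sq (θ φ : ℝ) : ∑ i, direction θ φ i ^ 2 = 1 := by
  simp only [Fin.sum_univ_three, direction, Matrix.cons_val_zero, Matrix.cons_val_one,
    Matrix.cons_val]
  linear_combination Real.sin_sq_add_cos_sq θ +
    Real.sin θ ^ 2 * Real.sin_sq_add_cos_sq φ

section State
variable {p : ℝ → ℝ} {ρ θ φ : C(Torus, ℝ)} {m c : ℝ} {q : ℝ → ℝ}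

lemma contDiffOn_stateFun (hp : ContDiffOn ℝ ∞ p (Ioi 0)) (hp' : ∀ r, 0 < r → 0 < deriv p r)
    (a : Option (Fin 3)) : ContDiffOn ℝ ∞ (stateFun p a) posDensity := by
  rcases a with _ | i
  · exact (contDiffOn_potential hp hp').comp (contDiff_apply ℝ ℝ (0 : Fin 3)).contDiffOn
      fun y hy => hy
  · exact (contDiff_direction i).contDiffOn

lemma mem_adm_posDensity (hpos : ∀ x, 0 < ρ x) : ![ρ, θ, φ] ∈ Adm posDensity := hpos

lemma state_none_apply (hp : ContDiffOn ℝ ∞ p (Ioi 0)) (hp' : ∀ r, 0 < r → 0 < deriv p r)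
    (hpos : ∀ x, 0 < ρ x) (x : Torus) : state p ρ θ φ none x = potential p (ρ x) :=
  nem_apply (contDiffOn_stateFun hp hp' none).continuousOn (mem_adm_posDensity hpos) x

lemma state_some_apply (i : Fin 3) (x : Torus) :
    state p ρ θ φ (some i) x = directionField θ φ x i :=
  nem_apply (U := univ) (contDiff_direction i).continuous.continuousOn (fun _ => mem_univ _) x

lemma hasPDeriv_state (hp : ContDiffOn ℝ ∞ p (Ioi 0)) (hp' : ∀ r, 0 < r → 0 < deriv p r)
    (hm : 5 / 2 < m) (hρ : MemH m ρ) (hθ : MemH m θ) (hφ : MemH m φ) (hpos : ∀ x, 0 < ρ x)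
    (j : Fin 3) (a : Option (Fin 3)) :
    HasPDeriv j (state p ρ θ φ a) (D j (state p ρ θ φ a)) := by
  refine (hasPDeriv_nem isOpen_posDensity (contDiffOn_stateFun hp hp' a)
    (mem_adm_posDensity hpos) (u' := ![D j ρ, D j θ, D j φ]) fun b => ?_).hasPDeriv_D
  fin_cases b
  · exact hρ.hasPDeriv hm j
  · exact hθ.hasPDeriv hm j
  · exact hφ.hasPDeriv hm j

lemma D_state_none (hp : ContDiffOn ℝ ∞ p (Ioi 0)) (hp' : ∀ r, 0 < r → 0 < deriv p r)
    (hm : 5 / 2 < m) (hρ : MemH m ρ) (hθ : MemH m θ) (hφ : MemH m φ) (hpos : ∀ x, 0 < ρ x)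
    (j : Fin 3) (x : Torus) :
    D j (state p ρ θ φ none) x = √(deriv p (ρ x)) / ρ x * D j ρ x := by
  refine (hasPDeriv_state hp hp' hm hρ hθ hφ hpos j none x).unique ?_
  simp only [state_none_apply hp hp' hpos]
  have h1 := hρ.hasPDeriv hm j x
  refine HasDerivAt.comp (0 : ℝ) (h₂ := potential p) ?_ h1
  rw [QuotientAddGroup.mk_zero, Pi.single_zero, add_zero]
  exact hasDerivAt_potential hp hp' (hpos x)

/-- The derivative of `|Ω|² = 1`; it supplies the hypothesis `hn` of `mass_iff`. -/
lemma sum_state_mul_D_state (hp : ContDiffOn ℝ ∞ p (Ioi 0)) (hp' : ∀ r, 0 < r → 0 < deriv p r)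
    (hm : 5 / 2 < m) (hρ : MemH m ρ) (hθ : MemH m θ) (hφ : MemH m φ) (hpos : ∀ x, 0 < ρ x)
    (j : Fin 3) (x : Torus) :
    ∑ i, directionField θ φ x i * D j (state p ρ θ φ (some i)) x = 0 := by
  have h1 : HasDerivAt (fun r : ℝ => ∑ i, state p ρ θ φ (some i)
      (x + Pi.single j (r : UnitAddCircle)) ^ 2) (∑ i, 2 * directionField θ φ x i *
        D j (state p ρ θ φ (some i)) x) 0 := by
    refine HasDerivAt.fun_sum fun i _ => ?_
    have := (hasPDeriv_state hp hp' hm hρ hθ hφ hpos j (some i) x).fun_pow 2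
    rw [QuotientAddGroup.mk_zero, Pi.single_zero, add_zero] at this
    rw [← state_some_apply (p := p) (ρ := ρ)]
    simpa using this
  simp only [state_some_apply, directionField, sum_direction_sq] at h1
  have h2 := h1.unique (hasDerivAt_const (0 : ℝ) (1 : ℝ))
  simp only [mul_assoc, ← Finset.mul_sum] at h2
  simpa [directionField] using h2

lemma mass_iff_symmetric (hp : ContDiffOn ℝ ∞ p (Ioi 0)) (hp' : ∀ r, 0 < r → 0 < deriv p r)
    (hm : 5 / 2 < m) (hρ : MemH m ρ) (hθ : MemH m θ) (hφ : MemH m φ) (hpos : ∀ x, 0 < ρ x)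
    {x : Torus} (hq : q (potential p (ρ x)) = √(deriv p (ρ x))) (rt : ℝ) :
    rt + divergence (fun y => ρ y • directionField θ φ y) x = 0 ↔
      √(deriv p (ρ x)) / ρ x * rt + ∑ j, ∑ b, symA c q j none b (ev (state p ρ θ φ) x) *
        D j (state p ρ θ φ b) x = 0 := by
  rw [← mass_iff (hpos x) (Real.sqrt_pos.2 (hp' _ (hpos x))) (n := directionField θ φ x)
    (dr := fun j => D j ρ x) (dn := fun j i => D j (state p ρ θ φ (some i)) x)
    (dy := fun j b => D j (state p ρ θ φ b) x)
    (by rw [ev, state_none_apply hp hp' hpos, hq]) (fun i => state_some_apply i x)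
    (fun j => D_state_none hp hp' hm hρ hθ hφ hpos j x) (fun j i => rfl)
    (fun j => sum_state_mul_D_state hp hp' hm hρ hθ hφ hpos j x)]
  have h : divergence (fun y => ρ y • directionField θ φ y) x = ∑ j, (D j ρ x *
      directionField θ φ x j + ρ x * D j (state p ρ θ φ (some j)) x) := by
    refine Finset.sum_congr rfl fun j _ => ?_
    have e : (fun y => (ρ y • directionField θ φ y) j) = ⇑(ρ * state p ρ θ φ (some j)) := by
      ext y
      rw [Pi.smul_apply, smul_eq_mul, ContinuousMap.mul_apply, state_some_apply]
    rw [e, ((hρ.hasPDeriv hm j).mul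
      (hasPDeriv_state hp hp' hm hρ hθ hφ hpos j (some j))).pderiv_eq x]
    rw [← state_some_apply (p := p) (ρ := ρ)]
    rfl
  rw [h]

lemma momentum_iff_symmetric (hp : ContDiffOn ℝ ∞ p (Ioi 0)) (hp' : ∀ r, 0 < r → 0 < deriv p r)
    (hm : 5 / 2 < m) (hρ : MemH m ρ) (hθ : MemH m θ) (hφ : MemH m φ) (hpos : ∀ x, 0 < ρ x)
    {x : Torus} (hq : q (potential p (ρ x)) = √(deriv p (ρ x))) (nt : Fin 3 → ℝ) :
    ρ x • (nt + c • advect (directionField θ φ x) (directionField θ φ) x)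
        + projPerp (directionField θ φ x) (grad (fun y => p (ρ y)) x) = 0 ↔
      ∀ i, nt i + ∑ j, ∑ b, symA c q j (some i) b (ev (state p ρ θ φ) x) *
        D j (state p ρ θ φ b) x = 0 := by
  rw [← momentum_iff (hpos x) (s := √(deriv p (ρ x))) (n := directionField θ φ x)
    (dr := fun j => D j ρ x) (dn := fun j i => D j (state p ρ θ φ (some i)) x)
    (dy := fun j b => D j (state p ρ θ φ b) x)
    (by rw [ev, state_none_apply hp hp' hpos, hq]) (fun i => state_some_apply i x)
    (fun j => D_state_none hp hp' hm hρ hθ hφ hpos j x) (fun j i => rfl)]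
  have h1 : advect (directionField θ φ x) (directionField θ φ) x =
      ∑ j, directionField θ φ x j • fun i => D j (state p ρ θ φ (some i)) x := by
    refine Finset.sum_congr rfl fun j _ => ?_
    congr 1
    refine (hasDerivAt_pi.2 fun i => ?_).deriv
    simpa only [state_some_apply] using hasPDeriv_state hp hp' hm hρ hθ hφ hpos j (some i) x
  have h2 : grad (fun y => p (ρ y)) x = fun j => √(deriv p (ρ x)) ^ 2 * D j ρ x := by
    funext j
    rw [Real.sq_sqrt (hp' _ (hpos x)).le]
    refine (HasDerivAt.comp (0 : ℝ) (h₂ := p) ?_ (hρ.hasPDeriv hm j x)).deriv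
    rw [QuotientAddGroup.mk_zero, Pi.single_zero, add_zero]
    exact ((hp.contDiffAt (Ioi_mem_nhds (hpos x))).differentiableAt (by simp)).hasDerivAt
  rw [h1, h2]

end State

/-! ### Solutions satisfy the symmetric system; uniqueness -/

lemma absolutelyContinuous_congr {f g : ℝ → ℝ} {a b : ℝ}
    (hf : AbsolutelyContinuousOnInterval f a b) (h : EqOn f g (uIcc a b)) :
    AbsolutelyContinuousOnInterval g a b := by
  rw [absolutelyContinuousOnInterval_iff] at hf ⊢
  intro ε hε
  obtain ⟨δ, hδ, h'⟩ := hf ε hε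
  refine ⟨δ, hδ, fun E hE hEd => lt_of_eq_of_lt (Finset.sum_congr rfl fun i hi => ?_) (h' E hE hEd)⟩
  rw [h (hE.1 i hi).1, h (hE.1 i hi).2]

lemma Bop_apply {ι : Type*} [Fintype ι] {A : Fin 3 → ι → ι → (ι → ℝ) → ℝ}
    (hA : ∀ j a b, Continuous (A j a b)) (v : ι → C(Torus, ℝ)) (a : ι) (x : Torus) :
    Bop A v a x = ∑ j, ∑ b, A j a b (ev v x) * D j (v b) x := by
  simp only [Bop, ContinuousMap.sum_apply, ContinuousMap.mul_apply]
  refine Finset.sum_congr rfl fun j _ => Finset.sum_congr rfl fun b _ => ?_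
  rw [nem_apply (U := univ) (hA j a b).continuousOn fun _ => mem_univ _]

lemma exists_lipschitz_closedBall {ι : Type*} [Fintype ι] {F : (ι → ℝ) → ℝ}
    (hF : ContDiff ℝ ∞ F) (R : ℝ) : ∃ K : ℝ≥0, ∀ y ∈ Metric.closedBall (0 : ι → ℝ) R,
      ∀ z ∈ Metric.closedBall (0 : ι → ℝ) R, |F y - F z| ≤ K * ∑ b, |y b - z b| := by
  obtain ⟨K, hK⟩ := (hF.of_le (by norm_cast) : ContDiff ℝ 1 F).contDiffOn.exists_lipschitzOnWith
    one_ne_zero (convex_closedBall (0 : ι → ℝ) R) (isCompact_closedBall 0 R)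
  refine ⟨K, fun y hy z hz => (hK.dist_le_mul y hy z hz).trans ?_⟩
  gcongr
  exact (dist_pi_le_iff (Finset.sum_nonneg fun _ _ => abs_nonneg _)).2 fun b =>
    Finset.single_le_sum (f := fun b => |y b - z b|) (fun _ _ => abs_nonneg _) (Finset.mem_univ b)

/-- Uniqueness for symmetric hyperbolic systems. -/
lemma eq_of_symmetric_system {ι : Type*} [Fintype ι] [DecidableEq ι]
    {A : Fin 3 → ι → ι → (ι → ℝ) → ℝ} {m : ℝ} (hm : 5 / 2 < m)
    (hA : ∀ j a b, ContDiff ℝ ∞ (A j a b)) (hsym : ∀ j a b, A j a b = A j b a)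
    {T L L' : ℝ} {M M' : ℝ≥0} {u u' : ℝ → ι → C(Torus, ℝ)} (h0 : u 0 = u' 0)
    (hL : ∀ a x, ∀ s ∈ Icc 0 T, ∀ t ∈ Icc 0 T, |u t a x - u s a x| ≤ L * |t - s|)
    (hL' : ∀ a x, ∀ s ∈ Icc 0 T, ∀ t ∈ Icc 0 T, |u' t a x - u' s a x| ≤ L' * |t - s|)
    (hu : ∀ᵐ t ∂volume.restrict (Ioo 0 T), (∀ a, sobolevNormSq m (u t a) ≤ M) ∧
      ∀ a x, HasDerivAt (fun s => u s a x) (-Bop A (u t) a x) t)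
    (hu' : ∀ᵐ t ∂volume.restrict (Ioo 0 T), (∀ a, sobolevNormSq m (u' t a) ≤ M') ∧
      ∀ a x, HasDerivAt (fun s => u' s a x) (-Bop A (u' t) a x) t) :
    ∀ t ∈ Icc 0 T, u t = u' t := by
  have hAc := fun j a b => (hA j a b).continuous
  obtain ⟨R, hR⟩ := exists_norm_le_pi (ι := ι) hm M
  obtain ⟨R', hR'⟩ := exists_norm_le_pi (ι := ι) hm M'
  choose K hK using fun j a b => exists_lipschitz_closedBall (hA j a b) (max (R : ℝ) R')
  choose C₁ hC₁ using fun j a b => exists_sobolev_nem_le hm isOpen_univ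
    (isCompact_closedBall (0 : ι → ℝ) R) (subset_univ _) M (hA j a b).contDiffOn
  choose C₂ hC₂ using fun j a b => exists_abs_D_le hm (C₁ j a b)
  obtain ⟨C₃, hC₃⟩ := exists_abs_D_le hm M'
  set N : ℝ≥0 := ∑ j, ∑ a, ∑ b, C₂ j a b with hN
  set N' : ℝ≥0 := ∑ j, ∑ a, ∑ b, K j a b * C₃ with hN'
  have hle : ∀ (f : Fin 3 → ι → ι → ℝ≥0) j a b, f j a b ≤ ∑ j, ∑ a, ∑ b, f j a b :=
    fun f j a b => ((Finset.single_le_sum (f := f j a) (fun _ _ => zero_le)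
      (Finset.mem_univ b)).trans (Finset.single_le_sum (f := fun a => ∑ b, f j a b)
        (fun _ _ => zero_le) (Finset.mem_univ a))).trans
      (Finset.single_le_sum (f := fun j => ∑ a, ∑ b, f j a b)
        (fun _ _ => zero_le) (Finset.mem_univ j))
  have key := eq_zero_of_symmetric_hyperbolic (T := T) (L := L + L') (C := (N + N' : ℝ≥0))
    (NNReal.coe_nonneg _) (W := fun t a => u t a - u' t a) (fun a x s hs t ht => by
      have h1 := hL a x s hs t ht
      have h2 := hL' a x s hs t ht
      simp only [ContinuousMap.sub_apply]
      rw [show u t a x - u' t a x - (u s a x - u' s a x) =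
        (u t a x - u s a x) - (u' t a x - u' s a x) by ring, add_mul]
      exact (abs_sub _ _).trans (add_le_add h1 h2)) (fun a x => by simp [h0]) (by
    filter_upwards [hu, hu'] with t ⟨hs, hd⟩ ⟨hs', hd'⟩
    have hH : ∀ a, MemH m (u t a) := fun a => (hs a).trans_lt ENNReal.coe_lt_top
    have hH' : ∀ a, MemH m (u' t a) := fun a => (hs' a).trans_lt ENNReal.coe_lt_top
    have hsub : ∀ j a, HasPDeriv j (u t a - u' t a) (D j (u t a) - D j (u' t a)) :=
      fun j a => ((hH a).hasPDeriv hm j).sub ((hH' a).hasPDeriv hm j)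
    have hnem := fun j a b => hC₁ j a b (u t) (hR _ hs) hs
    refine ⟨fun a => -Bop A (u t) a + Bop A (u' t) a, fun j a b => nem (A j a b) (u t),
      fun a x => ?_, fun j a b =>
        congrArg (fun F => nem F (u t)) (hsym j a b), fun j a b => ?_, fun j a b x => ?_,
      fun j a => (hsub j a).hasPDeriv_D, fun a x => ?_⟩
    · have := (hd a x).sub (hd' a x)
      rw [sub_neg_eq_add] at this
      exact this
    · exact MemH.hasPDeriv hm ((hnem j a b).trans_lt ENNReal.coe_lt_top) j
    · refine (hC₂ j a b _ (hnem j a b) j x).trans ?_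
      exact_mod_cast (hle C₂ j a b).trans le_self_add
    -- The difference solves the linear system with coefficients `A(u)` up to the residual `(A(u') -
    -- A(u)) ∂u'`. This is of order zero in `u - u'`, because `A` is Lipschitz on bounded sets and
    -- `∂u'` is bounded.
    · have e : (-Bop A (u t) a + Bop A (u' t) a) x +
          ∑ j, ∑ b, nem (A j a b) (u t) x * D j (u t b - u' t b) x =
          ∑ j, ∑ b, (A j a b (ev (u' t) x) - A j a b (ev (u t) x)) * D j (u' t b) x := by
        rw [ContinuousMap.add_apply, ContinuousMap.neg_apply, Bop_apply hAc, Bop_apply hAc]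
        simp only [(hsub _ _).D_eq, ContinuousMap.sub_apply]
        simp only [nem_apply (U := univ) (hAc _ _ _).continuousOn fun _ => mem_univ _]
        simp only [sub_mul, mul_sub, Finset.sum_sub_distrib]
        ring
      rw [e]
      have hb : ∀ j b, |(A j a b (ev (u' t) x) - A j a b (ev (u t) x)) * D j (u' t b) x| ≤
          (K j a b * C₃ : ℝ) * ∑ b, |u t b x - u' t b x| := fun j b => by
        rw [abs_mul, mul_right_comm]
        have h1 := hK j a b (ev (u t) x)
          (Metric.closedBall_subset_closedBall (le_max_left _ _) (hR _ hs x)) (ev (u' t) x)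
          (Metric.closedBall_subset_closedBall (le_max_right _ _) (hR' _ hs' x))
        rw [abs_sub_comm]
        exact mul_le_mul h1 (hC₃ _ (hs' b) j x) (abs_nonneg _) (by positivity)
      refine (Finset.abs_sum_le_sum_abs _ _).trans ((Finset.sum_le_sum fun j _ =>
        (Finset.abs_sum_le_sum_abs _ _).trans (Finset.sum_le_sum fun b _ => hb j b)).trans ?_)
      simp only [← Finset.sum_mul, ContinuousMap.sub_apply]
      gcongr
      have h1 : ∑ j, ∑ b, K j a b * C₃ ≤ N' := by
        refine Finset.sum_le_sum fun j _ => Finset.single_le_sum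
          (f := fun a => ∑ b, K j a b * C₃) (fun _ _ => zero_le) (Finset.mem_univ a)
      have h2 : ∑ j, ∑ b, K j a b * C₃ ≤ N + N' := h1.trans le_add_self
      simp only [Finset.sum_mul]
      exact_mod_cast h2)
  intro t ht
  funext a
  ext x
  exact sub_eq_zero.1 (key t ht a x)

lemma exists_density_bounds {T : ℝ} (hT : 0 ≤ T) {ρ : ℝ → C(Torus, ℝ)}
    (hc : ContinuousOn ρ (Icc 0 T)) (hpos : ∀ t ∈ Icc 0 T, ∀ x, 0 < ρ t x) :
    ∃ α β : ℝ, 0 < α ∧ ∀ t ∈ Icc 0 T, ∀ x, ρ t x ∈ Icc α β := by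
  obtain ⟨K, hKU, hK, hKv⟩ := exists_compact_adm (v := fun t (_ : Unit) => ρ t) (T := T)
    (U := {y | 0 < y ()}) (fun _ => hc) hpos
  have hne : K.Nonempty := ⟨_, hKv 0 ⟨le_rfl, hT⟩ 0⟩
  have hc' : ContinuousOn (fun y : Unit → ℝ => y ()) K := (continuous_apply ()).continuousOn
  obtain ⟨y, hy, hy'⟩ := hK.exists_isMinOn hne hc'
  obtain ⟨z, hz, hz'⟩ := hK.exists_isMaxOn hne hc'
  exact ⟨y (), z (), hKU hy, fun t ht x => ⟨hy' (hKv t ht x), hz' (hKv t ht x)⟩⟩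

section Uniqueness
variable {p : ℝ → ℝ} {m c T : ℝ} {q : ℝ → ℝ}
  {ρ₀ θ₀ φ₀ : C(Torus, ℝ)} {ρ θ φ : ℝ → C(Torus, ℝ)}

/-- Density and angles are absolutely continuous at each point, and Lipschitz functions preserve
this. The potential is Lipschitz only on compact subsets of `(0, ∞)`, so bounds on the density
enter. -/
lemma IsSolution.absolutelyContinuous_state (hp : ContDiffOn ℝ ∞ p (Ioi 0))
    (hp' : ∀ r, 0 < r → 0 < deriv p r) (hm : 5 / 2 < m) (hT : 0 < T)
    (h : IsSolution c p m T ρ₀ θ₀ φ₀ ρ θ φ) (a : Option (Fin 3)) (x : Torus) :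
    AbsolutelyContinuousOnInterval (fun t => state p (ρ t) (θ t) (φ t) a x) 0 T := by
  have hac : ∀ {w}, InSolutionClass T m w →
      AbsolutelyContinuousOnInterval (fun t => w t x) 0 T := fun hw =>
    hw.2.2.absolutelyContinuous hT (by linarith) hw.1 x
  rcases a with _ | i
  · obtain ⟨α, β, hα, hρ⟩ := exists_density_bounds hT.le h.class_density.1 h.pos
    obtain ⟨K, hK⟩ := (((contDiffOn_potential hp hp').mono fun r (hr : r ∈ Icc α β) =>
      hα.trans_le hr.1).of_le (by norm_cast) : ContDiffOn ℝ 1 _ _).exists_lipschitzOnWith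
        one_ne_zero (convex_Icc _ _) isCompact_Icc
    refine absolutelyContinuous_congr (absolutelyContinuous_comp_lipschitzOn
      (hac h.class_density) hK fun t ht => ?_) fun t ht => ?_
    · rw [uIcc_of_le hT.le] at ht; exact hρ t ht x
    · rw [uIcc_of_le hT.le] at ht; exact (state_none_apply hp hp' (h.pos t ht) x).symm
  · have hs : ∀ {w}, InSolutionClass T m w →
        AbsolutelyContinuousOnInterval (fun t => Real.sin (w t x)) 0 T := fun hw =>
      absolutelyContinuous_comp_lipschitzOn (hac hw) (Real.lipschitzWith_sin.lipschitzOnWith)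
        (mapsTo_univ _ _)
    have hc : ∀ {w}, InSolutionClass T m w →
        AbsolutelyContinuousOnInterval (fun t => Real.cos (w t x)) 0 T := fun hw =>
      absolutelyContinuous_comp_lipschitzOn (hac hw) (Real.lipschitzWith_cos.lipschitzOnWith)
        (mapsTo_univ _ _)
    simp only [state_some_apply]
    fin_cases i
    · exact (hs h.class_theta).fun_mul (hc h.class_phi)
    · exact (hs h.class_theta).fun_mul (hs h.class_phi)
    · exact hc h.class_theta

/-- A solution of the system gives a solution of its symmetric form. -/
lemma IsSolution.symmetric (hp : ContDiffOn ℝ ∞ p (Ioi 0))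
    (hp' : ∀ r, 0 < r → 0 < deriv p r) (hm : 5 / 2 < m) (hT : 0 < T)
    (h : IsSolution c p m T ρ₀ θ₀ φ₀ ρ θ φ) (hqc : ContDiff ℝ ∞ q)
    (hq : ∀ t ∈ Icc 0 T, ∀ x, q (potential p (ρ t x)) = √(deriv p (ρ t x))) :
    ∃ (M : ℝ≥0) (L : ℝ),
      (∀ a x, ∀ s ∈ Icc 0 T, ∀ t ∈ Icc 0 T, |state p (ρ t) (θ t) (φ t) a x -
        state p (ρ s) (θ s) (φ s) a x| ≤ L * |t - s|) ∧
      ∀ᵐ t ∂volume.restrict (Ioo 0 T),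
        (∀ a, sobolevNormSq m (state p (ρ t) (θ t) (φ t) a) ≤ M) ∧
        ∀ a x, HasDerivAt (fun s => state p (ρ s) (θ s) (φ s) a x)
          (-Bop (symA c q) (state p (ρ t) (θ t) (φ t)) a x) t := by
  have hA := fun j a b => contDiff_symA c hqc j a b
  obtain ⟨-, ⟨-, M₁, hM₁⟩, -⟩ := h.class_density
  obtain ⟨-, ⟨-, M₂, hM₂⟩, -⟩ := h.class_theta
  obtain ⟨-, ⟨-, M₃, hM₃⟩, -⟩ := h.class_phi
  obtain ⟨K, hKU, hK, hKv⟩ := exists_compact_adm (v := fun t => ![ρ t, θ t, φ t]) (T := T)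
    (U := posDensity) (fun a => by
      fin_cases a
      · exact h.class_density.1
      · exact h.class_theta.1
      · exact h.class_phi.1) (fun t ht => mem_adm_posDensity (h.pos t ht))
  choose C hC using fun a => exists_sobolev_nem_le hm isOpen_posDensity hK hKU (M₁ + M₂ + M₃)
    (contDiffOn_stateFun hp hp' a)
  obtain ⟨L, hL⟩ := exists_norm_Bop_le hm hA (∑ a, C a)
  have key : ∀ᵐ t ∂volume.restrict (Ioo 0 T),
        (∀ a, sobolevNormSq m (state p (ρ t) (θ t) (φ t) a) ≤ (∑ a, C a : ℝ≥0)) ∧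
        ∀ a x, HasDerivAt (fun s => state p (ρ s) (θ s) (φ s) a x)
          (-Bop (symA c q) (state p (ρ t) (θ t) (φ t)) a x) t := by
    filter_upwards [hM₁, hM₂, hM₃, h.mass, h.momentum, ae_restrict_mem measurableSet_Ioo]
      with t h1 h2 h3 hmass hmom ht
    have ht' := Ioo_subset_Icc_self ht
    have hH : ∀ {f : C(Torus, ℝ)} {N : ℝ≥0}, sobolevNormSq m f ≤ N → MemH m f :=
      fun hf => hf.trans_lt ENNReal.coe_lt_top
    refine ⟨fun a => (hC a _ (hKv t ht') fun b => ?_).trans ?_, fun a x => ?_⟩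
    · fin_cases b
      · refine h1.trans ?_; push_cast; rw [add_assoc]; exact le_self_add
      · refine h2.trans ?_; push_cast; exact le_add_self.trans le_self_add
      · refine h3.trans ?_; push_cast; exact le_add_self
    · exact_mod_cast Finset.single_le_sum (f := C) (fun _ _ => zero_le) (Finset.mem_univ a)
    · rw [Bop_apply fun j a b => (hA j a b).continuous]
      rcases a with _ | i
      · obtain ⟨rt, hrt, he⟩ := hmass x
        rw [mass_iff_symmetric hp hp' hm (hH h1) (hH h2) (hH h3) (h.pos t ht') (hq t ht' x)] at he
        rw [← eq_neg_of_add_eq_zero_left he]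
        refine ((hasDerivAt_potential hp hp' (h.pos t ht' x)).comp t hrt).congr_of_eventuallyEq ?_
        filter_upwards [Icc_mem_nhds ht.1 ht.2] with s hs
        exact state_none_apply hp hp' (h.pos s hs) x
      · obtain ⟨nt, hnt, he⟩ := hmom x
        rw [momentum_iff_symmetric hp hp' hm (hH h1) (hH h2) (hH h3) (h.pos t ht')
          (hq t ht' x)] at he
        rw [← eq_neg_of_add_eq_zero_left (he i)]
        simp only [state_some_apply]
        exact hasDerivAt_pi.1 hnt i
  refine ⟨∑ a, C a, L, fun a x => ?_, key⟩
  -- The class gives only an `L²` bound on the time derivative; the equation improves it to the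
  -- uniform bound `L` on `Bop`.
  refine lipschitz_of_absolutelyContinuous (h.absolutelyContinuous_state hp hp' hm hT a x) ?_
  filter_upwards [key] with t ht
  refine ⟨_, ht.2 a x, ?_⟩
  rw [abs_neg]
  exact ((Bop (symA c q) _ a).norm_coe_le_norm x).trans (hL _ ht.1 a)

lemma pos_of_continuousOn_ne_zero {f : ℝ → ℝ} (hf : ContinuousOn f (Icc 0 T)) (h0 : 0 < f 0)
    (hne : ∀ t ∈ Icc 0 T, f t ≠ 0) : ∀ t ∈ Icc 0 T, 0 < f t := by
  intro t ht
  by_contra h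
  have hsub : Icc 0 t ⊆ Icc 0 T := Icc_subset_Icc_right ht.2
  obtain ⟨s, hs, hs0⟩ := intermediate_value_Icc' ht.1 (hf.mono hsub) ⟨not_lt.1 h, h0.le⟩
  exact hne s (hsub hs) hs0

/-- A nonzero value would be a nonzero multiple of `2π`, so `|d|` would pass through `π`, where the
cosine is `-1`. -/
lemma eq_zero_of_cos_eq_one {d : ℝ → ℝ} (hd : ContinuousOn d (Icc 0 T)) (h0 : d 0 = 0)
    (h1 : ∀ t ∈ Icc 0 T, Real.cos (d t) = 1) : ∀ t ∈ Icc 0 T, d t = 0 := by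
  intro t ht
  by_contra h
  have hsub : Icc 0 t ⊆ Icc 0 T := Icc_subset_Icc_right ht.2
  obtain ⟨n, hn⟩ := (Real.cos_eq_one_iff _).1 (h1 t ht)
  have hn0 : n ≠ 0 := by rintro rfl; simp at hn; exact h hn.symm
  have hn1 : (1 : ℝ) ≤ |(n : ℝ)| := by exact_mod_cast Int.one_le_abs hn0
  have hπ := Real.pi_pos
  have h2 : Real.pi ≤ |d t| := by
    rw [← hn, abs_mul, abs_of_pos (by positivity : 0 < 2 * Real.pi)]
    nlinarith
  obtain ⟨s, hs, hsπ⟩ := intermediate_value_Icc ht.1 (hd.mono hsub).abs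
    ⟨by rw [h0, abs_zero]; exact hπ.le, h2⟩
  have h3 := h1 s (hsub hs)
  rw [← Real.cos_abs, show |d s| = Real.pi from hsπ, Real.cos_pi] at h3
  norm_num at h3

/-- Solutions with the same initial data coincide, if the polar angle of one of them stays away
from the poles. -/
lemma IsSolution.unique {ρ' θ' φ' : ℝ → C(Torus, ℝ)} (hp : ContDiffOn ℝ ∞ p (Ioi 0))
    (hp' : ∀ r, 0 < r → 0 < deriv p r) (hm : 5 / 2 < m) (hT : 0 < T)
    (h : IsSolution c p m T ρ₀ θ₀ φ₀ ρ θ φ) (h' : IsSolution c p m T ρ₀ θ₀ φ₀ ρ' θ' φ')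
    (hsin : ∀ t ∈ Icc 0 T, ∀ x, 0 < Real.sin (θ t x)) :
    ∀ t ∈ Icc 0 T, ρ' t = ρ t ∧ θ' t = θ t ∧ φ' t = φ t := by
  obtain ⟨α, β, hα, hρ⟩ := exists_density_bounds hT.le h.class_density.1 h.pos
  obtain ⟨α', β', hα', hρ'⟩ := exists_density_bounds hT.le h'.class_density.1 h'.pos
  have h0T : (0 : ℝ) ∈ Icc 0 T := ⟨le_rfl, hT.le⟩
  have hαβ : min α α' < max β β' + 1 := by
    have h1 := hρ 0 h0T 0
    have h2 := min_le_left α α'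
    have h3 := le_max_left β β'
    linarith [h1.1, h1.2]
  -- The range of densities covers both solutions, so that they satisfy the same symmetric system.
  obtain ⟨-, q, -, -, -, hqc, hq⟩ := exists_inverse_potential hp hp' (lt_min hα hα') hαβ
  obtain ⟨M, L, hL, hu⟩ := h.symmetric hp hp' hm hT hqc fun t ht x => hq _
    ⟨(min_le_left _ _).trans (hρ t ht x).1,
      ((hρ t ht x).2.trans (le_max_left _ _)).trans (by linarith)⟩
  obtain ⟨M', L', hL', hu'⟩ := h'.symmetric hp hp' hm hT hqc fun t ht x => hq _
    ⟨(min_le_right _ _).trans (hρ' t ht x).1,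
      ((hρ' t ht x).2.trans (le_max_right _ _)).trans (by linarith)⟩
  have key := eq_of_symmetric_system hm (fun j a b => contDiff_symA c hqc j a b)
    (symA_symm c q) (u := fun t => state p (ρ t) (θ t) (φ t))
    (u' := fun t => state p (ρ' t) (θ' t) (φ' t))
    (by simp only [h.init_density, h.init_theta, h.init_phi, h'.init_density, h'.init_theta,
      h'.init_phi]) hL hL' hu hu'
  have hdir : ∀ t ∈ Icc 0 T, ∀ x i, direction (θ t x) (φ t x) i = direction (θ' t x) (φ' t x) i :=
    fun t ht x i => by
      have h1 := congrArg (fun f : C(Torus, ℝ) => f x) (congrFun (key t ht) (some i))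
      simp only [state_some_apply] at h1
      exact h1
  have hev : ∀ {w : ℝ → C(Torus, ℝ)}, InSolutionClass T m w → ∀ x,
      ContinuousOn (fun t => w t x) (Icc 0 T) := fun hw x =>
    (ContinuousMap.evalCLM ℝ x : C(Torus, ℝ) →L[ℝ] ℝ).continuous.comp_continuousOn hw.1
  have hcos : ∀ t ∈ Icc 0 T, ∀ x, Real.cos (θ t x) = Real.cos (θ' t x) :=
    fun t ht x => hdir t ht x 2
  have hsq : ∀ t ∈ Icc 0 T, ∀ x, Real.sin (θ t x) ^ 2 = Real.sin (θ' t x) ^ 2 :=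
    fun t ht x => by rw [Real.sin_sq, Real.sin_sq, hcos t ht x]
  -- Positivity for the second solution is not assumed: its `sin²` equals that of the first, so `sin
  -- θ'` cannot vanish and keeps its initial sign.
  have hsin' : ∀ t ∈ Icc 0 T, ∀ x, 0 < Real.sin (θ' t x) := fun t ht x => by
    refine pos_of_continuousOn_ne_zero (T := T) (f := fun t => Real.sin (θ' t x))
      (Real.continuous_sin.comp_continuousOn (hev h'.class_theta x)) ?_ (fun s hs h0 => ?_) t ht
    · have := hsin 0 h0T x
      rwa [h.init_theta, ← h'.init_theta] at this
    · have h1 := hsq s hs x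
      rw [h0] at h1
      have h2 := hsin s hs x
      nlinarith
  have hss : ∀ t ∈ Icc 0 T, ∀ x, Real.sin (θ t x) = Real.sin (θ' t x) := fun t ht x =>
    (pow_left_inj₀ (hsin t ht x).le (hsin' t ht x).le two_ne_zero).1 (hsq t ht x)
  have hφc : ∀ t ∈ Icc 0 T, ∀ x, Real.cos (φ t x) = Real.cos (φ' t x) := fun t ht x => by
    have h1 : Real.sin (θ t x) * Real.cos (φ t x) = Real.sin (θ' t x) * Real.cos (φ' t x) :=
      hdir t ht x 0
    rw [← hss t ht x] at h1
    exact mul_left_cancel₀ (hsin t ht x).ne' h1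
  have hφs : ∀ t ∈ Icc 0 T, ∀ x, Real.sin (φ t x) = Real.sin (φ' t x) := fun t ht x => by
    have h1 : Real.sin (θ t x) * Real.sin (φ t x) = Real.sin (θ' t x) * Real.sin (φ' t x) :=
      hdir t ht x 1
    rw [← hss t ht x] at h1
    exact mul_left_cancel₀ (hsin t ht x).ne' h1
  intro t ht
  refine ⟨?_, ?_, ?_⟩ <;> ext x
  · have h1 := congrArg (fun f : C(Torus, ℝ) => f x) (congrFun (key t ht) none)
    simp only [state_none_apply hp hp' (h.pos t ht), state_none_apply hp hp' (h'.pos t ht)] at h1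
    exact ((strictMonoOn_potential hp hp').injOn (h.pos t ht x) (h'.pos t ht x) h1).symm
  · refine sub_eq_zero.1 (eq_zero_of_cos_eq_one (T := T) (d := fun t => θ' t x - θ t x)
      ((hev h'.class_theta x).sub (hev h.class_theta x)) ?_ (fun s hs => ?_) t ht)
    · rw [h.init_theta, h'.init_theta, sub_self]
    · rw [Real.cos_sub, ← hcos s hs x, ← hss s hs x, ← sq, ← sq, Real.cos_sq_add_sin_sq]
  · refine sub_eq_zero.1 (eq_zero_of_cos_eq_one (T := T) (d := fun t => φ' t x - φ t x)
      ((hev h'.class_phi x).sub (hev h.class_phi x)) ?_ (fun s hs => ?_) t ht)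
    · rw [h.init_phi, h'.init_phi, sub_self]
    · rw [Real.cos_sub, ← hφc s hs x, ← hφs s hs x, ← sq, ← sq, Real.cos_sq_add_sin_sq]

end Uniqueness

/-! ### Existence -/

lemma memH_nem {ι : Type*} [Fintype ι] [DecidableEq ι] {U : Set (ι → ℝ)} {m : ℝ}
    (hm : 5 / 2 < m) {F : (ι → ℝ) → ℝ} (hU : IsOpen U) (hF : ContDiffOn ℝ ∞ F U)
    {u : ι → C(Torus, ℝ)} (hu : u ∈ Adm U) (hH : ∀ a, MemH m (u a)) : MemH m (nem F u) := by
  -- A single family is treated as a constant curve on the degenerate interval `[0, 0]`.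
  obtain ⟨K, hKU, hK, hKv⟩ := exists_compact_adm (v := fun _ => u) (T := 0) (U := U)
    (fun _ => continuousOn_const) fun _ _ => hu
  obtain ⟨C, hC⟩ := exists_sobolev_nem_le hm hU hK hKU
    (∑ a, (sobolevNormSq m (u a)).toNNReal) hF
  refine (hC u (hKv 0 (by simp)) fun a => ?_).trans_lt ENNReal.coe_lt_top
  rw [← ENNReal.coe_toNNReal (hH a).ne]
  exact_mod_cast Finset.single_le_sum (f := fun a => (sobolevNormSq m (u a)).toNNReal)
    (fun _ _ => zero_le) (Finset.mem_univ a)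

lemma exists_sobolev_Bop_le {ι : Type*} [Fintype ι] [DecidableEq ι]
    {A : Fin 3 → ι → ι → (ι → ℝ) → ℝ} {m : ℝ} (hm : 5 / 2 < m)
    (hA : ∀ j a b, ContDiff ℝ ∞ (A j a b)) (M : ℝ≥0) :
    ∃ C : ℝ≥0, ∀ v : ι → C(Torus, ℝ), (∀ a, sobolevNormSq m (v a) ≤ M) →
      ∀ a, sobolevNormSq (m - 1) (Bop A v a) ≤ C := by
  obtain ⟨R, hR⟩ := exists_norm_le_pi (ι := ι) hm M
  obtain ⟨M', hM'⟩ := exists_sobolev_D_le hm M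
  choose C₁ hC₁ using fun j a b => exists_sobolev_nem_le hm isOpen_univ
    (isCompact_closedBall (0 : ι → ℝ) R) (subset_univ _) M (hA j a b).contDiffOn
  obtain ⟨C₂, hC₂⟩ := sobolev_mul (by linarith : 0 ≤ m - 1) (by linarith : m - 1 ≤ m)
    (by linarith)
  refine ⟨∑ a, 2 ^ 3 * ∑ j, 2 ^ Fintype.card ι * ∑ b, C₂ * C₁ j a b * M', fun v hv a => ?_⟩
  have h1 : sobolevNormSq (m - 1) (Bop A v a) ≤
      (2 ^ 3 * ∑ j, 2 ^ Fintype.card ι * ∑ b, C₂ * C₁ j a b * M' : ℝ≥0) := by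
    refine (sobolevNormSq_sum_le _ _ _).trans ?_
    push_cast
    rw [Finset.card_univ, Fintype.card_fin]
    gcongr with j
    refine (sobolevNormSq_sum_le _ _ _).trans ?_
    rw [Finset.card_univ]
    gcongr with b
    have h2 := hC₁ j a b v (hR v hv) hv
    refine (hC₂ _ _ (h2.trans_lt ENNReal.coe_lt_top)).trans ?_
    gcongr
    exact hM' _ (hv b) j
  refine h1.trans ?_
  exact ENNReal.coe_le_coe.2 (Finset.single_le_sum
    (f := fun a => (2 ^ 3 * ∑ j, 2 ^ Fintype.card ι * ∑ b, C₂ * C₁ j a b * M' : ℝ≥0))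
    (fun _ _ => zero_le) (Finset.mem_univ a))

lemma HasPDeriv.const {j : Fin 3} (f : C(Torus, ℝ)) {r : ℝ} (h : ∀ x, f x = r) :
    HasPDeriv j f 0 := fun x => by
  simp only [h]; exact hasDerivAt_const _ _

/-- The constraint `|Ω| = 1` is preserved by the symmetric system. -/
lemma sum_sq_eq_one_of_symmetric {c m T : ℝ} {q : ℝ → ℝ} {M : ℝ≥0} (hm : 5 / 2 < m)
    (hq : ContDiff ℝ ∞ q) {u : ℝ → Option (Fin 3) → C(Torus, ℝ)}
    (hM : ∀ t ∈ Icc 0 T, ∀ a, sobolevNormSq m (u t a) ≤ M)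
    (hd : ∀ t ∈ Icc 0 T, ∀ a, HasDerivWithinAt (fun t => u t a) (-Bop (symA c q) (u t) a)
      (Icc 0 T) t)
    (h0 : ∀ x, ∑ i, u 0 (some i) x ^ 2 = 1) :
    ∀ t ∈ Icc 0 T, ∀ x, ∑ i, u t (some i) x ^ 2 = 1 := by
  have hA := fun j a b => contDiff_symA c hq j a b
  obtain ⟨R, hR⟩ := exists_norm_le (by linarith : 3 / 2 < m) M
  obtain ⟨L, hL⟩ := exists_norm_Bop_le hm hA M
  obtain ⟨C₁, hC₁⟩ := exists_abs_D_le hm M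
  obtain ⟨Q, hQ⟩ := (isCompact_Icc (a := -(R : ℝ)) (b := R)).exists_bound_of_continuousOn
    hq.continuous.continuousOn
  have hQ0 : 0 ≤ Q := (norm_nonneg _).trans (hQ 0 ⟨by simp, by simp⟩)
  have hRx : ∀ t ∈ Icc 0 T, ∀ a x, |u t a x| ≤ R := fun t ht a x =>
    ((u t a).norm_coe_le_norm x).trans (hR _ (hM t ht a))
  set w : ℝ → Unit → C(Torus, ℝ) := fun t _ => ∑ i, u t (some i) * u t (some i) - 1 with hw
  have hwx : ∀ t x, w t () x = ∑ i, u t (some i) x ^ 2 - 1 := fun t x => by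
    simp [hw, sq]
  have hwd : ∀ t ∈ Icc 0 T, ∀ x, HasDerivWithinAt (fun t => w t () x)
      (∑ i, 2 * u t (some i) x * (-Bop (symA c q) (u t) (some i) x)) (Icc 0 T) t := by
    intro t ht x
    simp only [hwx]
    refine HasDerivWithinAt.sub_const _ (HasDerivWithinAt.fun_sum fun i _ => ?_)
    have h1 : HasDerivWithinAt (fun t => u t (some i) x) (-Bop (symA c q) (u t) (some i) x)
        (Icc 0 T) t :=
      (ContinuousMap.evalCLM ℝ x : C(Torus, ℝ) →L[ℝ] ℝ).hasFDerivAt.comp_hasDerivWithinAt t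
        (hd t ht (some i))
    simpa using h1.fun_pow 2
  -- A scalar equation for `|Ω|² - 1`. In the constant, `|c| C₁` bounds the derivatives of the
  -- velocity `c Ω`, and the other term bounds the coefficient of order zero.
  have key := eq_zero_of_symmetric_hyperbolic (T := T) (κ := Unit) (W := w)
    (L := ∑ _i : Fin 3, 2 * R * L) (C := |c| * C₁ + 2 * Q * ∑ _j : Fin 3, (R : ℝ) * C₁)
    (by positivity) (fun _ x s hs t ht => by
      refine (convex_Icc 0 T).norm_image_sub_le_of_norm_hasDerivWithin_le
        (fun r hr => hwd r hr x) (fun r hr => ?_) hs ht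
      refine (norm_sum_le _ _).trans (Finset.sum_le_sum fun i _ => ?_)
      rw [norm_mul, norm_mul, norm_neg, Real.norm_ofNat]
      have h1 := hRx r hr (some i) x
      have h2 := ((Bop (symA c q) (u r) (some i)).norm_coe_le_norm x).trans (hL _ (hM r hr) _)
      rw [← Real.norm_eq_abs] at h1
      gcongr) (fun _ x => by rw [hwx, h0 x, sub_self]) (by
    refine ae_restrict_of_forall_mem measurableSet_Ioo fun t ht => ?_
    have ht' := Ioo_subset_Icc_self ht
    have hP : ∀ j a, HasPDeriv j (u t a) (D j (u t a)) := fun j a =>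
      MemH.hasPDeriv hm ((hM t ht' a).trans_lt ENNReal.coe_lt_top) j
    have hPw : ∀ j, HasPDeriv j (w t ()) (∑ i, (D j (u t (some i)) * u t (some i) +
        u t (some i) * D j (u t (some i))) - 0) := fun j =>
      (HasPDeriv.sum fun i _ => (hP j (some i)).mul (hP j (some i))).sub
        (HasPDeriv.const 1 (r := 1) fun _ => rfl)
    have hPB : ∀ j, HasPDeriv j (c • u t (some j)) (c • D j (u t (some j))) := fun j x =>
      (hP j (some j) x).const_mul c
    refine ⟨fun _ => ∑ i, (2 : ℝ) • (u t (some i) * -Bop (symA c q) (u t) (some i)),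
      fun j _ _ => c • u t (some j), fun _ x => ?_, fun _ _ _ => rfl,
      fun j _ _ => (hPB j).hasPDeriv_D, fun j _ _ x => ?_, fun j _ => (hPw j).hasPDeriv_D,
      fun _ x => ?_⟩
    · refine ((hwd t ht' x).hasDerivAt (Icc_mem_nhds ht.1 ht.2)).congr_deriv ?_
      rw [ContinuousMap.sum_apply]
      refine Finset.sum_congr rfl fun i _ => ?_
      simp [mul_assoc]
    · rw [(hPB j).D_eq, ContinuousMap.smul_apply, smul_eq_mul, abs_mul]
      refine (mul_le_mul_of_nonneg_left (hC₁ _ (hM t ht' _) j x) (abs_nonneg c)).trans ?_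
      have : 0 ≤ 2 * Q * ∑ _j : Fin 3, (R : ℝ) * C₁ := by positivity
      linarith
    -- With `w = |Ω|² - 1` this is `∂ₜw + c Ω·∇w = 2 q (Ω·∇σ) w`: the projection-like matrix sends
    -- `Ω` to `(1 - |Ω|²) Ω`, so the pressure term is itself a multiple of `w`.
    · have e : (∑ i, (2 : ℝ) • (u t (some i) * -Bop (symA c q) (u t) (some i))) x +
          ∑ j, ∑ _b : Unit, (c • u t (some j)) x * D j (w t ()) x =
          2 * q (u t none x) * (∑ j, u t (some j) x * D j (u t none) x) * w t () x := by
        simp only [ContinuousMap.smul_apply, ContinuousMap.mul_apply,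
          ContinuousMap.neg_apply, Bop_apply fun j a b => (hA j a b).continuous, (hPw _).D_eq,
          ContinuousMap.sub_apply, ContinuousMap.add_apply, hwx, Finset.univ_unique,
          Finset.sum_singleton, ContinuousMap.zero_apply, smul_eq_mul, Fintype.sum_option, symA,
          ev, Fin.sum_univ_three]
        simp
        ring
      rw [e, abs_mul, show ∑ b, |w t b x| = |w t () x| from Fintype.sum_unique _]
      refine mul_le_mul_of_nonneg_right ?_ (abs_nonneg _)
      rw [abs_mul, abs_mul, abs_two]
      have h1 : |q (u t none x)| ≤ Q := hQ _ (abs_le.1 (hRx t ht' none x))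
      have h2 : |∑ j, u t (some j) x * D j (u t none) x| ≤ ∑ _j : Fin 3, (R : ℝ) * C₁ := by
        refine (Finset.abs_sum_le_sum_abs _ _).trans (Finset.sum_le_sum fun j _ => ?_)
        rw [abs_mul]
        exact mul_le_mul (hRx t ht' _ x) (hC₁ _ (hM t ht' _) j x) (abs_nonneg _) R.2
      have h3 : 0 ≤ |c| * C₁ := by positivity
      have h4 : 2 * |q (u t none x)| * |∑ j, u t (some j) x * D j (u t none) x| ≤
        2 * Q * ∑ _j : Fin 3, (R : ℝ) * C₁ := by gcongr
      linarith)
  intro t ht x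
  have := key t ht () x
  rw [hwx] at this
  linarith

/-! ### Recovering density and angles -/

/-- The polar angle near `θ₀` of a direction `Ω`, as a function of `(σ, Ω)` and the reference
angles `(θ₀, φ₀)`. -/
def recTheta (y : Option (Fin 3) ⊕ Fin 2 → ℝ) : ℝ :=
  y (.inr 0) + (Real.arccos (y (.inl (some 2))) - Real.arccos (Real.cos (y (.inr 0))))

/-- The azimuth near `φ₀` of a direction `Ω`, as a function of `(σ, Ω)` and the reference
angles `(θ₀, φ₀)`. -/
def recPhi (y : Option (Fin 3) ⊕ Fin 2 → ℝ) : ℝ :=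
  y (.inr 1) + Real.arctan
    ((y (.inl (some 1)) * Real.cos (y (.inr 1)) - y (.inl (some 0)) * Real.sin (y (.inr 1))) /
     (y (.inl (some 0)) * Real.cos (y (.inr 1)) + y (.inl (some 1)) * Real.sin (y (.inr 1))))

/-- The values for which density and angles can be recovered, if the potential is to lie in
`(a, b)`. -/
def recDomain (a b : ℝ) : Set (Option (Fin 3) ⊕ Fin 2 → ℝ) :=
  {y | y (.inl none) ∈ Ioo a b ∧ y (.inl (some 2)) ∈ Ioo (-1) 1 ∧
    Real.cos (y (.inr 0)) ∈ Ioo (-1) 1 ∧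
    0 < y (.inl (some 0)) * Real.cos (y (.inr 1)) + y (.inl (some 1)) * Real.sin (y (.inr 1))}

lemma isOpen_recDomain (a b : ℝ) : IsOpen (recDomain a b) := by
  have hy : ∀ d : Option (Fin 3) ⊕ Fin 2, Continuous fun y : Option (Fin 3) ⊕ Fin 2 → ℝ => y d :=
    continuous_apply
  have h4 : IsOpen {y : Option (Fin 3) ⊕ Fin 2 → ℝ | 0 < y (.inl (some 0)) *
      Real.cos (y (.inr 1)) + y (.inl (some 1)) * Real.sin (y (.inr 1))} :=
    isOpen_lt continuous_const (((hy _).mul (Real.continuous_cos.comp (hy _))).add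
      ((hy _).mul (Real.continuous_sin.comp (hy _))))
  exact (isOpen_Ioo.preimage (hy _)).inter ((isOpen_Ioo.preimage (hy _)).inter
    ((isOpen_Ioo.preimage (Real.continuous_cos.comp (hy _))).inter h4))

lemma contDiffOn_recTheta (a b : ℝ) : ContDiffOn ℝ ∞ recTheta (recDomain a b) := by
  have hy : ∀ d : Option (Fin 3) ⊕ Fin 2,
      ContDiff ℝ ∞ fun y : Option (Fin 3) ⊕ Fin 2 → ℝ => y d := fun d => contDiff_apply ℝ ℝ d
  intro y ⟨_, h1, h2, _⟩
  refine ContDiffAt.contDiffWithinAt ((hy _).contDiffAt.add (ContDiffAt.sub ?_ ?_))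
  · exact ContDiffAt.comp (g := Real.arccos) y (Real.contDiffAt_arccos h1.1.ne' h1.2.ne) (hy _).contDiffAt
  · exact ContDiffAt.comp (g := Real.arccos) y (Real.contDiffAt_arccos h2.1.ne' h2.2.ne) (hy _).cos.contDiffAt

lemma contDiffOn_recPhi (a b : ℝ) : ContDiffOn ℝ ∞ recPhi (recDomain a b) := by
  have hy : ∀ d : Option (Fin 3) ⊕ Fin 2,
      ContDiff ℝ ∞ fun y : Option (Fin 3) ⊕ Fin 2 → ℝ => y d := fun d => contDiff_apply ℝ ℝ d
  refine (hy _).contDiffOn.add (Real.contDiff_arctan.comp_contDiffOn (ContDiffOn.div ?_ ?_ ?_))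
  · exact (((hy _).mul (hy _).cos).sub ((hy _).mul (hy _).sin)).contDiffOn
  · exact (((hy _).mul (hy _).cos).add ((hy _).mul (hy _).sin)).contDiffOn
  · exact fun y hy => hy.2.2.2.ne'

/-- As `sin θ₀ > 0`, the offset `θ₀ - arccos (cos θ₀)` has cosine one and sine zero. It only records
the branch of the reference angle, which need not lie in `(0, π)`. -/
lemma sin_cos_recTheta {y : Option (Fin 3) ⊕ Fin 2 → ℝ} (hs : 0 < Real.sin (y (.inr 0)))
    (h : y (.inl (some 2)) ∈ Ioo (-1) 1) :
    Real.cos (recTheta y) = y (.inl (some 2)) ∧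
      Real.sin (recTheta y) = √(1 - y (.inl (some 2)) ^ 2) := by
  set t := y (.inr 0)
  set z := y (.inl (some 2))
  have h1 : Real.cos (Real.arccos (Real.cos t)) = Real.cos t :=
    Real.cos_arccos (Real.neg_one_le_cos t) (Real.cos_le_one t)
  have h2 : Real.sin (Real.arccos (Real.cos t)) = Real.sin t := by
    rw [Real.sin_arccos, ← Real.sin_sq, Real.sqrt_sq hs.le]
  have h3 : Real.cos (t - Real.arccos (Real.cos t)) = 1 := by
    rw [Real.cos_sub, h1, h2, ← sq, ← sq, Real.cos_sq_add_sin_sq]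
  have h4 : Real.sin (t - Real.arccos (Real.cos t)) = 0 := by
    rw [Real.sin_sub, h1, h2, mul_comm, sub_self]
  have e : recTheta y = (t - Real.arccos (Real.cos t)) + Real.arccos z := by
    rw [recTheta]; ring
  rw [e, Real.cos_add, Real.sin_add, h3, h4, Real.cos_arccos h.1.le h.2.le, Real.sin_arccos]
  constructor <;> ring

/-- In the frame rotated by `φ₀` the horizontal part of `Ω` has coordinates `(A, B)` with `A > 0`,
so its azimuth relative to `φ₀` is `arctan (B / A)`. Its length is `√(1 - Ω₃²) = sin θ` by the unit
constraint. -/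
lemma direction_rec {y : Option (Fin 3) ⊕ Fin 2 → ℝ} {a b : ℝ} (hy : y ∈ recDomain a b)
    (hs : 0 < Real.sin (y (.inr 0))) (h1 : ∑ i : Fin 3, y (.inl (some i)) ^ 2 = 1) (i : Fin 3) :
    direction (recTheta y) (recPhi y) i = y (.inl (some i)) := by
  obtain ⟨-, hz, -, hA⟩ := hy
  obtain ⟨hc, hsn⟩ := sin_cos_recTheta hs hz
  set f := y (.inr 1) with hf
  set A := y (.inl (some 0)) * Real.cos f + y (.inl (some 1)) * Real.sin f with hAdef
  set B := y (.inl (some 1)) * Real.cos f - y (.inl (some 0)) * Real.sin f with hBdef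
  rw [Fin.sum_univ_three] at h1
  have hsc := Real.sin_sq_add_cos_sq f
  have hAB : 1 - y (.inl (some 2)) ^ 2 = A ^ 2 + B ^ 2 := by
    rw [hAdef, hBdef]
    linear_combination (-1) * h1 - (y (.inl (some 0)) ^ 2 + y (.inl (some 1)) ^ 2) * hsc
  have hr : √(1 - y (.inl (some 2)) ^ 2) = A * √(1 + (B / A) ^ 2) := by
    rw [hAB, ← Real.sqrt_sq hA.le, ← Real.sqrt_mul (sq_nonneg A), Real.sqrt_sq hA.le]
    congr 1
    field_simp
  have hpos : 0 < √(1 + (B / A) ^ 2) := Real.sqrt_pos.2 (by positivity)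
  have hphi : recPhi y = f + Real.arctan (B / A) := rfl
  have hC : Real.sin (recTheta y) * Real.cos (Real.arctan (B / A)) = A := by
    rw [hsn, hr, Real.cos_arctan]; field_simp
  have hS : Real.sin (recTheta y) * Real.sin (Real.arctan (B / A)) = B := by
    rw [hsn, hr, Real.sin_arctan]; field_simp
  fin_cases i
  · change Real.sin (recTheta y) * Real.cos (recPhi y) = y (.inl (some 0))
    rw [hphi, Real.cos_add]
    linear_combination Real.cos f * hC - Real.sin f * hS + y (.inl (some 0)) * hsc
  · change Real.sin (recTheta y) * Real.sin (recPhi y) = y (.inl (some 1))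
    rw [hphi, Real.sin_add]
    linear_combination Real.sin f * hC + Real.cos f * hS + y (.inl (some 1)) * hsc
  · exact hc

/-- The arguments of the functions recovering density and angles. -/
def recArg (u : Option (Fin 3) → C(Torus, ℝ)) (θ₀ φ₀ : C(Torus, ℝ)) :
    Option (Fin 3) ⊕ Fin 2 → C(Torus, ℝ) := Sum.elim u ![θ₀, φ₀]

/-- A solution of the symmetric system gives a solution of the original system, as long as density
and angles can be recovered. -/
lemma isSolution_of_symmetric {c m T α β : ℝ} {p q R : ℝ → ℝ} {M : ℝ≥0}
    {ρ₀ θ₀ φ₀ : C(Torus, ℝ)}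
    (hp : ContDiffOn ℝ ∞ p (Ioi 0)) (hp' : ∀ r, 0 < r → 0 < deriv p r) (hm : 5 / 2 < m)
    (hθ₀ : MemH m θ₀) (hφ₀ : MemH m φ₀)
    (hθ₀s : ∀ x, 0 < Real.sin (θ₀ x)) (hα : 0 < α)
    (hRc : ContDiffOn ℝ ∞ R (Ioo (potential p α) (potential p β)))
    (hR : ∀ y ∈ Ioo (potential p α) (potential p β), R y ∈ Ioo α β ∧ potential p (R y) = y)
    (hRr : ∀ r, 0 < r → R (potential p r) = r) (hqc : ContDiff ℝ ∞ q)
    (hq : ∀ r ∈ Icc α β, q (potential p r) = √(deriv p r)) (hρ₀ : ∀ x, 0 < ρ₀ x)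
    {u : ℝ → Option (Fin 3) → C(Torus, ℝ)} (hu0 : u 0 = state p ρ₀ θ₀ φ₀)
    (hM : ∀ t ∈ Icc 0 T, ∀ a, sobolevNormSq m (u t a) ≤ M)
    (hd : ∀ t ∈ Icc 0 T, ∀ a, HasDerivWithinAt (fun t => u t a) (-Bop (symA c q) (u t) a)
      (Icc 0 T) t)
    (hB : ∀ a, ContinuousOn (fun t => Bop (symA c q) (u t) a) (Icc 0 T)) (hT : 0 < T)
    (hdom : ∀ t ∈ Icc 0 T, recArg (u t) θ₀ φ₀ ∈ Adm (recDomain (potential p α) (potential p β))) :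
    ∃ ρ θ φ : ℝ → C(Torus, ℝ), IsSolution c p m T ρ₀ θ₀ φ₀ ρ θ φ ∧
      ∀ t ∈ Icc 0 T, ∀ x, 0 < Real.sin (θ t x) := by
  -- The reference angles are appended as components constant in time, so density and angles become
  -- one smooth function composed with an admissible curve.
  set v : ℝ → Option (Fin 3) ⊕ Fin 2 → C(Torus, ℝ) := fun t => recArg (u t) θ₀ φ₀ with hv
  set v' : ℝ → Option (Fin 3) ⊕ Fin 2 → C(Torus, ℝ) :=
    fun t => Sum.elim (fun a => -Bop (symA c q) (u t) a) 0 with hv'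
  have hA := fun j a b => contDiff_symA c hqc j a b
  have hRc' : ContDiffOn ℝ ∞ (fun y : Option (Fin 3) ⊕ Fin 2 → ℝ => R (y (.inl none)))
      (recDomain (potential p α) (potential p β)) :=
    hRc.comp (contDiff_apply ℝ ℝ _).contDiffOn fun y hy => hy.1
  have hθc := contDiffOn_recTheta (potential p α) (potential p β)
  have hφc := contDiffOn_recPhi (potential p α) (potential p β)
  have hUo := isOpen_recDomain (potential p α) (potential p β)
  have hvd : ∀ t ∈ Icc 0 T, ∀ a, HasDerivWithinAt (fun t => v t a) (v' t a) (Icc 0 T) t := by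
    rintro t ht (a | i)
    · exact hd t ht a
    · exact hasDerivWithinAt_const _ _ _
  have hvc : ∀ a, ContinuousOn (fun t => v' t a) (Icc 0 T) := by
    rintro (a | i)
    · exact (hB a).neg
    · exact continuousOn_const
  obtain ⟨C, hC⟩ := exists_sobolev_Bop_le hm hA M
  have hvM : ∀ t ∈ Icc 0 T, ∀ a, sobolevNormSq m (v t a) ≤
      (M + (sobolevNormSq m θ₀).toNNReal + (sobolevNormSq m φ₀).toNNReal : ℝ≥0) := by
    rintro t ht (a | i)
    · refine (hM t ht a).trans ?_
      push_cast; rw [add_assoc]; exact le_self_add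
    · push_cast
      rw [ENNReal.coe_toNNReal hθ₀.ne, ENNReal.coe_toNNReal hφ₀.ne]
      fin_cases i
      · exact le_add_self.trans le_self_add
      · exact le_add_self
  have hvM' : ∀ t ∈ Icc 0 T, ∀ a, sobolevNormSq (m - 1) (v' t a) ≤ C := by
    rintro t ht (a | i)
    · change sobolevNormSq (m - 1) (-Bop (symA c q) (u t) a) ≤ C
      rw [sobolevNormSq_neg]; exact hC _ (hM t ht) a
    · change sobolevNormSq (m - 1) 0 ≤ C
      rw [sobolevNormSq_zero]; exact zero_le
  have hcls : ∀ F, ContDiffOn ℝ ∞ F (recDomain (potential p α) (potential p β)) →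
      InSolutionClass T m (fun t => nem F (v t)) := fun F hF =>
    inSolutionClass_nem hm hUo hF hvd hvc hvM hvM' hdom
  set ρ : ℝ → C(Torus, ℝ) := fun t => nem (fun y => R (y (.inl none))) (v t) with hρ
  set θ : ℝ → C(Torus, ℝ) := fun t => nem recTheta (v t) with hθ
  set φ : ℝ → C(Torus, ℝ) := fun t => nem recPhi (v t) with hφ
  have hρx : ∀ t ∈ Icc 0 T, ∀ x, ρ t x = R (u t none x) := fun t ht x =>
    nem_apply hRc'.continuousOn (hdom t ht) x
  have hθx : ∀ t ∈ Icc 0 T, ∀ x, θ t x = recTheta (ev (v t) x) := fun t ht x =>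
    nem_apply hθc.continuousOn (hdom t ht) x
  have hφx : ∀ t ∈ Icc 0 T, ∀ x, φ t x = recPhi (ev (v t) x) := fun t ht x =>
    nem_apply hφc.continuousOn (hdom t ht) x
  have hRx : ∀ t ∈ Icc 0 T, ∀ x, ρ t x ∈ Ioo α β ∧ potential p (ρ t x) = u t none x :=
    fun t ht x => by rw [hρx t ht x]; exact hR _ (hdom t ht x).1
  have hpos : ∀ t ∈ Icc 0 T, ∀ x, 0 < ρ t x := fun t ht x => hα.trans (hRx t ht x).1.1
  have hunit := sum_sq_eq_one_of_symmetric hm hqc hM hd fun x => by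
    simp only [hu0, state_some_apply]; exact sum_direction_sq _ _
  have hdir : ∀ t ∈ Icc 0 T, ∀ x i, directionField (θ t) (φ t) x i = u t (some i) x :=
    fun t ht x i => by
      rw [directionField, hθx t ht x, hφx t ht x]
      exact direction_rec (hdom t ht x) (hθ₀s x) (hunit t ht x) i
  -- The recovered density and angles reproduce `u`; hence both original equations reduce to rows of
  -- the symmetric system.
  have hst : ∀ t ∈ Icc 0 T, state p (ρ t) (θ t) (φ t) = u t := fun t ht => by
    funext a
    ext x
    rcases a with _ | i
    · rw [state_none_apply hp hp' (hpos t ht), (hRx t ht x).2]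
    · rw [state_some_apply, hdir t ht x i]
  have hud : ∀ t ∈ Ioo 0 T, ∀ a x, HasDerivAt (fun s => u s a x)
      (-Bop (symA c q) (u t) a x) t := fun t ht a x =>
    hasDerivAt_apply_of_curve ht (v' := fun t a => -Bop (symA c q) (u t) a)
      (hd t (Ioo_subset_Icc_self ht)) a x
  have h0T : (0 : ℝ) ∈ Icc 0 T := ⟨le_rfl, hT.le⟩
  have hu0x : ∀ x i, u 0 (some i) x = direction (θ₀ x) (φ₀ x) i := fun x i => by
    rw [hu0, state_some_apply]; rfl
  refine ⟨ρ, θ, φ, ⟨hcls _ hRc', hcls _ hθc, hcls _ hφc, ?_, ?_, ?_, hpos, ?_, ?_⟩,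
    fun t ht x => ?_⟩
  · ext x
    rw [hρx 0 h0T, hu0, state_none_apply hp hp' hρ₀, hRr _ (hρ₀ x)]
  · ext x
    rw [hθx 0 h0T]
    change θ₀ x + (Real.arccos (u 0 (some 2) x) - Real.arccos (Real.cos (θ₀ x))) = θ₀ x
    rw [hu0x]
    exact add_eq_left.2 (sub_self _)
  · ext x
    rw [hφx 0 h0T]
    change φ₀ x + Real.arctan ((u 0 (some 1) x * Real.cos (φ₀ x) - u 0 (some 0) x *
      Real.sin (φ₀ x)) / _) = φ₀ x
    rw [hu0x, hu0x]
    have h1 : direction (θ₀ x) (φ₀ x) 1 * Real.cos (φ₀ x) -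
        direction (θ₀ x) (φ₀ x) 0 * Real.sin (φ₀ x) = 0 := by
      simp only [direction, Matrix.cons_val_zero, Matrix.cons_val_one]; ring
    rw [h1, zero_div, Real.arctan_zero, add_zero]
  · filter_upwards [(hcls _ hRc').2.1.2.choose_spec, (hcls _ hθc).2.1.2.choose_spec,
      (hcls _ hφc).2.1.2.choose_spec, ae_restrict_mem measurableSet_Ioo] with t h1 h2 h3 ht x
    have ht' := Ioo_subset_Icc_self ht
    have hrt := hasDerivAt_nem hUo hRc' ht hdom
      fun a => hasDerivAt_apply_of_curve ht (hvd t ht') a x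
    refine ⟨_, hrt, ?_⟩
    rw [mass_iff_symmetric (q := q) (c := c) hp hp' hm (h1.trans_lt ENNReal.coe_lt_top)
      (h2.trans_lt ENNReal.coe_lt_top) (h3.trans_lt ENNReal.coe_lt_top) (hpos t ht')
      (hq _ (Ioo_subset_Icc_self (hRx t ht' x).1)), hst t ht',
      ← Bop_apply fun j a b => (hA j a b).continuous, ← eq_neg_iff_add_eq_zero]
    -- The time derivative of `potential p ρ = u none` computed in two ways.
    refine ((hasDerivAt_potential hp hp' (hpos t ht' x)).comp t hrt).unique
      ((hud t ht none x).congr_of_eventuallyEq ?_)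
    filter_upwards [Icc_mem_nhds ht.1 ht.2] with s hs
    exact (hRx s hs x).2
  · filter_upwards [(hcls _ hRc').2.1.2.choose_spec, (hcls _ hθc).2.1.2.choose_spec,
      (hcls _ hφc).2.1.2.choose_spec, ae_restrict_mem measurableSet_Ioo] with t h1 h2 h3 ht x
    have ht' := Ioo_subset_Icc_self ht
    refine ⟨fun i => -Bop (symA c q) (u t) (some i) x, hasDerivAt_pi.2 fun i => ?_, ?_⟩
    · refine (hud t ht (some i) x).congr_of_eventuallyEq ?_
      filter_upwards [Icc_mem_nhds ht.1 ht.2] with s hs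
      exact hdir s hs x i
    · rw [momentum_iff_symmetric (q := q) (c := c) hp hp' hm (h1.trans_lt ENNReal.coe_lt_top)
        (h2.trans_lt ENNReal.coe_lt_top) (h3.trans_lt ENNReal.coe_lt_top) (hpos t ht')
        (hq _ (Ioo_subset_Icc_self (hRx t ht' x).1)), hst t ht']
      intro i
      rw [← Bop_apply fun j a b => (hA j a b).continuous, neg_add_cancel]
  · rw [hθx t ht x, (sin_cos_recTheta (y := ev (v t) x) (hθ₀s x) (hdom t ht x).2.1).2]
    have h1 : u t (some 2) x ∈ Ioo (-1) 1 := (hdom t ht x).2.1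
    exact Real.sqrt_pos.2 (by
      change 0 < 1 - u t (some 2) x ^ 2
      nlinarith [h1.1, h1.2])

/-- Local existence. -/
lemma exists_isSolution {c m : ℝ} {p : ℝ → ℝ} {ρ₀ θ₀ φ₀ : C(Torus, ℝ)}
    (hp : ContDiffOn ℝ ∞ p (Ioi 0)) (hp' : ∀ r, 0 < r → 0 < deriv p r) (hm : 5 / 2 < m)
    (hρ₀ : MemH m ρ₀) (hθ₀ : MemH m θ₀) (hφ₀ : MemH m φ₀) (hρ₀_pos : ∀ x, 0 < ρ₀ x)
    (hθ₀_pos : ∀ x, 0 < Real.sin (θ₀ x)) :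
    ∃ T, 0 < T ∧ ∃ ρ θ φ : ℝ → C(Torus, ℝ), IsSolution c p m T ρ₀ θ₀ φ₀ ρ θ φ ∧
      ∀ t ∈ Icc 0 T, ∀ x, 0 < Real.sin (θ t x) := by
  obtain ⟨α, β, hα, hαβ⟩ := exists_density_bounds (T := 0) le_rfl (ρ := fun _ => ρ₀)
    continuousOn_const fun _ _ => hρ₀_pos
  -- The range is widened so that the initial density lies in an open interval, leaving room for a
  -- short time.
  have hρ₀b : ∀ x, ρ₀ x ∈ Ioo (α / 2) (β + 1) := fun x => by
    have h := hαβ 0 (by simp) x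
    exact ⟨by linarith [h.1], by linarith [h.2]⟩
  have hα2 : 0 < α / 2 := half_pos hα
  obtain ⟨R, q, hRc, hR, hRr, hqc, hq⟩ := exists_inverse_potential hp hp' hα2
    ((hρ₀b 0).1.trans (hρ₀b 0).2)
  have hu₀ : ∀ a, MemH m (state p ρ₀ θ₀ φ₀ a) := fun a =>
    memH_nem hm isOpen_posDensity (contDiffOn_stateFun hp hp' a) (mem_adm_posDensity hρ₀_pos)
      fun b => by
        fin_cases b
        · exact hρ₀
        · exact hθ₀
        · exact hφ₀
  obtain ⟨T, hT, M, u, hu0, hM, hd, hB⟩ := exists_solution_symmetric hm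
    (fun j a b => contDiff_symA c hqc j a b) (symA_symm c q) hu₀
  set U := recDomain (potential p (α / 2)) (potential p (β + 1)) with hU
  have hv0 : recArg (u 0) θ₀ φ₀ ∈ Adm U := fun x => by
    have hmono := strictMonoOn_potential hp hp'
    have hi : ∀ i, u 0 (some i) x = direction (θ₀ x) (φ₀ x) i := fun i => by
      rw [hu0, state_some_apply]; rfl
    have hs := hθ₀_pos x
    have hcos : Real.cos (θ₀ x) ∈ Ioo (-1) 1 := by
      have := Real.sin_sq_add_cos_sq (θ₀ x)
      exact abs_lt.1 ((sq_lt_one_iff_abs_lt_one _).1 (by nlinarith))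
    refine ⟨?_, ?_, hcos, ?_⟩
    · change u 0 none x ∈ _
      rw [hu0, state_none_apply hp hp' hρ₀_pos]
      exact ⟨hmono hα2 (hρ₀_pos x) (hρ₀b x).1,
        hmono (hρ₀_pos x) ((hρ₀_pos x).trans (hρ₀b x).2) (hρ₀b x).2⟩
    · change u 0 (some 2) x ∈ _
      rw [hi]; exact hcos
    · change 0 < u 0 (some 0) x * Real.cos (φ₀ x) + u 0 (some 1) x * Real.sin (φ₀ x)
      rw [hi, hi]
      -- Initially the denominator in the azimuth formula is `sin θ₀`; this is where `sin θ₀ > 0`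
      -- puts the data into the recovery domain.
      have e : direction (θ₀ x) (φ₀ x) 0 * Real.cos (φ₀ x) +
          direction (θ₀ x) (φ₀ x) 1 * Real.sin (φ₀ x) = Real.sin (θ₀ x) := by
        simp only [direction, Matrix.cons_val_zero, Matrix.cons_val_one]
        linear_combination Real.sin (θ₀ x) * Real.sin_sq_add_cos_sq (φ₀ x)
      rw [e]; exact hs
  have hvc : ContinuousWithinAt (fun t => recArg (u t) θ₀ φ₀) (Icc 0 T) 0 :=
    continuousWithinAt_pi.2 fun a => by
      rcases a with a | i
      · exact continuousWithinAt_pi.1 (hd 0 ⟨le_rfl, hT.le⟩).continuousWithinAt a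
      · exact continuousWithinAt_const
  have hev := hvc.eventually ((isOpen_adm (isOpen_recDomain _ _)).mem_nhds hv0)
  obtain ⟨ε, hε, hball⟩ := Metric.mem_nhdsWithin_iff.1 hev
  -- The time is shortened until the curve stays in the open recovery domain; `ε / 2` keeps the
  -- endpoint strictly inside the ball.
  have hTs : Icc 0 (min T (ε / 2)) ⊆ Icc 0 T := Icc_subset_Icc_right (min_le_left _ _)
  have hT' : 0 < min T (ε / 2) := lt_min hT (half_pos hε)
  refine ⟨_, hT', isSolution_of_symmetric hp hp' hm hθ₀ hφ₀ hθ₀_pos hα2 hRc hR hRr hqc hq hρ₀_pos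
    hu0 (fun t ht => hM t (hTs ht))
    (fun t ht a => (hasDerivWithinAt_pi.1 (hd t (hTs ht)) a).mono hTs)
    (fun a => (hB a).mono hTs) hT' fun t ht => hball ⟨?_, hTs ht⟩⟩
  rw [Metric.mem_ball, Real.dist_eq, sub_zero, abs_of_nonneg ht.1]
  exact (ht.2.trans (min_le_right _ _)).trans_lt (half_lt_self hε)

end SelfAlign
end

/-! ### Existence and uniqueness combined. -/

theorem mainTheorem2 (c : ℝ) (p : ℝ → ℝ)
    (hp : ContDiffOn ℝ ∞ p (Ioi 0)) (hp' : ∀ r, 0 < r → 0 < deriv p r)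
    (m : ℝ) (hm : 5 / 2 < m)
    (ρ₀ θ₀ φ₀ : C(SelfAlign.Torus, ℝ))
    (hρ₀ : SelfAlign.MemH m ρ₀) (hθ₀ : SelfAlign.MemH m θ₀) (hφ₀ : SelfAlign.MemH m φ₀)
    (hρ₀_pos : ∀ x, 0 < ρ₀ x) (hθ₀_pos : ∀ x, 0 < Real.sin (θ₀ x)) :
    ∃ T : ℝ, 0 < T ∧ ∃ ρ θ φ : ℝ → C(SelfAlign.Torus, ℝ),
      SelfAlign.IsSolution c p m T ρ₀ θ₀ φ₀ ρ θ φ ∧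
      (∀ t ∈ Icc 0 T, ∀ x, 0 < Real.sin (θ t x)) ∧
      ∀ ρ' θ' φ' : ℝ → C(SelfAlign.Torus, ℝ),
        SelfAlign.IsSolution c p m T ρ₀ θ₀ φ₀ ρ' θ' φ' →
        ∀ t ∈ Icc 0 T, ρ' t = ρ t ∧ θ' t = θ t ∧ φ' t = φ t := by
  obtain ⟨T, hT, ρ, θ, φ, hsol, hsin⟩ :=
    SelfAlign.exists_isSolution hp hp' hm hρ₀ hθ₀ hφ₀ hρ₀_pos hθ₀_pos
  exact ⟨T, hT, ρ, θ, φ, hsol, hsin, fun ρ' θ' φ' h' => hsol.unique hp hp' hm hT h' hsin⟩
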